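/- **Setting.** Fix $g\in\mathbb S^2$, $\lambda>0$, $T>0$, $K>9$. For a probability measure $h$ on $\mathbb R^3\times\mathbb R^3$ write $M_k[h]=\int|v|^k\,dh(x,v)$ and $\rho[h]=\int h\,dv$; $\|\cdot\|_p$ is the norm of $L^p(\mathbb R^3)$, and $\dot H^1(\mathbb R^3)=\{w\in L^6:\nabla w\in L^2\}$. Given $f^0\in\mathcal P(\mathbb R^3\times\mathbb R^3)\cap L^\infty$ with $M_K[f^0]<\infty$, a solution on $[0,T]$ of the Vlasov–Stokes equation with initial datum $f^0$ is a pair $(f,u)$ with $$\partial_t f+v\cdot\nabla_x f+\lambda\,\mathrm{div}_v\big((g+u-v)f\big)=0,\qquad f(0)=f^0,$$ $$-\Delta u+\nabla p=\int (v-u)f\,dv,\qquad \mathrm{div}\,u=0\ \text{ in }\mathbb R^3,$$ where $f\in L^\infty((0,T)\times\mathbb R^3\times\mathbb R^3)$ is a curve of probability measures on $[0,T]$ that is continuous for the $2$-Wasserstein distance, $\sup_{t\in(0,T)}M_K[f(t)]<\infty$, $u\in L^\infty(0,T;W^{1,\infty}(\mathbb R^3))\cap C([0,T]\times\mathbb R^3)$,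 the first equation holds in the sense of distributions on $(0,T)\times\mathbb R^3\times\mathbb R^3$, and for almost every $t$ the function $u(t)\in\dot H^1(\mathbb R^3)$ is the weak solution of the second one, i.e. $u(t)$ is divergence free and $\int\nabla u(t):\nabla\varphi\,dx=\int (v-u(t,x))\cdot\varphi(x)\,df(t)(x,v)$ for all divergence-free $\varphi\in\dot H^1(\mathbb R^3)$. Its characteristics $(X,V)$ are given, for $s,t\in[0,T]$, by $$\dot X(t;s,x,v)=V(t;s,x,v),\qquad \dot V(t;s,x,v)=\lambda\big(g+u(t,X(t;s,x,v))-V(t;s,x,v)\big),\qquad (X,V)(s;s,x,v)=(x,v).$$ **Proposition.** For every $q>4$ and all $A_1,A_2,B,M\in[0,\infty)$ there are constants $c>0$ and $C<\infty$, depending only on $q,A_1,A_2,B,M$, such that the following holds for all $K>9$, $\lambda>0$, $T>0$ and $g\in\mathbb S^2$. For $i=1,2$ let $f_i^0\in\mathcal P(\mathbb R^3\times\mathbb R^3)\cap L^\infty(\mathbb R^3\times\mathbb R^3)$ with $M_K[f_i^0]<\infty$, let $(f_i,u_i)$ be a solution on $[0,T]$ with initial datum $f_i^0$, and let $(X_i,V_i)$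 be its characteristics. Let $\gamma_0$ be a transport plan between $f_1^0$ and $f_2^0$ (a measure with these marginals) with $\int|x_1-x_2|^2\,d\gamma_0<\infty$, and set $$\mathcal H(t)=\frac12\int|X_1(t;0,x_1,v_1)-X_2(t;0,x_2,v_2)|^2\,d\gamma_0(x_1,v_1,x_2,v_2),$$ $$\mathcal E(t)=\frac12\int|V_1(t;0,x_1,v_1)-V_2(t;0,x_2,v_2)|^2\,d\gamma_0(x_1,v_1,x_2,v_2).$$ Then, for every $t\in[0,T]$, $\mathcal H(t)$ and $\mathcal E(t)$ are finite, $\mathcal H$ and $\mathcal E$ are differentiable at $t$ (one-sidedly at $t=0$ and $t=T$), and $$\frac{d}{dt}\mathcal H(t)\le 2\,\mathcal E^{1/2}(t)\,\mathcal H^{1/2}(t);$$ if moreover $\|\rho[f_1](t)\|_q\le A_1$, $\|\rho[f_2](t)\|_q\le A_2$, $\|u_2(t)\|_{W^{1,\infty}}\le B$ and $M_9[f_2(t)]\le M$ at this time $t$, then $$\frac{d}{dt}\mathcal E(t)\le\lambda\left(-c\,\mathcal E(t)+C\,\mathcal E^{1/2}(t)\,\mathcal H^{1/2}(t)\right).$$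 -/

import Mathlib

open MeasureTheory Set Filter Topology
open scoped ENNReal NNReal ContDiff

noncomputable section

namespace VlasovStokes

/-- Physical space (also the space of velocities). -/
abbrev Space : Type := EuclideanSpace ℝ (Fin 3)

/-- Phase space: pairs (position, velocity). -/
abbrev Phase : Type := Space × Space

/-! ### Densities, moments, transport plans, Wasserstein distance -/

/-- The measure `μ` has a density in `L^∞` with respect to Lebesgue measure, with norm at most `M`. -/
def DensityBoundedBy {α : Type*} [MeasureSpace α] (μ : Measure α) (M : ℝ≥0) : Prop :=
  μ ≤ (M : ℝ≥0∞) • (volume : Measure α)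

/-- The spatial density `ρ[h] = ∫ h dv`, as a measure. -/
def spatialDensity (h : Measure Phase) : Measure Space := h.map Prod.fst

/-- The velocity moment `M_k[h] = ∫ |v|^k dh(x,v)`. -/
def moment (k : ℝ) (h : Measure Phase) : ℝ≥0∞ := ∫⁻ z, ‖z.2‖ₑ ^ k ∂h

open Classical in
/-- The `L^q` norm of the Lebesgue density of `ρ`; it is `∞` if `ρ` has no density. -/
def lqNorm (q : ℝ≥0∞) (ρ : Measure Space) : ℝ≥0∞ :=
  if ρ ≪ volume then eLpNorm (ρ.rnDeriv volume) q volume else ∞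

/-- `γ` is a transport plan between `μ` and `ν`. -/
def IsTransportPlan (γ : Measure (Phase × Phase)) (μ ν : Measure Phase) : Prop :=
  γ.map Prod.fst = μ ∧ γ.map Prod.snd = ν

/-- The `2`-Wasserstein distance on phase space, for the Euclidean distance
`(|x₁ - x₂|² + |v₁ - v₂|²)^{1/2}`. -/
def wasserstein (μ ν : Measure Phase) : ℝ≥0∞ :=
  (⨅ (γ : Measure (Phase × Phase)) (_ : IsTransportPlan γ μ ν),
    ∫⁻ z, (‖z.1.1 - z.2.1‖ₑ ^ 2 + ‖z.1.2 - z.2.2‖ₑ ^ 2) ∂γ) ^ (1 / 2 : ℝ)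

/-! ### Weak derivatives -/

/-- `G` is the weak (distributional) gradient of the vector field `w` on `ℝ³`:
`G x e` is the derivative of `w` at `x` in the direction `e`. -/
structure HasWeakGradient (w : Space → Space) (G : Space → Space →L[ℝ] Space) : Prop where
  locallyIntegrable : LocallyIntegrable w volume
  locallyIntegrable_grad : LocallyIntegrable G volume
  integral_eq : ∀ φ : Space → ℝ, ContDiff ℝ ∞ φ → HasCompactSupport φ → ∀ e : Space,
    ∫ x, (fderiv ℝ φ x e) • w x = - ∫ x, φ x • G x e

/-- The norm of `W^{1,∞}(ℝ³)`, equal to `∞` outside that space. The weak gradient is unique up to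
null sets, so that the infimum below is its `L^∞` norm. -/
def w1InfNorm (w : Space → Space) : ℝ≥0∞ :=
  eLpNorm w ∞ volume +
    ⨅ (G : Space → Space →L[ℝ] Space) (_ : HasWeakGradient w G), eLpNorm G ∞ volume

/-- `w` is a divergence-free element of `Ḣ¹(ℝ³) = {w ∈ L⁶ : ∇w ∈ L²}` with gradient `G`. -/
structure IsDivFreeDotH1 (w : Space → Space) (G : Space → Space →L[ℝ] Space) : Prop where
  hasWeakGradient : HasWeakGradient w G
  memLp : MemLp w 6 volume
  memLp_grad : MemLp G 2 volume
  div_eq_zero : ∀ᵐ x : Space, ∑ i : Fin 3, (G x (EuclideanSpace.single i 1)) i = 0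

/-- The Frobenius product `A : B`. -/
def frobenius (A B : Space →L[ℝ] Space) : ℝ :=
  ∑ i : Fin 3, inner ℝ (A (EuclideanSpace.single i 1)) (B (EuclideanSpace.single i 1))

/-- `u ∈ Ḣ¹(ℝ³)` is the weak solution of
`-Δu + ∇p = ∫ (v - u) h dv`, `div u = 0` in `ℝ³`
(the pressure disappears because the test functions are divergence free). -/
def IsWeakFluidVelocity (h : Measure Phase) (u : Space → Space) : Prop :=
  ∃ G : Space → Space →L[ℝ] Space, IsDivFreeDotH1 u G ∧
    ∀ (φ : Space → Space) (Gφ : Space → Space →L[ℝ] Space), IsDivFreeDotH1 φ Gφ →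
      ∫ x, frobenius (G x) (Gφ x) = ∫ z, inner ℝ (z.2 - u z.1) (φ z.1) ∂h

/-! ### The Vlasov–Stokes equation -/

/-- `(f, u)` is a weak solution on `[0,T]` of the Vlasov–Stokes equation
`∂ₜ f + v · ∇ₓ f + lam div_v ((g + u - v) f) = 0`,
`-Δu + ∇p = ∫ (v - u) f dv`, `div u = 0`, `f(0) = f₀`,
in the class `f ∈ L^∞ ∩ C([0,T]; W₂)`, `sup M_K[f] < ∞`, `u ∈ L^∞(0,T; W^{1,∞}) ∩ C`. -/
structure IsVlasovStokesSolution (K lam T : ℝ) (g : Space) (f₀ : Measure Phase)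
    (f : ℝ → Measure Phase) (u : ℝ → Space → Space) : Prop where
  isProbabilityMeasure : ∀ t ∈ Icc 0 T, IsProbabilityMeasure (f t)
  initial : f 0 = f₀
  bounded : ∃ M : ℝ≥0, ∀ᵐ t, t ∈ Ioo 0 T → DensityBoundedBy (f t) M
  continuous_wasserstein : ∀ t ∈ Icc 0 T,
    Tendsto (fun s => wasserstein (f s) (f t)) (𝓝[Icc 0 T] t) (𝓝 0)
  moment_bounded : ∃ M : ℝ≥0, ∀ t ∈ Ioo 0 T, moment K (f t) ≤ M
  velocity_bounded : ∃ M : ℝ≥0, ∀ᵐ t, t ∈ Ioo 0 T → w1InfNorm (u t) ≤ M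
  velocity_continuous : ContinuousOn (fun p : ℝ × Space => u p.1 p.2) (Icc 0 T ×ˢ univ)
  /-- The Vlasov equation in the sense of distributions on `(0,T) × ℝ³ × ℝ³`. The derivative of `φ`
  in the direction `(1, v, lam (g + u - v))` is
  `∂ₜφ + v · ∇ₓφ + lam (g + u - v) · ∇ᵥφ`. -/
  vlasov : ∀ φ : ℝ × Space × Space → ℝ, ContDiff ℝ ∞ φ → HasCompactSupport φ →
    tsupport φ ⊆ Ioo 0 T ×ˢ univ →
    ∫ t in Ioo 0 T, ∫ z, fderiv ℝ φ (t, z.1, z.2)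
      (1, z.2, lam • (g + u t z.1 - z.2)) ∂(f t) = 0
  fluid : ∀ᵐ t, t ∈ Ioo 0 T → IsWeakFluidVelocity (f t) (u t)

/-- `(X, V)` are the characteristics on `[0,T]` associated with the fluid velocity `u`;
`X t s x v` and `V t s x v` are position and velocity at time `t` of the trajectory which at
time `s` has position `x` and velocity `v`. -/
structure IsCharacteristics (lam T : ℝ) (g : Space) (u : ℝ → Space → Space)
    (X V : ℝ → ℝ → Space → Space → Space) : Prop where
  position_initial : ∀ s ∈ Icc 0 T, ∀ x v, X s s x v = x
  velocity_initial : ∀ s ∈ Icc 0 T, ∀ x v, V s s x v = v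
  position_deriv : ∀ s ∈ Icc 0 T, ∀ x v, ∀ t ∈ Icc 0 T,
    HasDerivWithinAt (fun τ => X τ s x v) (V t s x v) (Icc 0 T) t
  velocity_deriv : ∀ s ∈ Icc 0 T, ∀ x v, ∀ t ∈ Icc 0 T,
    HasDerivWithinAt (fun τ => V τ s x v)
      (lam • (g + u t (X t s x v) - V t s x v)) (Icc 0 T) t

/-- The squared distance at time `t` of the values of `Y₁, Y₂` along trajectories started at
time `0`; used with positions and with velocities. -/
def sqDiff (Y₁ Y₂ : ℝ → ℝ → Space → Space → Space) (t : ℝ) (z : Phase × Phase) : ℝ :=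
  ‖Y₁ t 0 z.1.1 z.1.2 - Y₂ t 0 z.2.1 z.2.2‖ ^ 2

/-- `(1/2) ∫ |Y₁(t;0,x₁,v₁) - Y₂(t;0,x₂,v₂)|² dγ₀(x₁,v₁,x₂,v₂)`: this is `ℋ(t)` for positions and
`ℰ(t)` for velocities. -/
def halfMeanSq (γ₀ : Measure (Phase × Phase)) (Y₁ Y₂ : ℝ → ℝ → Space → Space → Space)
    (t : ℝ) : ℝ :=
  1 / 2 * ∫ z, sqDiff Y₁ Y₂ t z ∂γ₀

end VlasovStokes

end

open VlasovStokes

noncomputable section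

namespace VlasovStokes

/-! ### Flows of Lipschitz vector fields -/

section Flow

variable {E : Type*} [NormedAddCommGroup E] [NormedSpace ℝ E]

/-! Differentiating along characteristics and applying Cauchy–Schwarz settles the estimate for `ℋ`.
For `ℰ`, the derivative is `λ(∫ D·(u₁(X₁) - u₂(X₂)) - ∫ |D|²)` with `D = V₁ - V₂`. The task is to
bound the first integral by `θ ∫ |D|²` with `θ < 1`, up to an error linear in the `L²(γ₀)` norms of
`D` and of `X₁ - X₂`. Lipschitz bounds alone cannot give this, since `u₁ - u₂` itself depends on
`D`; the dissipative structure of the Stokes operator is needed.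

Put `W = u₁(X₁) - u₂(X₁)`, `r = u₂(X₁) - u₂(X₂)` and `Fᵢ = Vᵢ - uᵢ(Xᵢ)`, so that `F₁ - F₂ = D - (W +
r)`. Each velocity is the Stokeslet potential of its forces, hence, up to the constant `blobMass`,
`W = y + e`: `y` is the potential along `X₁` of `F₁ - F₂` placed at `X₁`, and `e` is the effect of
moving the centres of `F₂` from `X₂` to `X₁`. The map `F₁ - F₂ ↦ y` is a bounded, self-adjoint,
nonnegative operator on `L²(γ₀)`, hence co-coercive
(`SingularBound.integral_sq_stokesPotential_le`). The relation `F₁ - F₂ = D - (W + r)` then forces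
`W` to be, up to `r` and `e`, strictly shorter than `D` (`inner_add_le_of_coercive`). The term `r`
is controlled by the Lipschitz bound on `u₂`, and `e` by
`SingularBound.lintegral_sq_displacement_le`.

The exponents are tied together there: the kernel difference behaves like `|x|⁻²`, and a ninth
moment of the force trades it for `|x|^(-9/4)`. That power is integrable against `ρ ∈ L^q` uniformly
in the centre when `q > 4`, since the conjugate exponent is then below `4/3` and `9/4 · 4/3 = 3`.

Two facts support this. A distributional solution is the push-forward of its initial datum by the
characteristics (`IsLipschitzFlow.eq_map`), proved by duality with functions constant along the
flow. And the potential formula for `u` holds at every time, not just almost every one: testing the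
weak Stokes equation with a smooth divergence-free regularized Stokeslet gives a formula continuous
in time, and the regularization is removed afterwards at the fixed time. The same regularization
writes the Stokes energy as a limit of nonnegative multiples of Dirichlet integrals, hence its
positivity. -/

lemma norm_right_le_of_norm_deriv_le {f f' : ℝ → E} {K a b : ℝ} (hK : 0 < K) (hab : a ≤ b)
    (hf : ∀ t ∈ Icc a b, HasDerivWithinAt f (f' t) (Icc a b) t)
    (hb : ∀ t ∈ Icc a b, ‖f' t‖ ≤ K * (1 + ‖f t‖)) :
    ‖f b‖ ≤ (1 + ‖f a‖) * Real.exp (K * (b - a)) := by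
  have h := norm_le_gronwallBound_of_norm_deriv_right_le (f := f) (f' := f') (δ := ‖f a‖) (K := K)
    (ε := K) (a := a) (b := b) (fun t ht => (hf t ht).continuousWithinAt)
    (fun t ht => (hf t (Ico_subset_Icc_self ht)).mono_of_mem_nhdsWithin
      (Icc_mem_nhdsGE_of_mem ht)) le_rfl
    (fun t ht => (hb t (Ico_subset_Icc_self ht)).trans (by linarith)) b ⟨hab, le_rfl⟩
  rw [gronwallBound_of_K_ne_0 hK.ne', div_self hK.ne'] at h
  linarith

/-- Time reversal `s ↦ a + b - s` applied to the forward bound. It shows that a trajectory ending in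
a bounded set started in one, which makes pullbacks along the flow compactly supported in space. -/
lemma norm_left_le_of_norm_deriv_le {f f' : ℝ → E} {K a b : ℝ} (hK : 0 < K) (hab : a ≤ b)
    (hf : ∀ t ∈ Icc a b, HasDerivWithinAt f (f' t) (Icc a b) t)
    (hb : ∀ t ∈ Icc a b, ‖f' t‖ ≤ K * (1 + ‖f t‖)) :
    ‖f a‖ ≤ (1 + ‖f b‖) * Real.exp (K * (b - a)) := by
  have hm : MapsTo (fun s : ℝ => a + b - s) (Icc a b) (Icc a b) := by
    intro s hs; constructor <;> simp <;> linarith [hs.1, hs.2]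
  have h := norm_right_le_of_norm_deriv_le (f := fun s => f (a + b - s))
    (f' := fun s => - f' (a + b - s)) hK hab
    (fun t ht => by
      have h1 : HasDerivWithinAt (fun s : ℝ => a + b - s) (-1) (Icc a b) t := by
        simpa using (hasDerivWithinAt_id t (Icc a b)).const_sub (a + b)
      simpa [Function.comp_def] using (hf _ (hm ht)).scomp t h1 hm)
    (fun t ht => by simpa using hb _ (hm ht))
  simpa using h

/-- `Z t s` is the flow on `[0,T]`, from time `s` to time `t`, of the field `b`, which is
continuous and `L`-Lipschitz in space. -/
structure IsLipschitzFlow (T : ℝ) (L : ℝ≥0) (b : ℝ → E → E) (Z : ℝ → ℝ → E → E) : Prop where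
  lipschitz : ∀ t ∈ Icc 0 T, LipschitzWith L (b t)
  continuousOn : ContinuousOn (fun p : ℝ × E => b p.1 p.2) (Icc 0 T ×ˢ univ)
  initial : ∀ s ∈ Icc 0 T, ∀ z, Z s s z = z
  hasDeriv : ∀ s ∈ Icc 0 T, ∀ z, ∀ t ∈ Icc 0 T,
    HasDerivWithinAt (fun τ => Z τ s z) (b t (Z t s z)) (Icc 0 T) t

namespace IsLipschitzFlow

variable {T : ℝ} {L : ℝ≥0} {b : ℝ → E → E} {Z : ℝ → ℝ → E → E}

lemma exists_growth (h : IsLipschitzFlow T L b Z) :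
    ∃ K : ℝ, 0 < K ∧ ∀ t ∈ Icc 0 T, ∀ z, ‖b t z‖ ≤ K * (1 + ‖z‖) := by
  have hc : ContinuousOn (fun t => b t 0) (Icc 0 T) :=
    h.continuousOn.comp (f := fun t : ℝ => (t, (0 : E))) (by fun_prop) (fun t ht => ⟨ht, mem_univ _⟩)
  obtain ⟨C, hC⟩ := isCompact_Icc.exists_bound_of_continuousOn hc
  refine ⟨|C| + L + 1, by positivity, fun t ht z => ?_⟩
  have h1 := (h.lipschitz t ht).dist_le_mul z 0
  rw [dist_eq_norm, dist_zero_right] at h1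
  have h2 : ‖b t z‖ ≤ ‖b t z - b t 0‖ + ‖b t 0‖ := by
    simpa using norm_add_le (b t z - b t 0) (b t 0)
  have h3 := (hC t ht).trans (le_abs_self C)
  have h4 := norm_nonneg z
  have h5 := abs_nonneg C
  have h6 : (0 : ℝ) ≤ L := L.2
  nlinarith [mul_nonneg h5 h4]

lemma derivIcc (h : IsLipschitzFlow T L b Z) {s r t : ℝ} (hs : s ∈ Icc 0 T) (hr : r ∈ Icc 0 T)
    (ht : t ∈ Icc 0 T) (z : E) : ∀ τ ∈ Icc r t,
      HasDerivWithinAt (fun τ => Z τ s z) (b τ (Z τ s z)) (Icc r t) τ := fun τ hτ =>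
  (h.hasDeriv s hs z τ ⟨hr.1.trans hτ.1, hτ.2.trans ht.2⟩).mono (Icc_subset_Icc hr.1 ht.2)

/-- Grönwall for two trajectories. The starting times `s` and `s'` may differ, so that the semigroup
law follows by comparing two trajectories that agree at the intermediate time `r`. -/
lemma dist_le (h : IsLipschitzFlow T L b Z) {s s' r t : ℝ} (hs : s ∈ Icc 0 T) (hs' : s' ∈ Icc 0 T)
    (hr : r ∈ Icc 0 T) (ht : t ∈ Icc 0 T) (hrt : r ≤ t) (z z' : E) :
    dist (Z t s z) (Z t s' z') ≤ Real.exp (L * T) * dist (Z r s z) (Z r s' z') := by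
  have h1 : ∀ s ∈ Icc 0 T, ∀ z, ∀ τ ∈ Ico r t,
      HasDerivWithinAt (fun τ => Z τ s z) (b τ (Z τ s z)) (Ici τ) τ := fun s hs z τ hτ =>
    (h.derivIcc hs hr ht z τ (Ico_subset_Icc_self hτ)).mono_of_mem_nhdsWithin
      (Icc_mem_nhdsGE_of_mem hτ)
  have h2 : ∀ s ∈ Icc 0 T, ∀ z, ContinuousOn (fun τ => Z τ s z) (Icc r t) := fun s hs z τ hτ =>
    (h.derivIcc hs hr ht z τ hτ).continuousWithinAt
  have := dist_le_of_trajectories_ODE_of_mem (v := b) (s := fun _ => univ) (K := L)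
    (fun τ hτ => (h.lipschitz τ ⟨hr.1.trans hτ.1, hτ.2.le.trans ht.2⟩).lipschitzOnWith)
    (h2 s hs z) (h1 s hs z) (fun _ _ => mem_univ _) (h2 s' hs' z') (h1 s' hs' z')
    (fun _ _ => mem_univ _) le_rfl t ⟨hrt, le_rfl⟩
  refine this.trans ?_
  rw [mul_comm]
  gcongr
  linarith [hr.1, ht.2]

lemma dist_le' (h : IsLipschitzFlow T L b Z) {s t : ℝ} (hs : s ∈ Icc 0 T) (ht : t ∈ Icc 0 T)
    (hst : s ≤ t) (z z' : E) : dist (Z t s z) (Z t s z') ≤ Real.exp (L * T) * dist z z' := by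
  simpa [h.initial s hs] using h.dist_le hs hs hs ht hst z z'

lemma comp (h : IsLipschitzFlow T L b Z) {s r t : ℝ} (hs : s ∈ Icc 0 T) (hr : r ∈ Icc 0 T)
    (ht : t ∈ Icc 0 T) (hrt : r ≤ t) (z : E) : Z t r (Z r s z) = Z t s z := by
  have := h.dist_le hr hs hr ht hrt (Z r s z) z
  rw [h.initial r hr, dist_self, mul_zero] at this
  exact dist_le_zero.1 this

lemma norm_le {K : ℝ} (h : IsLipschitzFlow T L b Z) (hK : 0 < K)
    (hb : ∀ t ∈ Icc 0 T, ∀ z, ‖b t z‖ ≤ K * (1 + ‖z‖)) {s t : ℝ} (hs : s ∈ Icc 0 T)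
    (ht : t ∈ Icc 0 T) (hst : s ≤ t) (z : E) :
    ‖Z t s z‖ ≤ (1 + ‖z‖) * Real.exp (K * T) := by
  have := norm_right_le_of_norm_deriv_le hK hst (h.derivIcc hs hs ht z)
    (fun τ hτ => hb τ ⟨hs.1.trans hτ.1, hτ.2.trans ht.2⟩ _)
  rw [h.initial s hs] at this
  refine this.trans ?_
  gcongr
  linarith [hs.1, ht.2]

lemma norm_initial_le {K : ℝ} (h : IsLipschitzFlow T L b Z) (hK : 0 < K)
    (hb : ∀ t ∈ Icc 0 T, ∀ z, ‖b t z‖ ≤ K * (1 + ‖z‖)) {s t : ℝ} (hs : s ∈ Icc 0 T)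
    (ht : t ∈ Icc 0 T) (hst : s ≤ t) (z : E) :
    ‖z‖ ≤ (1 + ‖Z t s z‖) * Real.exp (K * T) := by
  have := norm_left_le_of_norm_deriv_le hK hst (h.derivIcc hs hs ht z)
    (fun τ hτ => hb τ ⟨hs.1.trans hτ.1, hτ.2.trans ht.2⟩ _)
  rw [h.initial s hs] at this
  refine this.trans ?_
  gcongr
  linarith [hs.1, ht.2]

/-- Displacement along the flow, compared with a constant direction. -/
lemma norm_sub_sub_smul_le (h : IsLipschitzFlow T L b Z) {s t δ : ℝ} (hs : s ∈ Icc 0 T)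
    (ht : t ∈ Icc 0 T) (hst : s ≤ t) (z d : E)
    (hδ : ∀ r ∈ Icc s t, ‖b r (Z r s z) - d‖ ≤ δ) :
    ‖Z t s z - (z + (t - s) • d)‖ ≤ δ * (t - s) := by
  have h1 : ∀ r ∈ Icc s t, HasDerivWithinAt (fun r => Z r s z - r • d) (b r (Z r s z) - d)
      (Icc s t) r := fun r hr => by
    simpa using (h.derivIcc hs hs ht z r hr).fun_sub
      ((hasDerivWithinAt_id r (Icc s t)).smul_const d)
  have := (convex_Icc s t).norm_image_sub_le_of_norm_hasDerivWithin_le h1 hδ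
    (left_mem_Icc.2 hst) (right_mem_Icc.2 hst)
  rw [h.initial s hs, Real.norm_of_nonneg (sub_nonneg.2 hst)] at this
  convert this using 2
  rw [sub_smul]; abel

lemma norm_sub_le {K : ℝ} (h : IsLipschitzFlow T L b Z) (hK : 0 < K)
    (hb : ∀ t ∈ Icc 0 T, ∀ z, ‖b t z‖ ≤ K * (1 + ‖z‖)) {s t : ℝ} (hs : s ∈ Icc 0 T)
    (ht : t ∈ Icc 0 T) (hst : s ≤ t) (z : E) :
    ‖Z t s z - z‖ ≤ K * (1 + (1 + ‖z‖) * Real.exp (K * T)) * (t - s) := by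
  have := h.norm_sub_sub_smul_le hs ht hst z 0
    (δ := K * (1 + (1 + ‖z‖) * Real.exp (K * T))) (fun r hr => by
      have hr' : r ∈ Icc 0 T := ⟨hs.1.trans hr.1, hr.2.trans ht.2⟩
      rw [sub_zero]
      refine (hb r hr' _).trans ?_
      gcongr
      exact h.norm_le hK hb hs hr' hr.1 z)
  simpa using this

lemma continuous (h : IsLipschitzFlow T L b Z) {s t : ℝ} (hs : s ∈ Icc 0 T) (ht : t ∈ Icc 0 T)
    (hst : s ≤ t) : Continuous (Z t s) :=
  (LipschitzWith.of_dist_le_mul (K := ⟨Real.exp (L * T), by positivity⟩)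
    (fun z z' => h.dist_le' hs ht hst z z')).continuous

end IsLipschitzFlow

end Flow

/-! ### Uniqueness for the continuity equation with a Lipschitz field -/

/-- A continuous function with vanishing distributional derivative takes the same values at both
ends of the interval. -/
lemma eq_of_integral_deriv_mul_eq_zero {k : ℝ → ℝ} {T t₁ : ℝ} (ht : 0 < t₁) (htT : t₁ ≤ T)
    (hk : ContinuousOn k (Icc 0 T))
    (h : ∀ θ : ℝ → ℝ, ContDiff ℝ ∞ θ → ∀ α β : ℝ, 0 < α → β < t₁ → tsupport θ ⊆ Icc α β →
      ∫ t in Ioo 0 T, deriv θ t * k t = 0) : k 0 = k t₁ := by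
  have hT : 0 ≤ T := ht.le.trans htT
  set κ : ℝ → ℝ := IccExtend hT ((Icc 0 T).domRestrict k) with hκ
  have hκc : Continuous κ := (continuousOn_iff_continuous_domRestrict.1 hk).Icc_extend'
  have hκk : ∀ t ∈ Icc 0 T, κ t = k t := fun t ht => by
    simp [hκ, IccExtend_of_mem hT _ ht, Set.domRestrict]
  have key : ∀ a c : ℝ, 0 < a → a < c → c < t₁ → κ a = κ c := by
    intro a c ha hac hc
    let φ : ℕ → ContDiffBump (0 : ℝ) := fun n =>
      ⟨1 / (n + 1) / 2, 1 / (n + 1), by positivity, half_lt_self (by positivity)⟩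
    have hφ : Tendsto (fun n => (φ n).rOut) atTop (𝓝 0) := tendsto_one_div_add_atTop_nhds_zero_nat
    have hlim := fun x => ContDiffBump.convolution_tendsto_right_of_continuous
      (μ := volume) hφ hκc x
    refine tendsto_nhds_unique_of_eventuallyEq (hlim a) (hlim c) ?_
    have hsmall : ∀ᶠ n in atTop, (φ n).rOut < min a (t₁ - c) :=
      hφ.eventually_lt_const (by simp [ha, hc])
    filter_upwards [hsmall] with n hn
    set r := (φ n).rOut with hr
    have hr0 : 0 < r := (φ n).rOut_pos
    obtain ⟨hra, hrc⟩ := lt_min_iff.1 hn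
    set p : ℝ → ℝ → ℝ := fun x t => (φ n).normed volume (x - t) with hp
    have hpc : ∀ x, ContDiff ℝ ∞ (p x) := fun x =>
      (φ n).contDiff_normed.comp (contDiff_const.sub contDiff_id)
    have hp0 : ∀ x t, r ≤ |x - t| → p x t = 0 := fun x t hxt => by
      by_contra hne
      have : x - t ∈ Function.support ((φ n).normed volume) := hne
      rw [(φ n).support_normed_eq, mem_ball_zero_iff, Real.norm_eq_abs] at this
      exact absurd hxt (not_le.2 this)
    have hp1 : ∀ x, ∫ t, p x t = 1 := fun x => by
      rw [hp]; simp only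
      rw [integral_sub_left_eq_self (fun t => (φ n).normed volume t) volume x]
      exact (φ n).integral_normed
    have hpi : ∀ x, Integrable (p x) := fun x => (φ n).integrable_normed.comp_sub_left x
    have hconv : ∀ x, r ≤ x → x + r ≤ t₁ → convolution ((φ n).normed volume) κ
        (ContinuousLinearMap.lsmul ℝ ℝ) volume x = ∫ t in Ioo 0 T, p x t * k t := by
      intro x hx hx1
      rw [convolution_eq_swap]
      have : ∫ t in Ioo 0 T, p x t * k t = ∫ t in Ioo 0 T, p x t * κ t :=
        setIntegral_congr_fun measurableSet_Ioo fun t ht => by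
          simp only [hκk t (Ioo_subset_Icc_self ht)]
      rw [this]
      refine (setIntegral_eq_integral_of_forall_compl_eq_zero fun t ht => ?_).symm
      change p x t * κ t = 0
      rw [hp0, zero_mul]
      by_contra hlt
      rw [not_le, abs_lt] at hlt
      exact ht ⟨by linarith, by linarith⟩
    rw [hconv a hra.le (by linarith), hconv c (by linarith) (by linarith)]
    -- The difference of two unit-mass bumps has total integral zero, so its primitive vanishes
    -- beyond both bumps and is an admissible test function. Testing with it equates the
    -- mollifications of `k` at `a` and at `c`.
    set θ : ℝ → ℝ := fun t => ∫ s in (0 : ℝ)..t, (p a s - p c s) with hθ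
    have hpcc : Continuous fun s => p a s - p c s :=
      (hpc a).continuous.sub (hpc c).continuous
    have hθd : ∀ t, HasDerivAt θ (p a t - p c t) t := fun t =>
      intervalIntegral.integral_hasDerivAt_right (hpcc.intervalIntegrable _ _)
        (hpcc.stronglyMeasurableAtFilter _ _) hpcc.continuousAt
    have hderiv : deriv θ = fun t => p a t - p c t := funext fun t => (hθd t).deriv
    have hθs : ContDiff ℝ ∞ θ := by
      rw [contDiff_infty_iff_deriv, hderiv]
      exact ⟨fun t => (hθd t).differentiableAt, (hpc a).sub (hpc c)⟩
    have hsupp : tsupport θ ⊆ Icc (a - r) (c + r) := by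
      refine closure_minimal (fun t ht => ?_) isClosed_Icc
      by_contra hnot
      apply ht
      rw [mem_Icc, not_and_or, not_le, not_le] at hnot
      rcases hnot with hlt | hlt
      · refine (intervalIntegral.integral_congr (g := fun _ => 0) fun s hs => ?_).trans (by simp)
        have : s ≤ a - r := (mem_uIcc.1 hs).elim (fun h => h.2.trans hlt.le)
          (fun h => h.2.trans (by linarith))
        simp only
        rw [hp0 a s (by rw [abs_of_nonneg] <;> linarith),
          hp0 c s (by rw [abs_of_nonneg] <;> linarith), sub_self]
      · have h0 : 0 ≤ t := by linarith
        rw [hθ]; simp only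
        rw [intervalIntegral.integral_of_le h0,
          setIntegral_eq_integral_of_forall_compl_eq_zero (f := fun s => p a s - p c s),
          integral_sub (hpi a) (hpi c), hp1, hp1, sub_self]
        intro s hs
        rw [mem_Ioc, not_and_or, not_lt, not_le] at hs
        rcases hs with hs | hs
        · rw [hp0 a s (by rw [abs_of_nonneg] <;> linarith),
            hp0 c s (by rw [abs_of_nonneg] <;> linarith), sub_self]
        · rw [hp0 a s (by rw [abs_of_nonpos] <;> linarith),
            hp0 c s (by rw [abs_of_nonpos] <;> linarith), sub_self]
    have h0 := h θ hθs (a - r) (c + r) (by linarith) (by linarith) hsupp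
    rw [hderiv] at h0
    have hi : ∀ x, IntegrableOn (fun t => p x t * k t) (Ioo 0 T) := fun x =>
      (((hpc x).continuous.continuousOn.mul hk).integrableOn_Icc).mono_set Ioo_subset_Icc_self
    simp only [sub_mul] at h0
    rw [integral_sub (hi a) (hi c)] at h0
    linarith
  have hconst : ∀ c ∈ Ioo 0 t₁, κ c = κ (t₁ / 2) := by
    intro c hc
    rcases lt_trichotomy c (t₁ / 2) with hlt | heq | hlt
    · exact key _ _ hc.1 hlt (by linarith)
    · rw [heq]
    · exact (key _ _ (by linarith) hlt hc.2).symm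
  -- Test functions stay away from the endpoints, so constancy is known only on the open interval;
  -- continuity carries it to `0` and `t₁`.
  have hcl : EqOn κ (fun _ => κ (t₁ / 2)) (Icc 0 t₁) := by
    rw [← closure_Ioo ht.ne]
    exact EqOn.closure (fun c hc => hconst c hc) hκc continuous_const
  rw [← hκk 0 ⟨le_rfl, hT⟩, ← hκk t₁ ⟨ht.le, htT⟩, hcl ⟨le_rfl, ht.le⟩, hcl ⟨ht.le, le_rfl⟩]

/-! ### Mollification with control of increments -/

section Mollify

variable {G : Type*} [NormedAddCommGroup G] [NormedSpace ℝ G] [FiniteDimensional ℝ G]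

open ContinuousLinearMap in
-- Convolution commutes with translation, so a bound on the increments of `ψ` in a fixed direction
-- near `a` passes to the mollification at `a`. This bounds directional derivatives of the smooth
-- function without differentiating `ψ`, which is merely Lipschitz in the application.
lemma exists_mollification {ψ : G → ℝ} (hψ : Continuous ψ) {ε : ℝ} (hε : 0 < ε) :
    ∃ g : G → ℝ, ContDiff ℝ ∞ g ∧
      (∀ a δ, (∀ x ∈ Metric.ball a ε, dist (ψ x) (ψ a) ≤ δ) → dist (g a) (ψ a) ≤ δ) ∧
      ∀ a e C, 0 ≤ C → (∀ x ∈ Metric.ball a ε, |ψ (x + e) - ψ x| ≤ C) → |g (a + e) - g a| ≤ C := by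
  borelize G
  let μ : Measure G := Measure.addHaar
  set φ : ContDiffBump (0 : G) := ⟨ε / 2, ε, half_pos hε, half_lt_self hε⟩ with hφ
  refine ⟨convolution (φ.normed μ) ψ (lsmul ℝ ℝ) μ,
    φ.hasCompactSupport_normed.contDiff_convolution_left _ φ.contDiff_normed
      hψ.locallyIntegrable, fun a δ h => φ.dist_normed_convolution_le
      hψ.aestronglyMeasurable h, fun a e C hC h => ?_⟩
  have hex : ∀ (f : G → ℝ), Continuous f → ConvolutionExists (φ.normed μ) f (lsmul ℝ ℝ) μ :=
    fun f hf => φ.hasCompactSupport_normed.convolutionExists_left (lsmul ℝ ℝ) φ.continuous_normed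
      hf.locallyIntegrable
  have hc : Continuous fun x => ψ (x + e) := hψ.comp (continuous_id.add continuous_const)
  have h1 : convolution (φ.normed μ) (fun x => ψ (x + e) - ψ x) (lsmul ℝ ℝ) μ a =
      convolution (φ.normed μ) ψ (lsmul ℝ ℝ) μ (a + e) - convolution (φ.normed μ) ψ (lsmul ℝ ℝ) μ a := by
    simp only [convolution]
    rw [← integral_sub (hex ψ hψ (a + e)) (hex ψ hψ a)]
    congr 1; ext t
    rw [← map_sub]
    congr 3; abel
  have hcs : Continuous fun x => ψ (x + e) - ψ x := hc.sub hψ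
  rw [← h1]
  have := dist_convolution_le (μ := μ) (z₀ := (0 : ℝ)) hC (φ.support_normed_eq (μ := μ)).subset
    φ.nonneg_normed φ.integral_normed hcs.aestronglyMeasurable (x₀ := a)
    (fun x hx => by simpa using h x hx)
  simpa using this

end Mollify

/-! ### Functions constant along the flow -/

section Pullback

variable {E : Type*} [NormedAddCommGroup E] [NormedSpace ℝ E]

/-- The function which is constant along the flow and equals `χ` at time `t₁`; outside `[0,t₁]`
it does not depend on time. -/
def flowPullback {E : Type*} (Z : ℝ → ℝ → E → E) (t₁ : ℝ) (χ : E → ℝ) (p : ℝ × E) : ℝ :=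
  χ (Z t₁ (max 0 (min t₁ p.1)) p.2)

variable {T : ℝ} {L : ℝ≥0} {b : ℝ → E → E} {Z : ℝ → ℝ → E → E}

lemma flowPullback_of_mem {E : Type*} {Z : ℝ → ℝ → E → E} {t₁ t : ℝ} (ht : t ∈ Icc 0 t₁) (χ : E → ℝ) (z : E) :
    flowPullback Z t₁ χ (t, z) = χ (Z t₁ t z) := by
  simp [flowPullback, min_eq_right ht.2, max_eq_right ht.1]

/-- The properties of `flowPullback` used below. -/
lemma IsLipschitzFlow.exists_flowPullback_bounds (h : IsLipschitzFlow T L b Z) {t₁ : ℝ}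
    (ht₁ : t₁ ∈ Icc 0 T) {χ : E → ℝ} {Lχ : ℝ≥0} (hχ : LipschitzWith Lχ χ) {R₀ : ℝ} (hR₀ : 0 ≤ R₀)
    (hχ0 : ∀ z, R₀ < ‖z‖ → χ z = 0) :
    ∃ Λ : ℝ≥0, ∃ R : ℝ, 0 ≤ R ∧ LipschitzWith Λ (flowPullback Z t₁ χ) ∧
      (∀ t z, R < ‖z‖ → flowPullback Z t₁ χ (t, z) = 0) ∧
      ∀ t t' z, 0 ≤ t → t ≤ t' → t' ≤ t₁ →
        flowPullback Z t₁ χ (t', Z t' t z) = flowPullback Z t₁ χ (t, z) := by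
  obtain ⟨K, hK, hb⟩ := h.exists_growth
  -- By the backward Grönwall bound, a trajectory that ends in the ball of radius `R₀` started in
  -- the ball of radius `R`.
  set R : ℝ := (1 + R₀) * Real.exp (K * T) with hR
  set A : ℝ := Real.exp (L * T) with hA
  set c : ℝ → ℝ := fun t => max 0 (min t₁ t) with hc
  have hcm : ∀ t, c t ∈ Icc 0 T := fun t =>
    ⟨le_max_left _ _, max_le (ht₁.1.trans ht₁.2) ((min_le_left _ _).trans ht₁.2)⟩
  have hc1 : ∀ t, c t ≤ t₁ := fun t => max_le ht₁.1 (min_le_left _ _)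
  have hclip : ∀ t t', |c t - c t'| ≤ |t - t'| := fun t t' => by
    refine (abs_max_sub_max_le_max _ _ _ _).trans ?_
    refine max_le (by simp) ((abs_min_sub_min_le_max _ _ _ _).trans (by simp))
  have hzero : ∀ t z, R < ‖z‖ → flowPullback Z t₁ χ (t, z) = 0 := by
    intro t z hz
    refine hχ0 _ ?_
    by_contra hle
    rw [not_lt] at hle
    have := h.norm_initial_le hK hb (hcm t) ht₁ (hc1 t) z
    have h2 : ‖z‖ ≤ R := this.trans (by rw [hR]; gcongr)
    linarith
  have hspace : ∀ t z z', |flowPullback Z t₁ χ (t, z) - flowPullback Z t₁ χ (t, z')| ≤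
      Lχ * A * ‖z - z'‖ := by
    intro t z z'
    have h1 := hχ.dist_le_mul (Z t₁ (c t) z) (Z t₁ (c t) z')
    have h2 := h.dist_le' (hcm t) ht₁ (hc1 t) z z'
    rw [Real.dist_eq] at h1
    refine h1.trans ?_
    rw [mul_assoc, ← dist_eq_norm]
    gcongr
  set D : ℝ := K * (1 + (1 + R) * Real.exp (K * T)) with hD
  have hR0 : 0 ≤ R := by positivity
  have hD0 : 0 ≤ D := by positivity
  have htime1 : ∀ s s' z, s ≤ s' → s ∈ Icc 0 T → s' ∈ Icc 0 T → s' ≤ t₁ → ‖z‖ ≤ R →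
      |χ (Z t₁ s z) - χ (Z t₁ s' z)| ≤ Lχ * A * D * |s - s'| := by
    intro s s' z hss hs hs' hs1 hz
    rw [← h.comp hs hs' ht₁ hs1 z]
    have h1 := hχ.dist_le_mul (Z t₁ s' (Z s' s z)) (Z t₁ s' z)
    have h2 := h.dist_le' hs' ht₁ hs1 (Z s' s z) z
    have h3 := h.norm_sub_le hK hb hs hs' hss z
    rw [← dist_eq_norm] at h3
    rw [Real.dist_eq] at h1
    refine h1.trans ?_
    rw [mul_assoc, mul_assoc]
    refine mul_le_mul_of_nonneg_left (h2.trans ?_) Lχ.2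
    refine mul_le_mul_of_nonneg_left (h3.trans ?_) (by positivity)
    rw [abs_sub_comm, abs_of_nonneg (sub_nonneg.2 hss)]
    have := sub_nonneg.2 hss
    rw [hD]; gcongr
  have htime : ∀ t t' z, |flowPullback Z t₁ χ (t, z) - flowPullback Z t₁ χ (t', z)| ≤
      Lχ * A * D * |t - t'| := by
    intro t t' z
    -- The speed of the flow grows linearly in `‖z‖`, so the time-Lipschitz estimate is available
    -- only for bounded `z`; for `‖z‖ > R` both values vanish.
    by_cases hz : R < ‖z‖
    · rw [hzero t z hz, hzero t' z hz, sub_zero, abs_zero]; positivity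
    rw [not_lt] at hz
    have h1 : |flowPullback Z t₁ χ (t, z) - flowPullback Z t₁ χ (t', z)| ≤
        Lχ * A * D * |c t - c t'| := by
      rcases le_total (c t) (c t') with hle | hle
      · exact htime1 _ _ z hle (hcm t) (hcm t') (hc1 t') hz
      · rw [abs_sub_comm, abs_sub_comm (c t)]
        exact htime1 _ _ z hle (hcm t') (hcm t) (hc1 t) hz
    exact h1.trans (mul_le_mul_of_nonneg_left (hclip t t') (by positivity))
  refine ⟨(Lχ * A * (1 + D)).toNNReal, R, hR0, LipschitzWith.of_dist_le_mul ?_, hzero, ?_⟩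
  · rintro ⟨t, z⟩ ⟨t', z'⟩
    have h1 := hspace t z z'
    have h2 := htime t t' z'
    have h3 : ‖z - z'‖ ≤ dist (t, z) (t', z') := by
      rw [Prod.dist_eq, ← dist_eq_norm]; exact le_max_right _ _
    have h4 : |t - t'| ≤ dist (t, z) (t', z') := by
      rw [Prod.dist_eq, ← Real.dist_eq]; exact le_max_left _ _
    rw [Real.dist_eq]
    calc _ ≤ |flowPullback Z t₁ χ (t, z) - flowPullback Z t₁ χ (t, z')| +
          |flowPullback Z t₁ χ (t, z') - flowPullback Z t₁ χ (t', z')| := abs_sub_le _ _ _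
      _ ≤ Lχ * A * dist (t, z) (t', z') + Lχ * A * D * dist (t, z) (t', z') :=
          add_le_add (h1.trans (by gcongr)) (h2.trans (by gcongr))
      _ = _ := by rw [Real.coe_toNNReal _ (by positivity)]; ring
  · intro t t' z ht htt' ht'
    rw [flowPullback_of_mem ⟨ht.trans htt', ht'⟩, flowPullback_of_mem ⟨ht, htt'.trans ht'⟩,
      h.comp ⟨ht, (htt'.trans ht').trans ht₁.2⟩ ⟨ht.trans htt', ht'.trans ht₁.2⟩ ht₁ ht']

end Pullback

/-! ### Pairings along narrowly continuous curves -/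

section Narrow

variable {E : Type*} [NormedAddCommGroup E] [NormedSpace ℝ E] [FiniteDimensional ℝ E]
  [MeasurableSpace E] [BorelSpace E]

/-- Integrals of compactly supported functions are continuous in time along a narrowly continuous
curve of probability measures. -/
lemma continuousOn_integral_of_narrow {T : ℝ} {μ : ℝ → Measure E}
    (hp : ∀ t ∈ Icc 0 T, IsProbabilityMeasure (μ t))
    (hμ : ∀ χ : E → ℝ, Continuous χ → HasCompactSupport χ →
      ContinuousOn (fun t => ∫ z, χ z ∂μ t) (Icc 0 T))
    {F : ℝ → E → ℝ} (hF : ContinuousOn (fun p : ℝ × E => F p.1 p.2) (Icc 0 T ×ˢ univ)) {R : ℝ}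
    (hR : ∀ t ∈ Icc 0 T, ∀ z, R < ‖z‖ → F t z = 0) :
    (∀ t ∈ Icc 0 T, Integrable (F t) (μ t)) ∧
      ContinuousOn (fun t => ∫ z, F t z ∂μ t) (Icc 0 T) := by
  have hFc : ∀ t ∈ Icc 0 T, Continuous (F t) := fun t ht => by
    rw [← continuousOn_univ]
    exact hF.comp (f := fun z : E => (t, z)) (by fun_prop) (fun z _ => ⟨ht, mem_univ _⟩)
  have hFs : ∀ t ∈ Icc 0 T, HasCompactSupport (F t) := fun t ht =>
    HasCompactSupport.intro (isCompact_closedBall 0 R) fun z hz => hR t ht z (by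
      simpa using hz)
  have hint : ∀ t ∈ Icc 0 T, ∀ s ∈ Icc 0 T, Integrable (F t) (μ s) := fun t ht s hs => by
    have := hp s hs
    exact (hFc t ht).integrable_of_hasCompactSupport (hFs t ht)
  refine ⟨fun t ht => hint t ht t ht, fun t ht => ?_⟩
  have h1 := hμ (F t) (hFc t ht) (hFs t ht) t ht
  rw [ContinuousWithinAt, Metric.tendsto_nhds] at h1 ⊢
  intro ε hε
  have huc := (isCompact_Icc.prod (isCompact_closedBall (0 : E) R)).uniformContinuousOn_of_continuous
    (hF.mono (prod_mono_right (subset_univ _)))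
  obtain ⟨δ, hδ, huc⟩ := Metric.uniformContinuousOn_iff.1 huc (ε / 2) (half_pos hε)
  filter_upwards [h1 (ε / 2) (half_pos hε), self_mem_nhdsWithin,
    mem_nhdsWithin_of_mem_nhds (Metric.ball_mem_nhds t hδ)] with s hs1 hs2 hs3
  have := hp s hs2
  have h2 : ‖∫ z, (F s z - F t z) ∂μ s‖ ≤ ε / 2 := by
    have := norm_integral_le_of_norm_le_const (μ := μ s) (f := fun z => F s z - F t z)
      (C := ε / 2) (ae_of_all _ fun z => by
        by_cases hz : R < ‖z‖
        · rw [hR s hs2 z hz, hR t ht z hz]; simpa using (half_pos hε).le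
        · have hz' : z ∈ Metric.closedBall (0 : E) R := by simpa using hz
          have := huc (s, z) ⟨hs2, hz'⟩ (t, z) ⟨ht, hz'⟩ (by simpa [Prod.dist_eq] using hs3)
          rw [dist_eq_norm] at this
          exact this.le)
    simpa using this
  rw [integral_sub (hint s hs2 s hs2) (hint t ht s hs2)] at h2
  rw [Real.dist_eq] at hs1 ⊢
  rw [Real.norm_eq_abs] at h2
  calc _ ≤ |∫ z, F s z ∂μ s - ∫ z, F t z ∂μ s| + |∫ z, F t z ∂μ s - ∫ z, F t z ∂μ t| :=
        abs_sub_le _ _ _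
    _ < ε / 2 + ε / 2 := add_lt_add_of_le_of_lt h2 hs1
    _ = ε := add_halves ε

end Narrow

/-! ### The duality argument -/

section Uniqueness

variable {E : Type*} [NormedAddCommGroup E] [NormedSpace ℝ E]
variable {T : ℝ} {L : ℝ≥0} {b : ℝ → E → E} {Z : ℝ → ℝ → E → E}

lemma abs_fderiv_le_of_forward_difference_le {G : Type*} [NormedAddCommGroup G] [NormedSpace ℝ G]
    {g : G → ℝ} {p d : G} {C : ℝ} (hg : DifferentiableAt ℝ g p)
    (h : ∀ᶠ s : ℝ in 𝓝[>] 0, |g (p + s • d) - g p| ≤ C * s) : |fderiv ℝ g p d| ≤ C := by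
  have hl : HasDerivAt (fun s : ℝ => p + s • d) d 0 := by
    simpa using ((hasDerivAt_id (0 : ℝ)).smul_const d).const_add p
  have hd : HasDerivAt (fun s : ℝ => g (p + s • d)) (fderiv ℝ g p d) 0 := by
    have : HasFDerivAt g (fderiv ℝ g p) (p + (0 : ℝ) • d) := by simpa using hg.hasFDerivAt
    exact this.comp_hasDerivAt (0 : ℝ) hl
  have ht := (hasDerivWithinAt_iff_tendsto_slope' (self_notMem_Ioi)).1
    (hd.hasDerivWithinAt (s := Ioi 0))
  refine le_of_tendsto ht.abs ?_
  filter_upwards [h, self_mem_nhdsWithin] with s hs hs0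
  have hs0 : 0 < s := hs0
  rw [slope_def_field, zero_smul, add_zero, sub_zero, abs_div, abs_of_pos hs0, div_le_iff₀ hs0]
  exact hs

/-- A smooth approximation of `flowPullback`, almost constant along the flow. -/
lemma IsLipschitzFlow.exists_approx_flowPullback [FiniteDimensional ℝ E]
    (h : IsLipschitzFlow T L b Z) {t₁ : ℝ}
    (ht₁ : t₁ ∈ Icc 0 T) {χ : E → ℝ} {Λ : ℝ≥0} {R : ℝ} (hR : 0 ≤ R)
    (hlip : LipschitzWith Λ (flowPullback Z t₁ χ))
    (hzero : ∀ t z, R < ‖z‖ → flowPullback Z t₁ χ (t, z) = 0)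
    (hconst : ∀ t t' z, 0 ≤ t → t ≤ t' → t' ≤ t₁ →
        flowPullback Z t₁ χ (t', Z t' t z) = flowPullback Z t₁ χ (t, z))
    {α β δ : ℝ} (hα : 0 < α) (hβ : β < t₁) (hδ : 0 < δ) :
    ∃ g : ℝ × E → ℝ, ContDiff ℝ ∞ g ∧ (∀ p, |g p - flowPullback Z t₁ χ p| ≤ Λ * δ) ∧
      (∀ t z, R + 1 < ‖z‖ → g (t, z) = 0) ∧
      ∀ t ∈ Icc α β, ∀ z, |fderiv ℝ g (t, z) (1, b t z)| ≤ Λ * δ := by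
  obtain ⟨K, hK, hb⟩ := h.exists_growth
  have : ProperSpace E := FiniteDimensional.proper ℝ E
  set ψ := flowPullback Z t₁ χ with hψ
  have huc := (isCompact_Icc.prod (isCompact_closedBall (0 : E) (R + 3))
    ).uniformContinuousOn_of_continuous (h.continuousOn.mono (prod_mono_right (subset_univ _)))
  obtain ⟨η, hη, huc⟩ := Metric.uniformContinuousOn_iff.1 huc δ hδ
  set D : ℝ := K * (1 + (1 + (R + 2)) * Real.exp (K * T)) with hD
  have hD0 : 0 < D := by positivity
  -- The bounds by `α` and `(t₁ - β) / 2` keep the mollification window inside `[0, t₁]`, where the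
  -- pullback is constant along the flow. The bound by `η / 2` leaves room to compare the field with
  -- its value at the centre.
  obtain ⟨ε, hε0, hε⟩ : ∃ ε : ℝ, 0 < ε ∧ ε ≤ δ ∧ ε ≤ η / 2 ∧ ε ≤ 1 / 2 ∧ ε ≤ α ∧
      ε ≤ (t₁ - β) / 2 := by
    refine ⟨min δ (min (η / 2) (min (1 / 2) (min α ((t₁ - β) / 2)))), ?_, ?_⟩
    · have := sub_pos.2 hβ
      positivity
    · simp
  obtain ⟨hε1, hε2, hε3, hε4, hε5⟩ := hε
  obtain ⟨g, hg, hg1, hg2⟩ := exists_mollification hlip.continuous hε0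
  have hg0 : ∀ t z, R + 1 / 2 < ‖z‖ → g (t, z) = 0 := by
    intro t z hz
    have hψz : ψ (t, z) = 0 := hzero t z (by linarith)
    have := hg1 (t, z) 0 fun x hx => by
      obtain ⟨t', z'⟩ := x
      rw [Metric.mem_ball, Prod.dist_eq, max_lt_iff] at hx
      rw [hψz, hzero t' z', dist_self]
      have h3 : ‖z‖ ≤ ‖z'‖ + dist z' z := by
        rw [dist_eq_norm, norm_sub_rev]
        simpa using norm_add_le z' (z - z')
      linarith [hx.2]
    rw [hψz] at this
    exact dist_le_zero.1 this
  refine ⟨g, hg, fun p => ?_, fun t z hz => hg0 t z (by linarith), fun t ht z => ?_⟩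
  · rw [← Real.dist_eq]
    refine hg1 p _ fun x hx => (hlip.dist_le_mul x p).trans ?_
    gcongr
    exact (Metric.mem_ball.1 hx).le.trans hε1
  have hdiff : DifferentiableAt ℝ g (t, z) := hg.differentiable (by simp) _
  refine abs_fderiv_le_of_forward_difference_le hdiff ?_
  have htT : t ∈ Icc 0 T := ⟨by linarith [ht.1], by linarith [ht.2, ht₁.2]⟩
  by_cases hz : R + 1 < ‖z‖
  · have hcont : Tendsto (fun s : ℝ => z + s • b t z) (𝓝[>] 0) (𝓝 z) := by
      have : Continuous fun s : ℝ => z + s • b t z := by fun_prop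
      simpa using (this.tendsto 0).mono_left nhdsWithin_le_nhds
    filter_upwards [hcont.norm.eventually_const_lt hz, self_mem_nhdsWithin] with s hs hs0
    have hs0 : 0 < s := hs0
    have : g ((t, z) + s • ((1 : ℝ), b t z)) = 0 := hg0 _ _ (by
      change R + 1 / 2 < ‖z + s • b t z‖
      linarith)
    rw [this, hg0 t z (by linarith)]
    simp only [sub_zero, abs_zero]; positivity
  rw [not_lt] at hz
  have hs1 : ∀ᶠ s : ℝ in 𝓝[>] 0, s < min (η / 2) (min (η / 2 / D) (min (1 / D) ((t₁ - β) / 2))) := by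
    refine mem_nhdsWithin_of_mem_nhds (Iio_mem_nhds ?_)
    have := sub_pos.2 hβ
    positivity
  filter_upwards [hs1, self_mem_nhdsWithin] with s hs hs0
  have hs0 : 0 < s := hs0
  simp only [lt_min_iff] at hs
  obtain ⟨hs1, hs2, hs3, hs4⟩ := hs
  rw [lt_div_iff₀ hD0] at hs2 hs3
  refine hg2 (t, z) _ _ (by positivity) ?_
  rintro ⟨t', z'⟩ hx
  rw [Metric.mem_ball, Prod.dist_eq, max_lt_iff, Real.dist_eq, abs_lt] at hx
  obtain ⟨⟨hx1, hx2⟩, hx3⟩ := hx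
  simp only at hx1 hx2 hx3
  have hz' : ‖z'‖ ≤ R + 2 := by
    have h3 : ‖z'‖ ≤ ‖z‖ + dist z' z := by
      rw [dist_eq_norm]; simpa using norm_add_le z (z' - z)
    linarith
  have ht'0 : 0 ≤ t' := by linarith [ht.1]
  have ht's : t' + s ≤ t₁ := by linarith [ht.2]
  have ht'T : t' ∈ Icc 0 T := ⟨ht'0, by linarith [ht₁.2]⟩
  have ht'sT : t' + s ∈ Icc 0 T := ⟨by linarith, by linarith [ht₁.2]⟩
  have hle : t' ≤ t' + s := by linarith
  -- Near `(t, z)` the trajectory through `(t', z')` is within `δ * s` of the straight line in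
  -- direction `b t z`. Since `ψ` is constant on the trajectory and `Λ`-Lipschitz, its increment
  -- along the line is at most `Λ * δ * s`.
  have hmain := h.norm_sub_sub_smul_le ht'T ht'sT hle z' (b t z) (δ := δ) (fun r hr => by
    have hrT : r ∈ Icc 0 T := ⟨ht'0.trans hr.1, hr.2.trans ht'sT.2⟩
    have h1 : ‖Z r t' z' - z'‖ ≤ D * s := (h.norm_sub_le hK hb ht'T hrT hr.1 z').trans (by
      have : 0 ≤ r - t' := sub_nonneg.2 hr.1
      rw [hD]
      gcongr
      linarith [hr.2])
    have h2 : dist (Z r t' z') z < η := by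
      calc _ ≤ dist (Z r t' z') z' + dist z' z := dist_triangle _ _ _
        _ < η := by rw [dist_eq_norm (Z r t' z')]; linarith
    rw [← dist_eq_norm]
    refine (huc (r, Z r t' z') ⟨hrT, ?_⟩ (t, z) ⟨htT, ?_⟩ ?_).le
    · rw [mem_closedBall_zero_iff]
      have : ‖Z r t' z'‖ ≤ ‖Z r t' z' - z'‖ + ‖z'‖ := by
        simpa using norm_add_le (Z r t' z' - z') z'
      linarith
    · rw [mem_closedBall_zero_iff]; linarith
    · rw [Prod.dist_eq, max_lt_iff, Real.dist_eq, abs_lt]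
      exact ⟨⟨by simp only; linarith [hr.1], by simp only; linarith [hr.2]⟩, h2⟩)
  have hrw : ψ (t', z') = ψ (t' + s, Z (t' + s) t' z') := (hconst _ _ _ ht'0 hle ht's).symm
  have hpt : ((t', z') : ℝ × E) + s • ((1 : ℝ), b t z) = (t' + s, z' + s • b t z) := by
    simp
  rw [hrw, hpt, abs_sub_comm, ← Real.dist_eq]
  refine (hlip.dist_le_mul _ _).trans ?_
  rw [mul_assoc]
  refine mul_le_mul_of_nonneg_left ?_ Λ.2
  rw [Prod.dist_eq, dist_self, dist_eq_norm]
  refine max_le (by positivity) ?_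
  simpa using hmain

variable [FiniteDimensional ℝ E] [MeasurableSpace E] [BorelSpace E]

/-- The pairing of `μ t` with the function that is constant along the flow and equals `χ` at time
`t₁` has zero distributional derivative on `(0, t₁)`. That function is only Lipschitz, so the
equation is tested with `θ(t) g`, where `g` is a smooth approximation whose derivative along the
flow is at most `Λ * δ`; the error is proportional to `δ` and vanishes in the limit. -/
lemma IsLipschitzFlow.integral_comp_eq (h : IsLipschitzFlow T L b Z) {μ : ℝ → Measure E}
    (hp : ∀ t ∈ Icc 0 T, IsProbabilityMeasure (μ t))
    (hμ : ∀ χ : E → ℝ, Continuous χ → HasCompactSupport χ →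
      ContinuousOn (fun t => ∫ z, χ z ∂μ t) (Icc 0 T))
    (hweak : ∀ φ : ℝ × E → ℝ, ContDiff ℝ ∞ φ → HasCompactSupport φ →
      tsupport φ ⊆ Ioo 0 T ×ˢ univ →
      ∫ t in Ioo 0 T, ∫ z, fderiv ℝ φ (t, z) (1, b t z) ∂(μ t) = 0)
    {t₁ : ℝ} (ht₁0 : 0 < t₁) (ht₁T : t₁ ≤ T) {χ : E → ℝ} {Lχ : ℝ≥0} (hχ : LipschitzWith Lχ χ)
    {R₀ : ℝ} (hR₀ : 0 ≤ R₀) (hχ0 : ∀ z, R₀ < ‖z‖ → χ z = 0) :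
    ∫ z, χ (Z t₁ 0 z) ∂(μ 0) = ∫ z, χ z ∂(μ t₁) := by
  have ht₁ : t₁ ∈ Icc 0 T := ⟨ht₁0.le, ht₁T⟩
  have : ProperSpace E := FiniteDimensional.proper ℝ E
  obtain ⟨Λ, R, hR, hlip, hzero, hconst⟩ := h.exists_flowPullback_bounds ht₁ hχ hR₀ hχ0
  have hk := (continuousOn_integral_of_narrow hp hμ (F := fun t z => flowPullback Z t₁ χ (t, z))
    hlip.continuous.continuousOn fun t _ z hz => hzero t z hz)
  have key := eq_of_integral_deriv_mul_eq_zero ht₁0 ht₁T hk.2 ?_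
  · simp only [flowPullback_of_mem (left_mem_Icc.2 ht₁0.le),
      flowPullback_of_mem (right_mem_Icc.2 ht₁0.le), h.initial t₁ ht₁] at key
    exact key
  intro θ hθ α β hα hβ hsupp
  have hθ0 : ∀ t, t ∉ Icc α β → θ t = 0 := fun t ht =>
    image_eq_zero_of_notMem_tsupport fun h' => ht (hsupp h')
  have hθc : HasCompactSupport θ := HasCompactSupport.intro isCompact_Icc hθ0
  have hθ'c : Continuous (deriv θ) := hθ.continuous_deriv (by simp)
  obtain ⟨C₀, hC₀⟩ := hθ.continuous.bounded_above_of_compact_support hθc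
  obtain ⟨C₁, hC₁⟩ := hθ'c.bounded_above_of_compact_support hθc.deriv
  have hC₀' : 0 ≤ C₀ := (norm_nonneg _).trans (hC₀ 0)
  have hC₁' : 0 ≤ C₁ := (norm_nonneg _).trans (hC₁ 0)
  have hT : 0 < T := ht₁0.trans_le ht₁T
  have hbound : ∀ δ : ℝ, 0 < δ → ‖∫ t in Ioo 0 T, deriv θ t * ∫ z, flowPullback Z t₁ χ (t, z) ∂μ t‖ ≤
      (C₁ + C₀) * Λ * T * δ := by
    intro δ hδ
    obtain ⟨g, hg, hg1, hg2, hg3⟩ := h.exists_approx_flowPullback ht₁ hR hlip hzero hconst hα hβ hδ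
    set φ : ℝ × E → ℝ := fun p => θ p.1 * g p with hφ
    have hφs : ContDiff ℝ ∞ φ := (hθ.comp contDiff_fst).mul hg
    have hsub : tsupport φ ⊆ Icc α β ×ˢ Metric.closedBall (0 : E) (R + 1) := by
      refine closure_minimal (fun p hp => ?_) (isClosed_Icc.prod Metric.isClosed_closedBall)
      by_contra hnot
      apply hp
      rw [mem_prod, not_and_or, mem_closedBall_zero_iff, not_le] at hnot
      rcases hnot with hn | hn
      · simp [hφ, hθ0 _ hn]
      · simp [hφ, hg2 p.1 p.2 hn]
    have hφc : HasCompactSupport φ :=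
      HasCompactSupport.of_support_subset_isCompact
        (isCompact_Icc.prod (isCompact_closedBall (0 : E) (R + 1))) (subset_closure.trans hsub)
    have hw := hweak φ hφs hφc (hsub.trans (prod_mono (fun t ht =>
      ⟨hα.trans_le ht.1, ht.2.trans_lt (hβ.trans_le ht₁T)⟩) (subset_univ _)))
    have hfd : ∀ t z, fderiv ℝ φ (t, z) (1, b t z) =
        θ t * fderiv ℝ g (t, z) (1, b t z) + deriv θ t * g (t, z) := by
      intro t z
      have h1 : HasFDerivAt (fun p : ℝ × E => θ p.1)
          ((ContinuousLinearMap.toSpanSingleton ℝ (deriv θ t)).comp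
            (ContinuousLinearMap.fst ℝ ℝ E)) (t, z) :=
        HasFDerivAt.comp (t, z) (g := θ)
          ((hθ.differentiable (by simp) t).hasDerivAt.hasFDerivAt) hasFDerivAt_fst
      have h2 := (h1.mul (hg.differentiable (by simp) (t, z)).hasFDerivAt).fderiv
      have h3 : fderiv ℝ φ (t, z) = _ := h2
      rw [h3]
      simp [mul_comm]
    have hFc : ContinuousOn (fun p : ℝ × E => fderiv ℝ φ (p.1, p.2) (1, b p.1 p.2))
        (Icc 0 T ×ˢ univ) := by
      have h1 : Continuous (fderiv ℝ φ) := hφs.continuous_fderiv (by simp)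
      exact h1.continuousOn.clm_apply (continuousOn_const.prodMk h.continuousOn)
    have hF0 : ∀ t ∈ Icc 0 T, ∀ z, R + 1 < ‖z‖ → fderiv ℝ φ (t, z) (1, b t z) = 0 := by
      intro t _ z hz
      have : (t, z) ∉ tsupport φ := fun hmem => by
        have := (hsub hmem).2
        rw [mem_closedBall_zero_iff] at this
        simp only at this
        linarith
      rw [fderiv_of_notMem_tsupport ℝ this]; simp
    have hF := continuousOn_integral_of_narrow hp hμ
      (F := fun t z => fderiv ℝ φ (t, z) (1, b t z)) hFc hF0
    have hi1 : IntegrableOn (fun t => ∫ z, fderiv ℝ φ (t, z) (1, b t z) ∂μ t) (Ioo 0 T) :=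
      hF.2.integrableOn_Icc.mono_set Ioo_subset_Icc_self
    have hi2 : IntegrableOn (fun t => deriv θ t * ∫ z, flowPullback Z t₁ χ (t, z) ∂μ t) (Ioo 0 T) :=
      (hθ'c.continuousOn.mul hk.2).integrableOn_Icc.mono_set Ioo_subset_Icc_self
    have hsubt : ∫ t in Ioo 0 T, deriv θ t * ∫ z, flowPullback Z t₁ χ (t, z) ∂μ t =
        ∫ t in Ioo 0 T, ((deriv θ t * ∫ z, flowPullback Z t₁ χ (t, z) ∂μ t) -
          ∫ z, fderiv ℝ φ (t, z) (1, b t z) ∂μ t) := by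
      rw [integral_sub hi2 hi1, hw, sub_zero]
    rw [hsubt]
    have hle : ∀ t ∈ Ioo 0 T, ‖(deriv θ t * ∫ z, flowPullback Z t₁ χ (t, z) ∂μ t) -
          ∫ z, fderiv ℝ φ (t, z) (1, b t z) ∂μ t‖ ≤ (C₁ + C₀) * (Λ * δ) := by
      intro t ht
      have htI := Ioo_subset_Icc_self ht
      have := hp t htI
      rw [← integral_const_mul, ← integral_sub ((hk.1 t htI).const_mul _) (hF.1 t htI)]
      refine (norm_integral_le_of_norm_le_const (C := (C₁ + C₀) * (Λ * δ))
        (ae_of_all _ fun z => ?_)).trans (by simp)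
      have h1 : deriv θ t * flowPullback Z t₁ χ (t, z) - fderiv ℝ φ (t, z) (1, b t z) =
          deriv θ t * (flowPullback Z t₁ χ (t, z) - g (t, z)) -
            θ t * fderiv ℝ g (t, z) (1, b t z) := by rw [hfd]; ring
      rw [h1, add_mul]
      refine (_root_.norm_sub_le _ _).trans (add_le_add ?_ ?_)
      · rw [norm_mul]
        refine mul_le_mul (hC₁ t) ?_ (norm_nonneg _) hC₁'
        rw [Real.norm_eq_abs, abs_sub_comm]
        exact hg1 _
      · by_cases htab : t ∈ Icc α β
        · rw [norm_mul]
          exact mul_le_mul (hC₀ t) (hg3 t htab z) (norm_nonneg _) hC₀'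
        · rw [hθ0 t htab, zero_mul, norm_zero]; positivity
    refine (norm_setIntegral_le_of_norm_le_const (by simp) hle).trans ?_
    rw [measureReal_def, Real.volume_Ioo, sub_zero, ENNReal.toReal_ofReal hT.le]
    apply le_of_eq; ring
  have hzero' : ‖∫ t in Ioo 0 T, deriv θ t * ∫ z, flowPullback Z t₁ χ (t, z) ∂μ t‖ ≤ 0 := by
    have hlim : Tendsto (fun δ : ℝ => (C₁ + C₀) * Λ * T * δ) (𝓝[>] 0) (𝓝 0) := by
      have : Continuous fun δ : ℝ => (C₁ + C₀) * Λ * T * δ := by fun_prop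
      simpa using (this.tendsto 0).mono_left nhdsWithin_le_nhds
    refine ge_of_tendsto hlim ?_
    filter_upwards [self_mem_nhdsWithin] with δ hδ using hbound δ hδ
  exact norm_le_zero_iff.1 hzero'

/-- A narrowly continuous curve of probability measures which solves the continuity equation with
a Lipschitz field is transported by the flow. -/
theorem IsLipschitzFlow.eq_map (h : IsLipschitzFlow T L b Z) {μ : ℝ → Measure E}
    (hp : ∀ t ∈ Icc 0 T, IsProbabilityMeasure (μ t))
    (hμ : ∀ χ : E → ℝ, Continuous χ → HasCompactSupport χ →
      ContinuousOn (fun t => ∫ z, χ z ∂μ t) (Icc 0 T))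
    (hweak : ∀ φ : ℝ × E → ℝ, ContDiff ℝ ∞ φ → HasCompactSupport φ →
      tsupport φ ⊆ Ioo 0 T ×ˢ univ →
      ∫ t in Ioo 0 T, ∫ z, fderiv ℝ φ (t, z) (1, b t z) ∂(μ t) = 0)
    {t : ℝ} (ht : t ∈ Icc 0 T) : μ t = (μ 0).map (Z t 0) := by
  have : ProperSpace E := FiniteDimensional.proper ℝ E
  have h0 : (0 : ℝ) ∈ Icc 0 T := ⟨le_rfl, ht.1.trans ht.2⟩
  have := hp 0 h0
  have := hp t ht
  rcases ht.1.eq_or_lt with rfl | ht0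
  · have : Z 0 0 = id := funext fun z => h.initial 0 h0 z
    rw [this, Measure.map_id]
  have hZ : Continuous (Z t 0) := h.continuous h0 ht ht.1
  have : IsProbabilityMeasure ((μ 0).map (Z t 0)) :=
    Measure.isProbabilityMeasure_map hZ.aemeasurable
  -- By regularity it suffices to compare the measures on compact sets. Their indicators are limits
  -- of thickened indicators, which are Lipschitz with bounded support and so are covered by the
  -- duality identity.
  apply Measure.OuterRegular.ext_isOpen
  apply Measure.InnerRegularWRT.eq_of_innerRegularWRT_of_forall_eq
    (Measure.Regular.innerRegular (μ := μ t))
    (Measure.Regular.innerRegular (μ := (μ 0).map (Z t 0)))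
  intro K hK
  obtain ⟨R₀, hR₀pos, hR₀⟩ := hK.isBounded.exists_pos_norm_le
  let δ : ℕ → ℝ := fun n => 1 / (n + 1)
  have hδ : ∀ n, 0 < δ n := fun n => by positivity
  have hδ0 : Tendsto δ atTop (𝓝 0) := tendsto_one_div_add_atTop_nhds_zero_nat
  have happ : ∀ ν : Measure E, IsProbabilityMeasure ν →
      Tendsto (fun n => ∫ z, ((thickenedIndicator (hδ n) K z : ℝ≥0) : ℝ) ∂ν) atTop
        (𝓝 (ν.real K)) := by
    intro ν _
    have hind : ν.real K = ∫ z, K.indicator (fun _ => (1 : ℝ)) z ∂ν := by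
      rw [integral_indicator_const _ hK.measurableSet]; simp
    rw [hind]
    refine tendsto_integral_of_dominated_convergence (fun _ => 1) (fun n => ?_)
      (integrable_const 1) (fun n => ae_of_all _ fun z => ?_) (ae_of_all _ fun z => ?_)
    · exact (NNReal.continuous_coe.comp (thickenedIndicator (hδ n) K).continuous).aestronglyMeasurable
    · simpa using thickenedIndicator_le_one (hδ n) K z
    · have h1 := (thickenedIndicator_tendsto_indicator_closure hδ hδ0 K)
      rw [tendsto_pi_nhds] at h1
      have h2 := (NNReal.continuous_coe.tendsto _).comp (h1 z)
      rw [hK.isClosed.closure_eq] at h2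
      have h3 : (K.indicator (fun _ => (1 : ℝ)) z) =
          ((K.indicator (fun _ => (1 : ℝ≥0)) z : ℝ≥0) : ℝ) := by
        by_cases hz : z ∈ K
        · rw [indicator_of_mem hz, indicator_of_mem hz, NNReal.coe_one]
        · rw [indicator_of_notMem hz, indicator_of_notMem hz, NNReal.coe_zero]
      rw [h3]
      exact h2
  have heq : ∀ n, ∫ z, ((thickenedIndicator (hδ n) K z : ℝ≥0) : ℝ) ∂(μ t) =
      ∫ z, ((thickenedIndicator (hδ n) K z : ℝ≥0) : ℝ) ∂((μ 0).map (Z t 0)) := by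
    intro n
    have hcn : Continuous fun z => ((thickenedIndicator (hδ n) K z : ℝ≥0) : ℝ) :=
      NNReal.continuous_coe.comp (thickenedIndicator (hδ n) K).continuous
    rw [integral_map hZ.aemeasurable hcn.aestronglyMeasurable]
    refine (h.integral_comp_eq hp hμ hweak ht0 ht.2
      (χ := fun z => ((thickenedIndicator (hδ n) K z : ℝ≥0) : ℝ))
      (LipschitzWith.of_dist_le_mul fun z z' => (NNReal.dist_eq _ _).ge.trans
        ((lipschitzWith_thickenedIndicator (hδ n) K).dist_le_mul z z'))
      (R₀ := R₀ + δ n) (by have := hδ n; positivity) fun z hz => ?_).symm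
    rw [NNReal.coe_eq_zero]
    refine thickenedIndicator_zero (hδ n) K fun hmem => ?_
    rw [Metric.mem_thickening_iff] at hmem
    obtain ⟨y, hy, hzy⟩ := hmem
    have h3 : ‖z‖ ≤ ‖y‖ + dist z y := by
      rw [dist_eq_norm]; simpa using norm_add_le y (z - y)
    linarith [hR₀ y hy]
  have h1 := happ (μ t) inferInstance
  simp only [heq] at h1
  have h2 := tendsto_nhds_unique h1 (happ ((μ 0).map (Z t 0)) inferInstance)
  exact (measureReal_eq_measureReal_iff).1 h2

end Uniqueness

/-! ### Consequences of the Wasserstein continuity and of the `W^{1,∞}` bounds -/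

lemma exists_plan_of_wasserstein_lt {μ ν : Measure Phase} {η : ℝ≥0∞}
    (h : wasserstein μ ν < η) :
    ∃ γ : Measure (Phase × Phase), IsTransportPlan γ μ ν ∧
      ∫⁻ z, (‖z.1.1 - z.2.1‖ₑ ^ 2 + ‖z.1.2 - z.2.2‖ₑ ^ 2) ∂γ < η ^ (2 : ℝ) := by
  have h1 : (⨅ (γ : Measure (Phase × Phase)) (_ : IsTransportPlan γ μ ν),
    ∫⁻ z, (‖z.1.1 - z.2.1‖ₑ ^ 2 + ‖z.1.2 - z.2.2‖ₑ ^ 2) ∂γ) < η ^ (2 : ℝ) := by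
    by_contra hle
    rw [not_lt] at hle
    have := ENNReal.rpow_le_rpow hle (show (0 : ℝ) ≤ 1 / 2 by norm_num)
    rw [← ENNReal.rpow_mul] at this
    norm_num at this
    unfold wasserstein at h
    norm_num at h
    exact absurd h (not_lt.2 this)
  simp only [iInf_lt_iff] at h1
  obtain ⟨γ, hγ, h2⟩ := h1
  exact ⟨γ, hγ, h2⟩

/-- Under a nearly optimal plan, pairs at distance less than `δ` contribute at most `ε / 2` by
uniform continuity. For the remaining pairs the crude bound `2 * C` is at most `A = 2 * C / δ ^ 2`
times the quadratic cost, as in Chebyshev's inequality. -/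
lemma exists_wasserstein_lt_imp {χ : Phase → ℝ} (hχ : UniformContinuous χ) {C : ℝ}
    (hC : ∀ z, |χ z| ≤ C) {ε : ℝ} (hε : 0 < ε) :
    ∃ η : ℝ≥0∞, 0 < η ∧ ∀ μ ν : Measure Phase, IsProbabilityMeasure μ → IsProbabilityMeasure ν →
      wasserstein μ ν < η → |∫ z, χ z ∂μ - ∫ z, χ z ∂ν| ≤ ε := by
  obtain ⟨δ, hδ, hχδ⟩ := Metric.uniformContinuous_iff.1 hχ (ε / 2) (half_pos hε)
  have hC0 : 0 ≤ C := (abs_nonneg _).trans (hC 0)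
  set A : ℝ := 2 * C / δ ^ 2 with hA
  have hA0 : 0 ≤ A := by positivity
  set η : ℝ := √(ε / 2 / (A + 1)) with hη
  have hη0 : 0 < η := Real.sqrt_pos.2 (by positivity)
  refine ⟨ENNReal.ofReal η, ENNReal.ofReal_pos.2 hη0, fun μ ν _ _ h => ?_⟩
  obtain ⟨γ, ⟨hγ1, hγ2⟩, hcost⟩ := exists_plan_of_wasserstein_lt h
  have hγ : IsProbabilityMeasure γ := by
    constructor
    rw [← preimage_univ (f := Prod.fst), ← Measure.map_apply measurable_fst MeasurableSet.univ, hγ1]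
    exact measure_univ
  have hχm : ∀ m : Measure Phase, AEStronglyMeasurable χ m := fun m =>
    hχ.continuous.aestronglyMeasurable
  have hi1 : Integrable (fun z : Phase × Phase => χ z.1) γ :=
    Integrable.of_bound (hχ.continuous.comp continuous_fst).aestronglyMeasurable C
      (ae_of_all _ fun z => hC _)
  have hi2 : Integrable (fun z : Phase × Phase => χ z.2) γ :=
    Integrable.of_bound (hχ.continuous.comp continuous_snd).aestronglyMeasurable C
      (ae_of_all _ fun z => hC _)
  have heq : ∫ z, χ z ∂μ - ∫ z, χ z ∂ν = ∫ z, (χ z.1 - χ z.2) ∂γ := by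
    rw [integral_sub hi1 hi2, ← hγ1, ← hγ2, integral_map measurable_fst.aemeasurable (hχm _),
      integral_map measurable_snd.aemeasurable (hχm _)]
  have hpt : ∀ z : Phase × Phase, ‖χ z.1 - χ z.2‖ ≤
      ε / 2 + A * (‖z.1.1 - z.2.1‖ ^ 2 + ‖z.1.2 - z.2.2‖ ^ 2) := by
    intro z
    by_cases hz : dist z.1 z.2 < δ
    · have := (hχδ hz).le
      rw [dist_eq_norm] at this
      exact this.trans (le_add_of_nonneg_right (by positivity))
    · rw [not_lt] at hz
      have h1 : δ ^ 2 ≤ ‖z.1.1 - z.2.1‖ ^ 2 + ‖z.1.2 - z.2.2‖ ^ 2 := by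
        rw [Prod.dist_eq, dist_eq_norm, dist_eq_norm] at hz
        rcases le_max_iff.1 hz with hz | hz
        · exact (pow_le_pow_left₀ hδ.le hz 2).trans (le_add_of_nonneg_right (by positivity))
        · exact (pow_le_pow_left₀ hδ.le hz 2).trans (le_add_of_nonneg_left (by positivity))
      have h2 : ‖χ z.1 - χ z.2‖ ≤ 2 * C := by
        refine (norm_sub_le _ _).trans ?_
        have := hC z.1; have := hC z.2
        simp only [Real.norm_eq_abs]; linarith
      have h3 : 2 * C = A * δ ^ 2 := by rw [hA]; field_simp
      have h4 := mul_le_mul_of_nonneg_left h1 hA0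
      linarith
  have hcm : Measurable fun z : Phase × Phase =>
      ‖z.1.1 - z.2.1‖ₑ ^ 2 + ‖z.1.2 - z.2.2‖ₑ ^ 2 := by fun_prop
  have hle : ‖∫ z, (χ z.1 - χ z.2) ∂γ‖ₑ ≤ ENNReal.ofReal ε := by
    calc _ ≤ ∫⁻ z, ‖χ z.1 - χ z.2‖ₑ ∂γ := enorm_integral_le_lintegral_enorm _
      _ ≤ ∫⁻ z, (ENNReal.ofReal (ε / 2) + ENNReal.ofReal A *
          (‖z.1.1 - z.2.1‖ₑ ^ 2 + ‖z.1.2 - z.2.2‖ₑ ^ 2)) ∂γ := by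
        refine lintegral_mono fun z => ?_
        rw [← ofReal_norm, ← ofReal_norm, ← ofReal_norm,
          ← ENNReal.ofReal_pow (norm_nonneg _), ← ENNReal.ofReal_pow (norm_nonneg _),
          ← ENNReal.ofReal_add (by positivity) (by positivity), ← ENNReal.ofReal_mul hA0,
          ← ENNReal.ofReal_add (by positivity) (by positivity)]
        exact ENNReal.ofReal_le_ofReal (hpt z)
      _ ≤ ENNReal.ofReal (ε / 2) + ENNReal.ofReal A * ENNReal.ofReal η ^ (2 : ℝ) := by
        rw [lintegral_add_left measurable_const, lintegral_const, measure_univ, mul_one,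
          lintegral_const_mul _ hcm]
        gcongr
      _ ≤ ENNReal.ofReal ε := by
        rw [ENNReal.ofReal_rpow_of_pos hη0, ← ENNReal.ofReal_mul hA0,
          ← ENNReal.ofReal_add (by positivity) (by positivity)]
        refine ENNReal.ofReal_le_ofReal ?_
        have : η ^ (2 : ℝ) = ε / 2 / (A + 1) := by
          rw [Real.rpow_two, hη, Real.sq_sqrt (by positivity)]
        rw [this, ← mul_div_assoc, ]
        have : A * (ε / 2) / (A + 1) ≤ ε / 2 := by
          rw [div_le_iff₀ (by positivity)]; nlinarith
        linarith
  rw [heq]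
  rw [← ofReal_norm] at hle
  exact (ENNReal.ofReal_le_ofReal_iff hε.le).1 hle

lemma continuousOn_integral_of_wasserstein {T : ℝ} {f : ℝ → Measure Phase}
    (hp : ∀ t ∈ Icc 0 T, IsProbabilityMeasure (f t))
    (hW : ∀ t ∈ Icc 0 T, Tendsto (fun s => wasserstein (f s) (f t)) (𝓝[Icc 0 T] t) (𝓝 0))
    {χ : Phase → ℝ} (hχ : Continuous χ) (hχc : HasCompactSupport χ) :
    ContinuousOn (fun t => ∫ z, χ z ∂f t) (Icc 0 T) := by
  intro t ht
  obtain ⟨C, hC⟩ := hχ.bounded_above_of_compact_support hχc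
  rw [ContinuousWithinAt, Metric.tendsto_nhds]
  intro ε hε
  obtain ⟨η, hη, h⟩ := exists_wasserstein_lt_imp (hχc.uniformContinuous_of_continuous hχ) hC
    (half_pos hε)
  filter_upwards [(hW t ht).eventually_lt_const hη, self_mem_nhdsWithin] with s hs hs2
  rw [Real.dist_eq]
  exact (h _ _ (hp s hs2) (hp t ht) hs).trans_lt (half_lt_self hε)

lemma norm_le_of_eLpNorm_top_le {w : Space → Space} (hw : Continuous w) {M : ℝ≥0}
    (h : eLpNorm w ∞ volume ≤ M) (x : Space) : ‖w x‖ ≤ M := by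
  have h1 : ∀ᵐ x : Space, ‖w x‖ ≤ M := by
    filter_upwards [ae_le_eLpNormEssSup (f := w) (μ := volume)] with x hx
    rw [eLpNorm_exponent_top] at h
    have := hx.trans h
    rw [enorm_eq_nnnorm, ENNReal.coe_le_coe] at this
    exact_mod_cast this
  have h2 : IsClosed {x | ‖w x‖ ≤ M} := isClosed_le hw.norm continuous_const
  exact (h2.closure_eq ▸ (Measure.dense_of_ae h1) x : x ∈ {x | ‖w x‖ ≤ M})

open ContinuousLinearMap in
-- The weak-gradient identity tested with a translated mollifier says that the derivative of a
-- mollification of `w` is the mollification of `G`, hence bounded by `L`. The Lipschitz bound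
-- survives pointwise convergence, at every point because `w` is continuous.
lemma HasWeakGradient.lipschitzWith {w : Space → Space} {G : Space → Space →L[ℝ] Space}
    (h : HasWeakGradient w G) (hw : Continuous w) {L : ℝ≥0} (hG : ∀ᵐ x : Space, ‖G x‖ ≤ L) :
    LipschitzWith L w := by
  let φ : ℕ → ContDiffBump (0 : Space) := fun n =>
      ⟨1 / (n + 1) / 2, 1 / (n + 1), by positivity, half_lt_self (by positivity)⟩
  have hφ : Tendsto (fun n => (φ n).rOut) atTop (𝓝 0) := tendsto_one_div_add_atTop_nhds_zero_nat
  have hlim := fun x => ContDiffBump.convolution_tendsto_right_of_continuous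
    (μ := (volume : Measure Space)) hφ hw x
  have hlip : ∀ n, LipschitzWith L
      (convolution ((φ n).normed volume) w (lsmul ℝ ℝ) volume) := by
    intro n
    set p := (φ n).normed (volume : Measure Space) with hp
    have hpc : HasCompactSupport p := (φ n).hasCompactSupport_normed
    have hps : ContDiff ℝ ∞ p := (φ n).contDiff_normed
    have hd : ∀ x, HasFDerivAt (convolution p w (lsmul ℝ ℝ) volume)
        (convolution (fderiv ℝ p) w ((lsmul ℝ ℝ).precompL Space) volume x) x := fun x =>
      hpc.hasFDerivAt_convolution_left (lsmul ℝ ℝ) (hps.of_le (by simp)) hw.locallyIntegrable x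
    refine lipschitzWith_of_nnnorm_fderiv_le (𝕜 := ℝ) (fun x => (hd x).differentiableAt) fun x => ?_
    rw [(hd x).fderiv, ← NNReal.coe_le_coe, coe_nnnorm]
    refine opNorm_le_bound _ L.2 fun e => ?_
    have hex := (hpc.fderiv ℝ).convolutionExists_left ((lsmul ℝ ℝ).precompL Space)
      (hps.continuous_fderiv (by simp)) hw.locallyIntegrable (μ := volume) x
    rw [convolution_eq_swap, ContinuousLinearMap.integral_apply hex.integrable_swap]
    have hq : ContDiff ℝ ∞ fun y => p (x - y) := hps.comp (contDiff_const.sub contDiff_id)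
    have hqc : HasCompactSupport fun y => p (x - y) :=
      hpc.comp_homeomorph (Homeomorph.subLeft x)
    have hw1 := h.integral_eq _ hq hqc e
    have hder : ∀ y, fderiv ℝ (fun y => p (x - y)) y e = - fderiv ℝ p (x - y) e := by
      intro y
      have h1 : HasFDerivAt (fun y => x - y) (-ContinuousLinearMap.id ℝ Space) y :=
        (hasFDerivAt_id y).const_sub x
      have h2 := (((hps.differentiable (by simp)) (x - y)).hasFDerivAt.comp y h1).fderiv
      have h3 : fderiv ℝ (fun y => p (x - y)) y = _ := h2
      rw [h3]; simp
    simp only [hder, neg_smul, integral_neg, neg_inj] at hw1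
    simp only [precompL_apply, lsmul_apply]
    rw [hw1]
    have hpi : Integrable fun y => p (x - y) := (φ n).integrable_normed.comp_sub_left x
    calc ‖∫ y, p (x - y) • G y e‖ ≤ ∫ y, p (x - y) * (L * ‖e‖) := by
          refine norm_integral_le_of_norm_le (hpi.mul_const _) ?_
          filter_upwards [hG] with y hy
          have hp0 : 0 ≤ p (x - y) := (φ n).nonneg_normed _
          rw [norm_smul, Real.norm_of_nonneg hp0]
          gcongr
          exact (le_opNorm _ _).trans (by gcongr)
      _ = L * ‖e‖ := by
          rw [integral_mul_const, integral_sub_left_eq_self (fun y => p y) volume x,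
            (φ n).integral_normed, one_mul]
  refine LipschitzWith.of_dist_le_mul fun x y => ?_
  exact le_of_tendsto ((hlim x).dist (hlim y)) (Eventually.of_forall fun n => (hlip n).dist_le_mul x y)

lemma w1InfNorm_bounds {w : Space → Space} (hw : Continuous w) {M : ℝ≥0}
    (h : w1InfNorm w ≤ M) : (∀ x, ‖w x‖ ≤ M) ∧ LipschitzWith (M + 1) w := by
  refine ⟨norm_le_of_eLpNorm_top_le hw (le_self_add.trans h), ?_⟩
  -- The slack `+ 1` gives a strict inequality, from which an actual weak gradient can be extracted
  -- without knowing that the infimum is attained.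
  have h1 : (⨅ (G : Space → Space →L[ℝ] Space) (_ : HasWeakGradient w G), eLpNorm G ∞ volume) <
      (M + 1 : ℝ≥0) := (le_add_self.trans h).trans_lt (by
        rw [ENNReal.coe_lt_coe]; exact lt_add_one M)
  simp only [iInf_lt_iff] at h1
  obtain ⟨G, hG, h2⟩ := h1
  refine hG.lipschitzWith hw ?_
  filter_upwards [ae_le_eLpNormEssSup (f := G) (μ := volume)] with x hx
  rw [eLpNorm_exponent_top] at h2
  have := hx.trans h2.le
  rw [enorm_eq_nnnorm, ENNReal.coe_le_coe] at this
  exact_mod_cast this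

lemma le_of_ae_le_of_continuousOn {k : ℝ → ℝ} {T c : ℝ} (hT : 0 < T)
    (hk : ContinuousOn k (Icc 0 T)) (h : ∀ᵐ t, t ∈ Ioo 0 T → k t ≤ c) :
    ∀ t ∈ Icc 0 T, k t ≤ c := by
  have h1 : (fun t => max (k t) c) =ᵐ[volume.restrict (Icc 0 T)] fun _ => c := by
    rw [← restrict_Ioo_eq_restrict_Icc, EventuallyEq, ae_restrict_iff' measurableSet_Ioo]
    filter_upwards [h] with t ht htT
    exact max_eq_right (ht htT)
  intro t ht
  have h2 := Measure.eqOn_Icc_of_ae_eq volume hT.ne h1 (ContinuousOn.sup hk continuousOn_const)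
    continuousOn_const ht
  exact (le_max_left _ _).trans_eq h2

/-! ### Solutions are transported by their characteristics -/

/-- The flow on phase space given by the characteristics. -/
def phaseFlow (X V : ℝ → ℝ → Space → Space → Space) (t s : ℝ) (z : Phase) : Phase :=
  (X t s z.1 z.2, V t s z.1 z.2)

section Solution

variable {K lam T : ℝ} {g : Space} {f₀ : Measure Phase} {f : ℝ → Measure Phase}
  {u : ℝ → Space → Space}

lemma IsVlasovStokesSolution.continuous_velocity (h : IsVlasovStokesSolution K lam T g f₀ f u)
    {t : ℝ} (ht : t ∈ Icc 0 T) : Continuous (u t) := by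
  rw [← continuousOn_univ]
  exact h.velocity_continuous.comp (f := fun x : Space => (t, x)) (by fun_prop)
    (fun x _ => ⟨ht, mem_univ _⟩)

/-- Pointwise values and differences of `u` are continuous in time, so the almost-everywhere bounds
hold at all times of the closed interval. The phase-space field is then uniformly Lipschitz at every
time, as the flow theory requires. -/
lemma IsVlasovStokesSolution.exists_velocity_bounds (h : IsVlasovStokesSolution K lam T g f₀ f u)
    (hT : 0 < T) :
    ∃ M : ℝ≥0, ∀ t ∈ Icc 0 T, (∀ x, ‖u t x‖ ≤ M) ∧ LipschitzWith M (u t) := by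
  obtain ⟨M, hM⟩ := h.velocity_bounded
  have hb : ∀ᵐ t, t ∈ Ioo 0 T → (∀ x, ‖u t x‖ ≤ M) ∧ LipschitzWith (M + 1) (u t) := by
    filter_upwards [hM] with t ht htT
    exact w1InfNorm_bounds (h.continuous_velocity (Ioo_subset_Icc_self htT)) (ht htT)
  have hc : ∀ x, ContinuousOn (fun t => u t x) (Icc 0 T) := fun x =>
    h.velocity_continuous.comp (f := fun t : ℝ => (t, x)) (by fun_prop)
      (fun t ht => ⟨ht, mem_univ _⟩)
  refine ⟨M + 1, fun t ht => ⟨fun x => ?_, LipschitzWith.of_dist_le_mul fun x y => ?_⟩⟩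
  · refine le_of_ae_le_of_continuousOn hT (hc x).norm ?_ t ht
    filter_upwards [hb] with s hs hsT
    exact ((hs hsT).1 x).trans (by simp)
  · refine le_of_ae_le_of_continuousOn hT (k := fun t => dist (u t x) (u t y))
      (continuous_dist.comp_continuousOn (ContinuousOn.prodMk (hc x) (hc y))) ?_ t ht
    filter_upwards [hb] with s hs hsT
    exact (hs hsT).2.dist_le_mul x y

lemma IsCharacteristics.exists_isLipschitzFlow {X V : ℝ → ℝ → Space → Space → Space}
    (hXV : IsCharacteristics lam T g u X V)
    (hu : ContinuousOn (fun p : ℝ × Space => u p.1 p.2) (Icc 0 T ×ˢ univ)) {M : ℝ≥0}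
    (hM : ∀ t ∈ Icc 0 T, LipschitzWith M (u t)) :
    ∃ L, IsLipschitzFlow T L (fun t (z : Phase) => (z.2, lam • (g + u t z.1 - z.2)))
      (phaseFlow X V) := by
  refine ⟨max 1 (‖lam‖₊ * (M + 1)), ⟨fun t ht => ?_, ?_, fun s hs z => ?_, fun s hs z t ht => ?_⟩⟩
  · refine LipschitzWith.prodMk LipschitzWith.prod_snd ?_
    have h1 : LipschitzWith (M + 1) fun z : Phase => g + u t z.1 - z.2 := by
      have h2 := ((LipschitzWith.const (α := Phase) g).add
        ((hM t ht).comp LipschitzWith.prod_fst)).sub LipschitzWith.prod_snd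
      simpa using h2
    exact (lipschitzWith_smul lam).comp h1
  · have h1 : ContinuousOn (fun p : ℝ × Phase => u p.1 p.2.1) (Icc 0 T ×ˢ univ) :=
      hu.comp (f := fun p : ℝ × Phase => (p.1, p.2.1)) (by fun_prop)
        (fun p hp => ⟨hp.1, mem_univ _⟩)
    exact (continuous_snd.comp continuous_snd).continuousOn.prodMk
      (((continuousOn_const.add h1).sub
        (continuous_snd.comp continuous_snd).continuousOn).const_smul lam)
  · simp [phaseFlow, hXV.position_initial s hs, hXV.velocity_initial s hs]
  · exact (hXV.position_deriv s hs z.1 z.2 t ht).prodMk (hXV.velocity_deriv s hs z.1 z.2 t ht)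

lemma IsVlasovStokesSolution.eq_map (h : IsVlasovStokesSolution K lam T g f₀ f u)
    {X V : ℝ → ℝ → Space → Space → Space} (hXV : IsCharacteristics lam T g u X V)
    (hT : 0 < T) {t : ℝ} (ht : t ∈ Icc 0 T) :
    Continuous (phaseFlow X V t 0) ∧ f t = f₀.map (phaseFlow X V t 0) := by
  obtain ⟨M, hM⟩ := h.exists_velocity_bounds hT
  obtain ⟨L, hL⟩ := hXV.exists_isLipschitzFlow h.velocity_continuous (fun t ht => (hM t ht).2)
  refine ⟨hL.continuous ⟨le_rfl, hT.le⟩ ht ht.1, ?_⟩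
  rw [← h.initial]
  exact hL.eq_map h.isProbabilityMeasure (fun χ hχ hχc =>
    continuousOn_integral_of_wasserstein h.isProbabilityMeasure h.continuous_wasserstein hχ hχc)
    h.vlasov ht

end Solution

/-! ### The regularized Stokeslet -/

/-- `(|x|² + ε²)^{-1/2}`. -/
def regInv (ε : ℝ) (x : Space) : ℝ := (√(‖x‖ ^ 2 + ε ^ 2))⁻¹

lemma regInv_nonneg (ε : ℝ) (x : Space) : 0 ≤ regInv ε x := by unfold regInv; positivity

lemma regInv_pos {ε : ℝ} (hε : 0 < ε) (x : Space) : 0 < regInv ε x := by unfold regInv; positivity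

lemma regInv_neg (ε : ℝ) (x : Space) : regInv ε (-x) = regInv ε x := by simp [regInv]

lemma regInv_zero (x : Space) : regInv 0 x = ‖x‖⁻¹ := by simp [regInv]

lemma regInv_sq_mul {ε : ℝ} (hε : 0 < ε) (x : Space) :
    regInv ε x ^ 2 * (‖x‖ ^ 2 + ε ^ 2) = 1 := by
  have h : 0 < ‖x‖ ^ 2 + ε ^ 2 := by positivity
  rw [regInv, inv_pow, Real.sq_sqrt h.le, inv_mul_cancel₀ h.ne']

lemma norm_mul_regInv_le (ε : ℝ) (x : Space) : ‖x‖ * regInv ε x ≤ 1 := by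
  have h : ‖x‖ ≤ √(‖x‖ ^ 2 + ε ^ 2) := Real.le_sqrt_of_sq_le (by nlinarith [sq_nonneg ε])
  rw [regInv, ← div_eq_mul_inv]
  exact div_le_one_of_le₀ h (by positivity)

lemma mul_regInv_le (ε : ℝ) (x : Space) : ε * regInv ε x ≤ 1 := by
  have h : ε ≤ √(‖x‖ ^ 2 + ε ^ 2) := Real.le_sqrt_of_sq_le (by nlinarith [sq_nonneg ‖x‖])
  rw [regInv, ← div_eq_mul_inv]
  exact div_le_one_of_le₀ h (by positivity)

lemma regInv_le_inv_norm (ε : ℝ) {x : Space} (hx : x ≠ 0) : regInv ε x ≤ ‖x‖⁻¹ := by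
  rw [regInv]
  have hx : 0 < ‖x‖ := norm_pos_iff.2 hx
  gcongr
  exact Real.le_sqrt_of_sq_le (by nlinarith [sq_nonneg ε])

lemma regInv_le {ε : ℝ} (hε : 0 < ε) (x : Space) :
    regInv ε x ≤ (1 + 1 / ε) * (1 + ‖x‖)⁻¹ := by
  have h1 := norm_mul_regInv_le ε x
  have h2 := mul_regInv_le ε x
  have h3 : regInv ε x ≤ 1 / ε := by rw [le_div_iff₀ hε]; linarith
  rw [← div_eq_mul_inv, le_div_iff₀ (by positivity)]
  linarith

lemma hasFDerivAt_regInv {ε : ℝ} (hε : 0 < ε) (x : Space) :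
    HasFDerivAt (regInv ε) (-(regInv ε x ^ 3) • innerSL ℝ x) x := by
  have hpos : 0 < ‖x‖ ^ 2 + ε ^ 2 := by positivity
  have h1 : HasFDerivAt (fun x : Space => ‖x‖ ^ 2 + ε ^ 2) (2 • innerSL ℝ x) x := by
    simpa using ((hasStrictFDerivAt_norm_sq x).hasFDerivAt).add_const (ε ^ 2)
  have h2 := (h1.sqrt hpos.ne')
  have h3 := (hasDerivAt_inv (Real.sqrt_pos.2 hpos).ne').comp_hasFDerivAt x h2
  refine h3.congr_fderiv ?_
  rw [smul_smul, two_smul, ← two_smul ℝ, smul_smul]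
  congr 1
  have hs : √(‖x‖ ^ 2 + ε ^ 2) ≠ 0 := (Real.sqrt_pos.2 hpos).ne'
  simp only [regInv]
  field_simp

lemma contDiff_regInv {ε : ℝ} (hε : 0 < ε) : ContDiff ℝ ∞ (regInv ε) := by
  have hpos : ∀ x : Space, ‖x‖ ^ 2 + ε ^ 2 ≠ 0 := fun x => by positivity
  have h1 : ContDiff ℝ ∞ fun x : Space => ‖x‖ ^ 2 + ε ^ 2 := (contDiff_norm_sq ℝ).add contDiff_const
  exact (h1.sqrt hpos).inv fun x => (Real.sqrt_pos.2 (by positivity)).ne'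

lemma measurable_regInv (ε : ℝ) : Measurable (regInv ε) := by unfold regInv; fun_prop

/-- The (regularized, not normalized) fundamental solution of the Stokes equation, applied to the
vector `h`. -/
def stokeslet (ε : ℝ) (x h : Space) : Space :=
  (regInv ε x + ε ^ 2 * regInv ε x ^ 3) • h + (regInv ε x ^ 3 * inner ℝ h x) • x

/-- The derivative of `stokeslet ε · h` in direction `e`. -/
def stokesletDeriv (ε : ℝ) (h e x : Space) : Space :=
  -(inner ℝ x e * (regInv ε x ^ 3 + 3 * ε ^ 2 * regInv ε x ^ 5)) • h
    + (regInv ε x ^ 3 * inner ℝ h e) • x + (regInv ε x ^ 3 * inner ℝ h x) • e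
    - (3 * regInv ε x ^ 5 * inner ℝ x e * inner ℝ h x) • x

/-- The derivative of `stokesletDeriv ε h e` in direction `e`. -/
def stokesletDeriv₂ (ε : ℝ) (h e x : Space) : Space :=
  (-(inner ℝ e e * (regInv ε x ^ 3 + 3 * ε ^ 2 * regInv ε x ^ 5))
      + inner ℝ x e ^ 2 * (3 * regInv ε x ^ 5 + 15 * ε ^ 2 * regInv ε x ^ 7)) • h
    + (2 * regInv ε x ^ 3 * inner ℝ h e - 6 * regInv ε x ^ 5 * inner ℝ x e * inner ℝ h x) • e
    + (-6 * regInv ε x ^ 5 * inner ℝ x e * inner ℝ h e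
      + 15 * regInv ε x ^ 7 * inner ℝ x e ^ 2 * inner ℝ h x
      - 3 * regInv ε x ^ 5 * inner ℝ e e * inner ℝ h x) • x

/-- The pressure of the regularized Stokeslet. -/
def stokesletPressure (ε : ℝ) (h x : Space) : ℝ :=
  inner ℝ h x * (2 * regInv ε x ^ 3 + 3 * ε ^ 2 * regInv ε x ^ 5)

/-- The derivative of the pressure in direction `e`. -/
def stokesletPressureDeriv (ε : ℝ) (h e x : Space) : ℝ :=
  inner ℝ h e * (2 * regInv ε x ^ 3 + 3 * ε ^ 2 * regInv ε x ^ 5)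
    - inner ℝ h x * inner ℝ x e * (6 * regInv ε x ^ 5 + 15 * ε ^ 2 * regInv ε x ^ 7)

section Derivatives

variable {ε : ℝ} (hε : 0 < ε) (h e : Space)
include hε

lemma contDiff_stokeslet : ContDiff ℝ ∞ fun x => stokeslet ε x h := by
  have := contDiff_regInv hε
  have h1 : ContDiff ℝ ∞ fun x : Space => (inner ℝ h x : ℝ) := contDiff_const.inner ℝ contDiff_id
  unfold stokeslet
  fun_prop

lemma contDiff_stokesletDeriv : ContDiff ℝ ∞ (stokesletDeriv ε h e) := by
  have := contDiff_regInv hε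
  have h1 : ContDiff ℝ ∞ fun x : Space => (inner ℝ h x : ℝ) := contDiff_const.inner ℝ contDiff_id
  have h2 : ContDiff ℝ ∞ fun x : Space => (inner ℝ x e : ℝ) := contDiff_id.inner ℝ contDiff_const
  unfold stokesletDeriv
  fun_prop

lemma contDiff_stokesletPressure : ContDiff ℝ ∞ (stokesletPressure ε h) := by
  have := contDiff_regInv hε
  have h1 : ContDiff ℝ ∞ fun x : Space => (inner ℝ h x : ℝ) := contDiff_const.inner ℝ contDiff_id
  unfold stokesletPressure
  fun_prop

lemma fderiv_stokeslet (x : Space) : fderiv ℝ (fun x => stokeslet ε x h) x e =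
    stokesletDeriv ε h e x := by
  have hs := hasFDerivAt_regInv hε x
  have hin : HasFDerivAt (fun x : Space => inner ℝ h x) (innerSL ℝ h) x :=
    (innerSL ℝ h).hasFDerivAt
  have := ((hs.add ((hs.pow 3).const_mul (ε ^ 2))).smul_const h).add
    (((hs.pow 3).mul hin).smul (hasFDerivAt_id x))
  have h2 : fderiv ℝ (fun x => stokeslet ε x h) x = _ := this.fderiv
  rw [h2]
  simp [stokesletDeriv]
  match_scalars <;> ring

lemma fderiv_stokesletDeriv (x : Space) : fderiv ℝ (stokesletDeriv ε h e) x e =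
    stokesletDeriv₂ ε h e x := by
  have hs := hasFDerivAt_regInv hε x
  have hin : HasFDerivAt (fun x : Space => inner ℝ h x) (innerSL ℝ h) x :=
    (innerSL ℝ h).hasFDerivAt
  have hie : HasFDerivAt (fun x : Space => inner ℝ x e) (innerSL ℝ e) x := by
    simp_rw [real_inner_comm e]
    exact (innerSL ℝ e).hasFDerivAt
  have := ((((hie.mul ((hs.pow 3).add ((hs.pow 5).const_mul (3 * ε ^ 2)))).neg.smul_const h).add
    (((hs.pow 3).mul_const (inner ℝ h e)).smul (hasFDerivAt_id x))).add
    (((hs.pow 3).mul hin).smul_const e)).sub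
    ((((((hs.pow 5).const_mul 3).mul hie).mul hin)).smul (hasFDerivAt_id x))
  have h2 : fderiv ℝ (stokesletDeriv ε h e) x = _ := this.fderiv
  rw [h2]
  simp [stokesletDeriv₂]
  match_scalars <;> ring

lemma fderiv_stokesletPressure (x : Space) : fderiv ℝ (stokesletPressure ε h) x e =
    stokesletPressureDeriv ε h e x := by
  have hs := hasFDerivAt_regInv hε x
  have hin : HasFDerivAt (fun x : Space => inner ℝ h x) (innerSL ℝ h) x :=
    (innerSL ℝ h).hasFDerivAt
  have := hin.mul (((hs.pow 3).const_mul 2).add ((hs.pow 5).const_mul (3 * ε ^ 2)))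
  have h2 : fderiv ℝ (stokesletPressure ε h) x = _ := this.fderiv
  rw [h2]
  simp [stokesletPressureDeriv]
  ring

end Derivatives

/-! #### Bounds -/

lemma abs_inner_smul_le {ε : ℝ} (x e : Space) :
    |inner ℝ (regInv ε x • x) e| ≤ ‖e‖ := by
  refine (abs_real_inner_le_norm _ _).trans ?_
  rw [norm_smul, Real.norm_of_nonneg (regInv_nonneg ε x), mul_comm (regInv ε x)]
  exact mul_le_of_le_one_left (norm_nonneg _) (norm_mul_regInv_le ε x)

/-- With `s = regInv ε x`, the quantities `s • x` and `ε * s` have size at most `1`, and the kernel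
is `s` times an expression in them. The same normalization gives the bounds below, with one further
power of `s` for each derivative; the pressure scales like the first derivative of the kernel. -/
lemma norm_stokeslet_le {ε : ℝ} (hε : 0 ≤ ε) (x h : Space) :
    ‖stokeslet ε x h‖ ≤ 3 * regInv ε x * ‖h‖ := by
  set s := regInv ε x with hs
  have hs0 : 0 ≤ s := regInv_nonneg ε x
  have h1 := norm_mul_regInv_le ε x
  have h2 := mul_regInv_le ε x
  rw [← hs] at h1 h2
  have h3 : (ε * s) ^ 2 ≤ 1 := pow_le_one₀ (by positivity) h2
  have h4 : |inner ℝ h (s • x)| ≤ ‖h‖ := by rw [real_inner_comm]; exact abs_inner_smul_le x h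
  have heq : stokeslet ε x h =
      s • ((1 + (ε * s) ^ 2) • h + (inner ℝ h (s • x)) • s • x) := by
    simp only [stokeslet, ← hs, inner_smul_right]
    module
  rw [heq, norm_smul, Real.norm_of_nonneg hs0, mul_comm (3 : ℝ), mul_assoc]
  refine mul_le_mul_of_nonneg_left ?_ hs0
  refine (norm_add_le _ _).trans ?_
  rw [norm_smul, norm_smul, norm_smul, Real.norm_of_nonneg hs0, Real.norm_of_nonneg (by positivity),
    Real.norm_eq_abs, mul_comm s]
  have := mul_le_mul h4 h1 (by positivity) (norm_nonneg _)
  nlinarith [norm_nonneg h]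

lemma norm_stokesletDeriv_le {ε : ℝ} (hε : 0 ≤ ε) (h e x : Space) :
    ‖stokesletDeriv ε h e x‖ ≤ 9 * ‖h‖ * ‖e‖ * regInv ε x ^ 2 := by
  set s := regInv ε x with hs
  have hs0 : 0 ≤ s := regInv_nonneg ε x
  have h1 : ‖s • x‖ ≤ 1 := by
    rw [norm_smul, Real.norm_of_nonneg hs0, mul_comm]; exact norm_mul_regInv_le ε x
  have h2 : ε * s ≤ 1 := mul_regInv_le ε x
  have h3 : (ε * s) ^ 2 ≤ 1 := pow_le_one₀ (by positivity) h2
  have h4 : |inner ℝ (s • x) h| ≤ ‖h‖ := abs_inner_smul_le x h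
  have h5 : |inner ℝ (s • x) e| ≤ ‖e‖ := abs_inner_smul_le x e
  have h6 : |inner ℝ h e| ≤ ‖h‖ * ‖e‖ := abs_real_inner_le_norm h e
  have heq : stokesletDeriv ε h e x = s ^ 2 •
      (-(inner ℝ (s • x) e * (1 + 3 * (ε * s) ^ 2)) • h + inner ℝ h e • s • x
        + inner ℝ (s • x) h • e - (3 * (inner ℝ (s • x) e * inner ℝ (s • x) h)) • s • x) := by
    simp only [stokesletDeriv, ← hs, real_inner_smul_left, real_inner_comm x h]
    module
  rw [heq, norm_smul, norm_pow, Real.norm_of_nonneg hs0, mul_comm _ (s ^ 2)]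
  refine mul_le_mul_of_nonneg_left ?_ (by positivity)
  have t1 : ‖-(inner ℝ (s • x) e * (1 + 3 * (ε * s) ^ 2)) • h‖ ≤ ‖e‖ * 4 * ‖h‖ := by
    rw [norm_smul, norm_neg, norm_mul, Real.norm_eq_abs, Real.norm_of_nonneg (by positivity)]
    gcongr; linarith
  have t2 : ‖inner ℝ h e • s • x‖ ≤ ‖h‖ * ‖e‖ * 1 := by
    rw [norm_smul, Real.norm_eq_abs]; gcongr
  have t3 : ‖inner ℝ (s • x) h • e‖ ≤ ‖h‖ * ‖e‖ := by
    rw [norm_smul, Real.norm_eq_abs]; gcongr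
  have t4 : ‖(3 * (inner ℝ (s • x) e * inner ℝ (s • x) h)) • s • x‖ ≤ 3 * (‖e‖ * ‖h‖) * 1 := by
    rw [norm_smul, norm_mul, norm_mul, Real.norm_eq_abs, Real.norm_eq_abs, Real.norm_eq_abs,
      abs_of_pos (by norm_num : (0 : ℝ) < 3)]
    gcongr
  refine (norm_sub_le _ _).trans ?_
  have := norm_add₃_le (a := -(inner ℝ (s • x) e * (1 + 3 * (ε * s) ^ 2)) • h)
    (b := inner ℝ h e • s • x) (c := inner ℝ (s • x) h • e)
  linarith

lemma norm_stokesletDeriv₂_le {ε : ℝ} (hε : 0 ≤ ε) (h e x : Space) :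
    ‖stokesletDeriv₂ ε h e x‖ ≤ 54 * ‖h‖ * ‖e‖ ^ 2 * regInv ε x ^ 3 := by
  set s := regInv ε x with hs
  have hs0 : 0 ≤ s := regInv_nonneg ε x
  have h1 : ‖s • x‖ ≤ 1 := by
    rw [norm_smul, Real.norm_of_nonneg hs0, mul_comm]; exact norm_mul_regInv_le ε x
  have h2 : ε * s ≤ 1 := mul_regInv_le ε x
  have h3 : (ε * s) ^ 2 ≤ 1 := pow_le_one₀ (by positivity) h2
  set a := inner ℝ (s • x) h with ha
  set b := inner ℝ (s • x) e with hb
  have h4 : |a| ≤ ‖h‖ := abs_inner_smul_le x h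
  have h5 : |b| ≤ ‖e‖ := abs_inner_smul_le x e
  have h6 : |inner ℝ h e| ≤ ‖h‖ * ‖e‖ := abs_real_inner_le_norm h e
  have heq : stokesletDeriv₂ ε h e x = s ^ 3 •
      ((-(‖e‖ ^ 2 * (1 + 3 * (ε * s) ^ 2)) + b ^ 2 * (3 + 15 * (ε * s) ^ 2)) • h
        + (2 * inner ℝ h e - 6 * (b * a)) • e
        + (-(6 * (b * inner ℝ h e)) + 15 * (b ^ 2 * a) - 3 * (‖e‖ ^ 2 * a)) • s • x) := by
    simp only [stokesletDeriv₂, ← hs, ha, hb, real_inner_smul_left, real_inner_comm x h,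
      real_inner_self_eq_norm_sq]
    module
  rw [heq, norm_smul, norm_pow, Real.norm_of_nonneg hs0, mul_comm _ (s ^ 3)]
  refine mul_le_mul_of_nonneg_left ?_ (by positivity)
  have hb2 : b ^ 2 ≤ ‖e‖ ^ 2 := by rw [← sq_abs]; gcongr
  have hba : |b * a| ≤ ‖e‖ * ‖h‖ := by rw [abs_mul]; gcongr
  have hbh : |b * inner ℝ h e| ≤ ‖e‖ * (‖h‖ * ‖e‖) := by rw [abs_mul]; gcongr
  have hbba : |b ^ 2 * a| ≤ ‖e‖ ^ 2 * ‖h‖ := by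
    rw [abs_mul, abs_of_nonneg (sq_nonneg b)]; gcongr
  have hea : |‖e‖ ^ 2 * a| ≤ ‖e‖ ^ 2 * ‖h‖ := by
    rw [abs_mul, abs_of_nonneg (sq_nonneg ‖e‖)]; gcongr
  have c1 : |-(‖e‖ ^ 2 * (1 + 3 * (ε * s) ^ 2)) + b ^ 2 * (3 + 15 * (ε * s) ^ 2)| ≤
      22 * ‖e‖ ^ 2 := by
    have p1 : ‖e‖ ^ 2 * (1 + 3 * (ε * s) ^ 2) ≤ ‖e‖ ^ 2 * 4 := by gcongr; linarith
    have p2 : b ^ 2 * (3 + 15 * (ε * s) ^ 2) ≤ ‖e‖ ^ 2 * 18 := by gcongr; linarith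
    have p3 : 0 ≤ ‖e‖ ^ 2 * (1 + 3 * (ε * s) ^ 2) := by positivity
    have p4 : 0 ≤ b ^ 2 * (3 + 15 * (ε * s) ^ 2) := by positivity
    rw [abs_le]; constructor <;> linarith
  have c2 : |2 * inner ℝ h e - 6 * (b * a)| ≤ 8 * (‖h‖ * ‖e‖) := by
    rw [abs_le] at h6 hba ⊢; constructor <;> linarith
  have c3 : |-(6 * (b * inner ℝ h e)) + 15 * (b ^ 2 * a) - 3 * (‖e‖ ^ 2 * a)| ≤
      24 * (‖e‖ ^ 2 * ‖h‖) := by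
    have : ‖e‖ * (‖h‖ * ‖e‖) = ‖e‖ ^ 2 * ‖h‖ := by ring
    rw [this] at hbh
    rw [abs_le] at hbh hbba hea ⊢; constructor <;> linarith
  refine (norm_add₃_le).trans ?_
  rw [norm_smul, norm_smul, norm_smul _ (s • x), Real.norm_eq_abs, Real.norm_eq_abs,
    Real.norm_eq_abs]
  have d1 := mul_le_mul_of_nonneg_right c1 (norm_nonneg h)
  have d2 := mul_le_mul_of_nonneg_right c2 (norm_nonneg e)
  have d3 := mul_le_mul c3 h1 (norm_nonneg _) (by positivity)
  linarith

lemma abs_stokesletPressure_le {ε : ℝ} (hε : 0 ≤ ε) (h x : Space) :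
    |stokesletPressure ε h x| ≤ 5 * ‖h‖ * regInv ε x ^ 2 := by
  set s := regInv ε x with hs
  have hs0 : 0 ≤ s := regInv_nonneg ε x
  have h2 : ε * s ≤ 1 := mul_regInv_le ε x
  have h3 : (ε * s) ^ 2 ≤ 1 := pow_le_one₀ (by positivity) h2
  have h4 : |inner ℝ (s • x) h| ≤ ‖h‖ := abs_inner_smul_le x h
  have heq : stokesletPressure ε h x =
      s ^ 2 * (inner ℝ (s • x) h * (2 + 3 * (ε * s) ^ 2)) := by
    simp only [stokesletPressure, ← hs, real_inner_smul_left, real_inner_comm x h]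
    ring
  rw [heq, abs_mul, abs_mul, abs_of_nonneg (by positivity : 0 ≤ s ^ 2), mul_comm _ (s ^ 2),
    abs_of_nonneg (by positivity : 0 ≤ 2 + 3 * (ε * s) ^ 2), mul_comm 5]
  gcongr
  linarith

lemma abs_stokesletPressureDeriv_le {ε : ℝ} (hε : 0 ≤ ε) (h e x : Space) :
    |stokesletPressureDeriv ε h e x| ≤ 26 * ‖h‖ * ‖e‖ * regInv ε x ^ 3 := by
  set s := regInv ε x with hs
  have hs0 : 0 ≤ s := regInv_nonneg ε x
  have h2 : ε * s ≤ 1 := mul_regInv_le ε x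
  have h3 : (ε * s) ^ 2 ≤ 1 := pow_le_one₀ (by positivity) h2
  set a := inner ℝ (s • x) h with ha
  set b := inner ℝ (s • x) e with hb
  have h4 : |a| ≤ ‖h‖ := abs_inner_smul_le x h
  have h5 : |b| ≤ ‖e‖ := abs_inner_smul_le x e
  have h6 : |inner ℝ h e| ≤ ‖h‖ * ‖e‖ := abs_real_inner_le_norm h e
  have heq : stokesletPressureDeriv ε h e x =
      s ^ 3 * (inner ℝ h e * (2 + 3 * (ε * s) ^ 2) - a * b * (6 + 15 * (ε * s) ^ 2)) := by
    simp only [stokesletPressureDeriv, ← hs, ha, hb, real_inner_smul_left, real_inner_comm x h]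
    ring
  rw [heq, abs_mul, abs_of_nonneg (by positivity : 0 ≤ s ^ 3), mul_comm _ (s ^ 3)]
  refine mul_le_mul_of_nonneg_left ?_ (by positivity)
  refine (abs_sub _ _).trans ?_
  rw [abs_mul, abs_mul (a * b), abs_mul a b, abs_of_nonneg (by positivity : 0 ≤ 2 + 3 * (ε * s) ^ 2),
    abs_of_nonneg (by positivity : 0 ≤ 6 + 15 * (ε * s) ^ 2)]
  have e1 : |inner ℝ h e| * (2 + 3 * (ε * s) ^ 2) ≤ ‖h‖ * ‖e‖ * 5 := by gcongr; linarith
  have e2 : |a| * |b| * (6 + 15 * (ε * s) ^ 2) ≤ ‖h‖ * ‖e‖ * 21 := by gcongr; linarith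
  linarith

/-! #### The Stokes equation -/

/-- The correction `ε ^ 2 * regInv ε x ^ 3` in the kernel is what makes it exactly divergence free:
the sum is a multiple of `regInv ε x ^ 2 * (‖x‖ ^ 2 + ε ^ 2) - 1`. -/
lemma sum_stokesletDeriv_apply (ε : ℝ) (hε : 0 < ε) (h x : Space) :
    ∑ i : Fin 3, (stokesletDeriv ε h (EuclideanSpace.single i 1) x) i = 0 := by
  have hs := regInv_sq_mul hε x
  have key : ∀ i : Fin 3, (stokesletDeriv ε h (EuclideanSpace.single i 1) x) i =
      -(x i * (regInv ε x ^ 3 + 3 * ε ^ 2 * regInv ε x ^ 5)) * h i + regInv ε x ^ 3 * h i * x i +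
      regInv ε x ^ 3 * inner ℝ h x - 3 * regInv ε x ^ 5 * x i * inner ℝ h x * x i := fun i => by
    simp [stokesletDeriv, EuclideanSpace.inner_single_right]
  have hn : ‖x‖ ^ 2 = x 0 ^ 2 + x 1 ^ 2 + x 2 ^ 2 := by
    rw [EuclideanSpace.norm_sq_eq, Fin.sum_univ_three]; simp
  have hi : inner ℝ h x = x 0 * h 0 + x 1 * h 1 + x 2 * h 2 := by
    simp [PiLp.inner_apply, Fin.sum_univ_three]
  rw [Fin.sum_univ_three, key, key, key]
  rw [hn] at hs
  rw [hi]
  linear_combination (-3 * regInv ε x ^ 3 * (x 0 * h 0 + x 1 * h 1 + x 2 * h 2)) * hs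

/-- The Stokes equation for the regularized Stokeslet. -/
lemma sum_stokesletDeriv₂ (ε : ℝ) (hε : 0 < ε) (h x w : Space) :
    ∑ i : Fin 3, inner ℝ (stokesletDeriv₂ ε h (EuclideanSpace.single i 1) x) w =
      ∑ i : Fin 3, stokesletPressureDeriv ε h (EuclideanSpace.single i 1) x * w i
        - 15 * ε ^ 4 * regInv ε x ^ 7 * inner ℝ h w := by
  have hs := regInv_sq_mul hε x
  have hn : ‖x‖ ^ 2 = x 0 ^ 2 + x 1 ^ 2 + x 2 ^ 2 := by
    rw [EuclideanSpace.norm_sq_eq, Fin.sum_univ_three]; simp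
  have hi : ∀ a b : Space, inner ℝ a b = b 0 * a 0 + b 1 * a 1 + b 2 * a 2 := fun a b => by
    simp [PiLp.inner_apply, Fin.sum_univ_three]
  rw [hn] at hs
  simp only [stokesletDeriv₂, stokesletPressureDeriv, hi, Fin.sum_univ_three]
  simp
  generalize regInv ε x = s at *
  linear_combination ((3 * s ^ 3 + 15 * ε ^ 2 * s ^ 5) * (w 0 * h 0 + w 1 * h 1 + w 2 * h 2)
    + 15 * s ^ 5 * (x 0 * h 0 + x 1 * h 1 + x 2 * h 2) * (w 0 * x 0 + w 1 * x 1 + w 2 * x 2)) * hs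

/-! ### Integration by parts against decaying functions -/

/-- `1 / (1 + |x|)`. -/
def decay (x : Space) : ℝ := (1 + ‖x‖)⁻¹

lemma decay_pos (x : Space) : 0 < decay x := by unfold decay; positivity

lemma continuous_decay : Continuous decay := by
  unfold decay
  exact (continuous_const.add continuous_norm).inv₀ fun x => (by positivity : 0 < 1 + ‖x‖).ne'

lemma integrable_decay_rpow {r : ℝ} (hr : 3 < r) : Integrable fun x => decay x ^ r := by
  have := integrable_one_add_norm (E := Space) (μ := volume) (r := r) (by simpa using hr)
  refine this.congr (ae_of_all _ fun x => ?_)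
  simp only [decay]
  rw [Real.inv_rpow (by positivity), Real.rpow_neg (by positivity)]

lemma memLp_of_norm_le_decay {F : Type*} [NormedAddCommGroup F] {f : Space → F}
    (hf : AEStronglyMeasurable f volume) {C : ℝ} {k : ℕ} (hC : ∀ x, ‖f x‖ ≤ C * decay x ^ k)
    {p : ℝ≥0∞} (hp : p ≠ ⊤) (hkp : 3 < k * p.toReal) : MemLp f p volume := by
  have hp0 : p ≠ 0 := by
    rintro rfl
    norm_num at hkp
  have h1 : MemLp (fun x => decay x ^ k) p volume := by
    have hm : AEStronglyMeasurable (fun x => decay x ^ k) volume :=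
      (continuous_decay.pow k).aestronglyMeasurable
    rw [← integrable_norm_rpow_iff hm hp0 hp]
    refine (integrable_decay_rpow hkp).congr (ae_of_all _ fun x => ?_)
    have := decay_pos x
    simp only
    rw [Real.norm_of_nonneg (by positivity), Real.rpow_natCast_mul this.le]
  exact (h1.const_mul C).mono hf (ae_of_all _ fun x => (hC x).trans (le_abs_self _))

/-- The cube of `decay` lies in `L^(6/5)`, the dual of `L⁶`, because `3 · 6/5 = 18/5 > 3`. -/
lemma integrable_decay_pow_three_mul {F : Type*} [NormedAddCommGroup F] {w : Space → F}
    (hw : MemLp w 6 volume) : Integrable fun x => decay x ^ 3 * ‖w x‖ := by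
  have h1 : Integrable fun x => decay x ^ (18 / 5 : ℝ) := integrable_decay_rpow (by norm_num)
  have h2 := hw.integrable_norm_rpow (by norm_num) (by norm_num)
  refine (h1.add h2).mono' ((continuous_decay.pow 3).aestronglyMeasurable.mul
    hw.aestronglyMeasurable.norm) (ae_of_all _ fun x => ?_)
  have hd := decay_pos x
  rw [Real.norm_of_nonneg (by positivity)]
  have hpq : (6 / 5 : ℝ).HolderConjugate 6 := by
    rw [Real.holderConjugate_iff]; norm_num
  have := Real.young_inequality_of_nonneg (pow_nonneg hd.le 3) (norm_nonneg (w x)) hpq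
  have h3 : (decay x ^ 3) ^ (6 / 5 : ℝ) = decay x ^ (18 / 5 : ℝ) := by
    rw [← Real.rpow_natCast_mul hd.le]; norm_num
  rw [h3] at this
  simp only [Pi.add_apply, ENNReal.toReal_ofNat]
  have h4 : 0 ≤ decay x ^ (18 / 5 : ℝ) := by positivity
  have h5 : 0 ≤ ‖w x‖ ^ (6 : ℝ) := by positivity
  linarith

lemma integrable_decay_sq_mul {F : Type*} [NormedAddCommGroup F] {G : Space → F}
    (hG : MemLp G 2 volume) : Integrable fun x => decay x ^ 2 * ‖G x‖ := by
  have h1 : Integrable fun x => decay x ^ (4 : ℝ) := integrable_decay_rpow (by norm_num)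
  have h2 := hG.integrable_norm_rpow (by norm_num) (by norm_num)
  refine (h1.add h2).mono' ((continuous_decay.pow 2).aestronglyMeasurable.mul
    hG.aestronglyMeasurable.norm) (ae_of_all _ fun x => ?_)
  have hd := decay_pos x
  rw [Real.norm_of_nonneg (by positivity)]
  simp only [Pi.add_apply, ENNReal.toReal_ofNat]
  have h3 : decay x ^ (4 : ℝ) = (decay x ^ 2) ^ 2 := by norm_cast; ring
  rw [h3, Real.rpow_two]
  nlinarith [sq_nonneg (decay x ^ 2 - ‖G x‖), sq_nonneg (decay x ^ 2), sq_nonneg ‖G x‖]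

/-- Test with `χ(x / (n + 1)) Φ` and let `n → ∞`. The decay of `Φ` and of its derivative matches `w
∈ L⁶`, `∇w ∈ L²` exactly enough for domination, including the term where the derivative falls on the
cutoff. -/
lemma HasWeakGradient.integral_fderiv_smul {w : Space → Space} {G : Space → Space →L[ℝ] Space}
    (h : HasWeakGradient w G) (hw : MemLp w 6 volume) (hG : MemLp G 2 volume) {Φ : Space → ℝ}
    (hΦ : ContDiff ℝ ∞ Φ) {e : Space} {C : ℝ} (h1 : ∀ x, |Φ x| ≤ C * decay x ^ 2)
    (h2 : ∀ x, |fderiv ℝ Φ x e| ≤ C * decay x ^ 3) :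
    ∫ x, fderiv ℝ Φ x e • w x = - ∫ x, Φ x • G x e := by
  let χ : ContDiffBump (0 : Space) := ⟨1, 2, one_pos, one_lt_two⟩
  have hC : 0 ≤ C := by
    have := (abs_nonneg _).trans (h1 0)
    have hd := decay_pos 0
    exact nonneg_of_mul_nonneg_left this (by positivity)
  set r : ℕ → ℝ := fun n => ((n : ℝ) + 1)⁻¹ with hr
  have hr0 : ∀ n, 0 < r n := fun n => by simp only [hr]; positivity
  have hr1 : ∀ n, r n ≤ 1 := fun n => inv_le_one_of_one_le₀ (by
    have : (0 : ℝ) ≤ n := n.cast_nonneg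
    linarith)
  have hrlim : Tendsto r atTop (𝓝 0) := by
    simpa [hr] using tendsto_one_div_add_atTop_nhds_zero_nat (𝕜 := ℝ)
  have hχs : ContDiff ℝ ∞ (χ : Space → ℝ) := χ.contDiff
  have hχ'c : Continuous fun x => fderiv ℝ χ x e :=
    (hχs.continuous_fderiv (by simp)).clm_apply continuous_const
  obtain ⟨C', hC'⟩ := hχ'c.bounded_above_of_compact_support
    ((χ.hasCompactSupport.fderiv ℝ).comp_left (g := fun L : Space →L[ℝ] ℝ => L e) (by simp))
  have hC'0 : 0 ≤ C' := (norm_nonneg _).trans (hC' 0)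
  have hχ'0 : ∀ x : Space, 2 < ‖x‖ → fderiv ℝ χ x = 0 := fun x hx => by
    refine fderiv_of_notMem_tsupport ℝ fun hmem => ?_
    rw [χ.tsupport_eq, mem_closedBall_zero_iff] at hmem
    exact absurd hx (not_lt.2 hmem)
  -- On the support of the rescaled cutoff gradient `r n * ‖x‖ ≤ 2`, hence `r n * (1 + ‖x‖) ≤ 3`:
  -- differentiating the cutoff gains one power of `decay`, uniformly in `n`.
  have hχ'd : ∀ n x, r n * |fderiv ℝ χ (r n • x) e| ≤ 3 * C' * decay x := by
    intro n x
    by_cases hx : 2 < ‖r n • x‖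
    · rw [hχ'0 _ hx]
      have := decay_pos x
      simp; positivity
    · rw [not_lt, norm_smul, Real.norm_of_nonneg (hr0 n).le] at hx
      have h3 : r n ≤ 3 * decay x := by
        rw [decay, ← div_eq_mul_inv, le_div_iff₀ (by positivity)]
        linarith [hr1 n]
      calc _ ≤ 3 * decay x * C' := mul_le_mul h3 (hC' _) (abs_nonneg _) (by
            have := decay_pos x; positivity)
        _ = _ := by ring
  set φ : ℕ → Space → ℝ := fun n x => χ (r n • x) * Φ x with hφ
  have hφs : ∀ n, ContDiff ℝ ∞ (φ n) := fun n =>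
    (hχs.comp (contDiff_const_smul (r n))).mul hΦ
  have hφc : ∀ n, HasCompactSupport (φ n) := fun n =>
    (χ.hasCompactSupport.comp_homeomorph (Homeomorph.smulOfNeZero (r n) (hr0 n).ne')).mul_right
  have hφd : ∀ n x, fderiv ℝ (φ n) x e =
      χ (r n • x) * fderiv ℝ Φ x e + (r n * fderiv ℝ χ (r n • x) e) * Φ x := by
    intro n x
    have e1 : HasFDerivAt (fun x : Space => r n • x) (r n • ContinuousLinearMap.id ℝ Space) x :=
      (hasFDerivAt_id x).const_smul (r n)
    have e2 := ((hχs.differentiable (by simp) (r n • x)).hasFDerivAt).comp x e1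
    have e3 := (e2.mul (hΦ.differentiable (by simp) x).hasFDerivAt).fderiv
    have e4 : fderiv ℝ (φ n) x = _ := e3
    rw [e4]
    simp
    ring
  have hχlim : ∀ x : Space, Tendsto (fun n => χ (r n • x)) atTop (𝓝 1) := by
    intro x
    have : Tendsto (fun n => χ (r n • x)) atTop (𝓝 (χ ((0 : ℝ) • x))) :=
      (χ.continuous.tendsto _).comp (hrlim.smul_const x)
    rwa [zero_smul, χ.one_of_mem_closedBall (by simp [χ])] at this
  have heq := fun n => h.integral_eq (φ n) (hφs n) (hφc n) e
  have hΦ'c : Continuous fun x => fderiv ℝ Φ x e :=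
    (hΦ.continuous_fderiv (by simp)).clm_apply continuous_const
  have hL : Tendsto (fun n => ∫ x, fderiv ℝ (φ n) x e • w x) atTop
      (𝓝 (∫ x, fderiv ℝ Φ x e • w x)) := by
    refine tendsto_integral_of_dominated_convergence
      (fun x => (C + 3 * C' * C) * (decay x ^ 3 * ‖w x‖)) (fun n => ?_)
      ((integrable_decay_pow_three_mul hw).const_mul _) (fun n => ae_of_all _ fun x => ?_)
      (ae_of_all _ fun x => ?_)
    · exact (((hφs n).continuous_fderiv (by simp)).clm_apply
        continuous_const).aestronglyMeasurable.smul hw.aestronglyMeasurable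
    · have hd := decay_pos x
      rw [norm_smul, hφd, ← mul_assoc]
      refine mul_le_mul_of_nonneg_right ?_ (norm_nonneg _)
      refine (norm_add_le _ _).trans ?_
      rw [add_mul, norm_mul, norm_mul, norm_mul, Real.norm_of_nonneg χ.nonneg,
        Real.norm_of_nonneg (hr0 n).le]
      simp only [Real.norm_eq_abs]
      refine add_le_add ?_ ?_
      · calc _ ≤ 1 * (C * decay x ^ 3) := mul_le_mul χ.le_one (h2 x) (abs_nonneg _) zero_le_one
          _ = _ := one_mul _
      · calc _ ≤ 3 * C' * decay x * (C * decay x ^ 2) :=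
              mul_le_mul (hχ'd n x) (h1 x) (abs_nonneg _) (by positivity)
          _ = _ := by ring
    · simp only [hφd]
      have l1 : Tendsto (fun n => r n * fderiv ℝ χ (r n • x) e) atTop (𝓝 0) := by
        have := hrlim.mul ((hχ'c.tendsto _).comp (hrlim.smul_const x))
        simpa using this
      have := (((hχlim x).mul_const (fderiv ℝ Φ x e)).add (l1.mul_const (Φ x))).smul_const (w x)
      simpa using this
  have hGe : AEStronglyMeasurable (fun x => G x e) volume :=
    (ContinuousLinearMap.apply ℝ Space e).continuous.comp_aestronglyMeasurable
      hG.aestronglyMeasurable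
  have hR : Tendsto (fun n => ∫ x, φ n x • G x e) atTop (𝓝 (∫ x, Φ x • G x e)) := by
    refine tendsto_integral_of_dominated_convergence
      (fun x => (C * ‖e‖) * (decay x ^ 2 * ‖G x‖)) (fun n => ?_)
      ((integrable_decay_sq_mul hG).const_mul _) (fun n => ae_of_all _ fun x => ?_)
      (ae_of_all _ fun x => ?_)
    · exact (hφs n).continuous.aestronglyMeasurable.smul hGe
    · have hd := decay_pos x
      rw [norm_smul, hφ, norm_mul, Real.norm_of_nonneg χ.nonneg, Real.norm_eq_abs]
      calc _ ≤ 1 * (C * decay x ^ 2) * (‖G x‖ * ‖e‖) := by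
            refine mul_le_mul (mul_le_mul χ.le_one (h1 x) (abs_nonneg _) zero_le_one)
              ((G x).le_opNorm e) (norm_nonneg _) (by positivity)
        _ = _ := by ring
    · have := ((hχlim x).mul_const (Φ x)).smul_const (G x e)
      simpa using this
  simp only [heq] at hL
  exact tendsto_nhds_unique hL hR.neg

lemma inner_eq_sum_apply (a b : Space) : inner ℝ a b = ∑ j : Fin 3, a j * b j := by
  simp [PiLp.inner_apply, mul_comm]

lemma integral_apply_coord {f : Space → Space} (hf : Integrable f) (j : Fin 3) :
    (∫ x, f x) j = ∫ x, f x j :=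
  ((EuclideanSpace.proj j : Space →L[ℝ] ℝ).integral_comp_comm hf).symm

/-- Integration by parts for vector fields with Stokeslet-like decay. -/
lemma HasWeakGradient.integral_inner_fderiv {w : Space → Space} {G : Space → Space →L[ℝ] Space}
    (h : HasWeakGradient w G) (hw : MemLp w 6 volume) (hG : MemLp G 2 volume) {Φ : Space → Space}
    (hΦ : ContDiff ℝ ∞ Φ) {e : Space} {C : ℝ} (h1 : ∀ x, ‖Φ x‖ ≤ C * decay x ^ 2)
    (h2 : ∀ x, ‖fderiv ℝ Φ x e‖ ≤ C * decay x ^ 3) :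
    Integrable (fun x => inner ℝ (fderiv ℝ Φ x e) (w x)) ∧
      Integrable (fun x => inner ℝ (Φ x) (G x e)) ∧
      ∫ x, inner ℝ (fderiv ℝ Φ x e) (w x) = - ∫ x, inner ℝ (Φ x) (G x e) := by
  have hGe : AEStronglyMeasurable (fun x => G x e) volume :=
    (ContinuousLinearMap.apply ℝ Space e).continuous.comp_aestronglyMeasurable
      hG.aestronglyMeasurable
  have hΦ'c : Continuous fun x => fderiv ℝ Φ x e :=
    (hΦ.continuous_fderiv (by simp)).clm_apply continuous_const
  have hcoord : ∀ j x, fderiv ℝ (fun x => Φ x j) x e = (fderiv ℝ Φ x e) j := by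
    intro j x
    have := ((EuclideanSpace.proj j : Space →L[ℝ] ℝ).hasFDerivAt.comp x
      (hΦ.differentiable (by simp) x).hasFDerivAt).fderiv
    have h3 : fderiv ℝ (fun x => Φ x j) x = _ := this
    rw [h3]; simp
  have hle : ∀ (v : Space) (j : Fin 3), |v j| ≤ ‖v‖ := fun v j => by
    simpa using PiLp.norm_apply_le v j
  have hΦj : ∀ j, ContDiff ℝ ∞ fun x => Φ x j := fun j =>
    (EuclideanSpace.proj j : Space →L[ℝ] ℝ).contDiff.comp hΦ
  have key : ∀ j, ∫ x, (fderiv ℝ Φ x e) j • w x = - ∫ x, Φ x j • G x e := fun j => by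
    have := h.integral_fderiv_smul hw hG (hΦj j) (e := e) (C := C)
      (fun x => (hle _ _).trans (h1 x)) (fun x => by rw [hcoord]; exact (hle _ _).trans (h2 x))
    simpa only [hcoord] using this
  have i1 : ∀ j, Integrable fun x => (fderiv ℝ Φ x e) j • w x := fun j =>
    ((integrable_decay_pow_three_mul hw).const_mul C).mono'
      (((EuclideanSpace.proj j : Space →L[ℝ] ℝ).continuous.comp
        hΦ'c).aestronglyMeasurable.smul hw.aestronglyMeasurable) (ae_of_all _ fun x => by
          rw [norm_smul, ← mul_assoc]
          exact mul_le_mul_of_nonneg_right ((hle _ _).trans (h2 x)) (norm_nonneg _))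
  have i2 : ∀ j, Integrable fun x => Φ x j • G x e := fun j =>
    ((integrable_decay_sq_mul hG).const_mul (C * ‖e‖)).mono'
      ((hΦj j).continuous.aestronglyMeasurable.smul hGe) (ae_of_all _ fun x => by
          rw [norm_smul]
          calc _ ≤ (C * decay x ^ 2) * (‖G x‖ * ‖e‖) :=
                mul_le_mul ((hle _ _).trans (h1 x)) ((G x).le_opNorm e) (norm_nonneg _)
                  ((norm_nonneg _).trans (h1 x))
            _ = _ := by ring)
  have j1 : ∀ j, Integrable fun x => (fderiv ℝ Φ x e) j * w x j := fun j =>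
    (EuclideanSpace.proj j : Space →L[ℝ] ℝ).integrable_comp (i1 j)
  have j2 : ∀ j, Integrable fun x => Φ x j * (G x e) j := fun j =>
    (EuclideanSpace.proj j : Space →L[ℝ] ℝ).integrable_comp (i2 j)
  simp only [inner_eq_sum_apply]
  refine ⟨integrable_finsetSum _ fun j _ => j1 j, integrable_finsetSum _ fun j _ => j2 j, ?_⟩
  rw [integral_finsetSum _ fun j _ => j1 j, integral_finsetSum _ fun j _ => j2 j,
    ← Finset.sum_neg_distrib]
  refine Finset.sum_congr rfl fun j _ => ?_
  have := congrArg (fun v : Space => v j) (key j)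
  simp only [PiLp.neg_apply] at this
  rw [integral_apply_coord (i1 j), integral_apply_coord (i2 j)] at this
  simpa using this

/-! ### The Stokeslet as test function -/

lemma decay_sub_le (a x : Space) : decay (x - a) ≤ (1 + ‖a‖) * decay x := by
  rw [decay, decay, ← div_eq_mul_inv, inv_eq_one_div, div_le_div_iff₀ (by positivity) (by positivity)]
  have : ‖x‖ ≤ ‖x - a‖ + ‖a‖ := by simpa using norm_add_le (x - a) a
  nlinarith [norm_nonneg a, norm_nonneg (x - a)]

lemma regInv_sub_le {ε : ℝ} (hε : 0 < ε) (a x : Space) :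
    regInv ε (x - a) ≤ (1 + 1 / ε) * (1 + ‖a‖) * decay x := by
  refine (regInv_le hε _).trans ?_
  rw [mul_assoc]
  exact mul_le_mul_of_nonneg_left (decay_sub_le a x) (by positivity)

lemma regInv_sub_pow_le {ε : ℝ} (hε : 0 < ε) (a x : Space) (k : ℕ) :
    regInv ε (x - a) ^ k ≤ ((1 + 1 / ε) * (1 + ‖a‖)) ^ k * decay x ^ k := by
  rw [← mul_pow]
  exact pow_le_pow_left₀ (regInv_nonneg _ _) (regInv_sub_le hε a x) k

lemma fderiv_comp_sub_const {F : Type*} [NormedAddCommGroup F] [NormedSpace ℝ F] {f : Space → F}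
    (hf : Differentiable ℝ f) (a x : Space) :
    fderiv ℝ (fun x => f (x - a)) x = fderiv ℝ f (x - a) := by
  have := ((hf (x - a)).hasFDerivAt.comp x ((hasFDerivAt_id x).sub_const a)).fderiv
  simpa [Function.comp_def] using this

section Test

variable {ε : ℝ} (hε : 0 < ε) (a h : Space)
include hε

lemma contDiff_stokeslet_sub : ContDiff ℝ ∞ fun x => stokeslet ε (x - a) h :=
  (contDiff_stokeslet hε h).comp (contDiff_id.sub contDiff_const)

lemma fderiv_stokeslet_sub (e x : Space) : fderiv ℝ (fun x => stokeslet ε (x - a) h) x e =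
    stokesletDeriv ε h e (x - a) := by
  rw [fderiv_comp_sub_const ((contDiff_stokeslet hε h).differentiable (by simp)) a x,
    fderiv_stokeslet hε]

lemma norm_fderiv_stokeslet_sub_le (x : Space) :
    ‖fderiv ℝ (fun x => stokeslet ε (x - a) h) x‖ ≤ 9 * ‖h‖ * regInv ε (x - a) ^ 2 := by
  refine ContinuousLinearMap.opNorm_le_bound _ (by positivity) fun e => ?_
  rw [fderiv_stokeslet_sub hε]
  refine (norm_stokesletDeriv_le hε.le h e _).trans_eq ?_
  ring

/-- Makes the regularized Stokeslet an admissible test function in the weak Stokes equation. It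
decays like `|x|⁻¹`, which is in `L⁶` at infinity as `6 > 3`, and its gradient like `|x|⁻²`, which
is in `L²` as `4 > 3`. -/
lemma isDivFreeDotH1_stokeslet : IsDivFreeDotH1 (fun x => stokeslet ε (x - a) h)
    (fderiv ℝ fun x => stokeslet ε (x - a) h) := by
  have hc := contDiff_stokeslet_sub hε a h
  have hc' := hc.continuous_fderiv (by simp)
  set A := (1 + 1 / ε) * (1 + ‖a‖) with hA
  refine ⟨⟨hc.continuous.locallyIntegrable, hc'.locallyIntegrable, fun φ hφ hφc e => ?_⟩, ?_, ?_, ?_⟩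
  · have hφ'c := (hφ.continuous_fderiv (by simp)).clm_apply (continuous_const (y := e))
    have hφ's : HasCompactSupport fun x => fderiv ℝ φ x e :=
      (hφc.fderiv ℝ).comp_left (g := fun L : Space →L[ℝ] ℝ => L e) (by simp)
    have := integral_smul_fderiv_eq_neg_fderiv_smul_of_integrable (μ := volume) (v := e) (f := φ)
      (g := fun x => stokeslet ε (x - a) h)
      ((hφ'c.smul hc.continuous).integrable_of_hasCompactSupport hφ's.smul_right)
      ((hφ.continuous.smul (hc'.clm_apply continuous_const)).integrable_of_hasCompactSupport
        hφc.smul_right)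
      ((hφ.continuous.smul hc.continuous).integrable_of_hasCompactSupport hφc.smul_right)
      (fun x _ => hφ.differentiable (by simp) x) (fun x _ => hc.differentiable (by simp) x)
    rw [this, neg_neg]
  · refine memLp_of_norm_le_decay hc.continuous.aestronglyMeasurable (C := 3 * ‖h‖ * A) (k := 1)
      (fun x => ?_) (by simp) (by norm_num)
    refine (norm_stokeslet_le hε.le _ _).trans ?_
    have := mul_le_mul_of_nonneg_left (regInv_sub_le hε a x) (by positivity : 0 ≤ 3 * ‖h‖)
    rw [pow_one]; linarith
  · refine memLp_of_norm_le_decay hc'.aestronglyMeasurable (C := 9 * ‖h‖ * A ^ 2) (k := 2)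
      (fun x => ?_) (by simp) (by norm_num)
    refine (norm_fderiv_stokeslet_sub_le hε a h x).trans ?_
    have := mul_le_mul_of_nonneg_left (regInv_sub_pow_le hε a x 2) (by positivity : 0 ≤ 9 * ‖h‖)
    linarith
  · refine ae_of_all _ fun x => ?_
    simp only [fderiv_stokeslet_sub hε]
    exact sum_stokesletDeriv_apply ε hε h (x - a)

/-- Testing a divergence free field with the Stokeslet gives its mollification. -/
lemma IsDivFreeDotH1.integral_frobenius_stokeslet {w : Space → Space}
    {G : Space → Space →L[ℝ] Space} (hw : IsDivFreeDotH1 w G) :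
    ∫ x, frobenius (G x) (fderiv ℝ (fun x => stokeslet ε (x - a) h) x) =
      ∫ x, 15 * ε ^ 4 * regInv ε (x - a) ^ 7 * inner ℝ h (w x) := by
  set A := (1 + 1 / ε) * (1 + ‖a‖) with hA
  have hA0 : 0 ≤ A := by positivity
  let b : Fin 3 → Space := fun i => EuclideanSpace.single i 1
  have hb : ∀ i, ‖b i‖ = 1 := fun i => by simp [b]
  have hD1s : ∀ i, ContDiff ℝ ∞ fun x => stokesletDeriv ε h (b i) (x - a) := fun i =>
    (contDiff_stokesletDeriv hε h (b i)).comp (contDiff_id.sub contDiff_const)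
  have hD1d : ∀ i x, fderiv ℝ (fun x => stokesletDeriv ε h (b i) (x - a)) x (b i) =
      stokesletDeriv₂ ε h (b i) (x - a) := fun i x => by
    rw [fderiv_comp_sub_const ((contDiff_stokesletDeriv hε h (b i)).differentiable (by simp)) a x,
      fderiv_stokesletDeriv hε]
  have hC1 : ∀ k : ℕ, ∀ c ≤ 54 * ‖h‖, 0 ≤ c → ∀ x, k ≤ 3 → c * regInv ε (x - a) ^ k ≤
      54 * ‖h‖ * (1 + A) ^ 3 * decay x ^ k := by
    intro k c hc hc0 x hk
    have h1 := regInv_sub_pow_le hε a x k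
    have hd := decay_pos x
    calc c * regInv ε (x - a) ^ k ≤ 54 * ‖h‖ * (A ^ k * decay x ^ k) :=
          mul_le_mul hc h1 (pow_nonneg (regInv_nonneg _ _) _) (by positivity)
      _ ≤ 54 * ‖h‖ * ((1 + A) ^ 3 * decay x ^ k) := by
          have : A ^ k ≤ (1 + A) ^ 3 := (pow_le_pow_left₀ hA0 (by linarith) k).trans
            (pow_le_pow_right₀ (by linarith) hk)
          gcongr
      _ = _ := by ring
  have ibp := fun i => hw.hasWeakGradient.integral_inner_fderiv hw.memLp hw.memLp_grad (hD1s i)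
    (e := b i) (C := 54 * ‖h‖ * (1 + A) ^ 3)
    (fun x => (norm_stokesletDeriv_le hε.le h (b i) _).trans (by
      rw [hb, mul_one]
      exact hC1 2 _ (by linarith [norm_nonneg h]) (by positivity) x (by norm_num)))
    (fun x => by
      rw [hD1d]
      refine (norm_stokesletDeriv₂_le hε.le h (b i) _).trans ?_
      rw [hb, one_pow, mul_one]
      exact hC1 3 _ le_rfl (by positivity) x le_rfl)
  simp only [hD1d] at ibp
  have hPs : ContDiff ℝ ∞ fun x => stokesletPressure ε h (x - a) :=
    (contDiff_stokesletPressure hε h).comp (contDiff_id.sub contDiff_const)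
  have hPd : ∀ i x, fderiv ℝ (fun x => stokesletPressure ε h (x - a)) x (b i) =
      stokesletPressureDeriv ε h (b i) (x - a) := fun i x => by
    rw [fderiv_comp_sub_const ((contDiff_stokesletPressure hε h).differentiable (by simp)) a x,
      fderiv_stokesletPressure hε]
  have hPb : ∀ x, |stokesletPressure ε h (x - a)| ≤ 54 * ‖h‖ * (1 + A) ^ 3 * decay x ^ 2 :=
    fun x => (abs_stokesletPressure_le hε.le h _).trans
      (hC1 2 _ (by linarith [norm_nonneg h]) (by positivity) x (by norm_num))
  have hPdb : ∀ i x, |stokesletPressureDeriv ε h (b i) (x - a)| ≤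
      54 * ‖h‖ * (1 + A) ^ 3 * decay x ^ 3 := fun i x =>
    (abs_stokesletPressureDeriv_le hε.le h (b i) _).trans (by
      rw [hb, mul_one]
      exact hC1 3 _ (by linarith [norm_nonneg h]) (by positivity) x le_rfl)
  have ibpP := fun i => hw.hasWeakGradient.integral_fderiv_smul hw.memLp hw.memLp_grad hPs
    (e := b i) (C := 54 * ‖h‖ * (1 + A) ^ 3) hPb (fun x => by rw [hPd]; exact hPdb i x)
  simp only [hPd] at ibpP
  have hGe : ∀ i, AEStronglyMeasurable (fun x => G x (b i)) volume := fun i =>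
    (ContinuousLinearMap.apply ℝ Space (b i)).continuous.comp_aestronglyMeasurable
      hw.memLp_grad.aestronglyMeasurable
  have i1 : ∀ i, Integrable fun x => stokesletPressureDeriv ε h (b i) (x - a) • w x := fun i =>
    ((integrable_decay_pow_three_mul hw.memLp).const_mul (54 * ‖h‖ * (1 + A) ^ 3)).mono'
      ((by
        have := (hPs.continuous_fderiv (by simp)).clm_apply (continuous_const (y := b i))
        simpa only [hPd] using this.aestronglyMeasurable :
          AEStronglyMeasurable (fun x => stokesletPressureDeriv ε h (b i) (x - a)) volume).smul
        hw.memLp.aestronglyMeasurable) (ae_of_all _ fun x => by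
          rw [norm_smul, ← mul_assoc]
          exact mul_le_mul_of_nonneg_right (hPdb i x) (norm_nonneg _))
  have i2 : ∀ i, Integrable fun x => stokesletPressure ε h (x - a) • G x (b i) := fun i =>
    ((integrable_decay_sq_mul hw.memLp_grad).const_mul (54 * ‖h‖ * (1 + A) ^ 3)).mono'
      (hPs.continuous.aestronglyMeasurable.smul (hGe i)) (ae_of_all _ fun x => by
          rw [norm_smul, ← mul_assoc]
          refine mul_le_mul (hPb x) ?_ (norm_nonneg _) ((abs_nonneg _).trans (hPb x))
          simpa [hb] using (G x).le_opNorm (b i))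
  have j1 : ∀ i, Integrable fun x => stokesletPressureDeriv ε h (b i) (x - a) * w x i := fun i =>
    (EuclideanSpace.proj i : Space →L[ℝ] ℝ).integrable_comp (i1 i)
  have j2 : ∀ i, Integrable fun x => stokesletPressure ε h (x - a) * (G x (b i)) i := fun i =>
    (EuclideanSpace.proj i : Space →L[ℝ] ℝ).integrable_comp (i2 i)
  -- The pressure drops out: after integration by parts it multiplies the divergence of `w`.
  have hpress : ∫ x, ∑ i, stokesletPressureDeriv ε h (b i) (x - a) * w x i = 0 := by
    have e1 : ∀ i, ∫ x, stokesletPressureDeriv ε h (b i) (x - a) * w x i =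
        - ∫ x, stokesletPressure ε h (x - a) * (G x (b i)) i := fun i => by
      have := congrArg (fun v : Space => v i) (ibpP i)
      simp only [PiLp.neg_apply] at this
      rw [integral_apply_coord (i1 i), integral_apply_coord (i2 i)] at this
      simpa using this
    rw [integral_finsetSum _ fun i _ => j1 i]
    simp only [e1]
    rw [Finset.sum_neg_distrib, ← integral_finsetSum _ fun i _ => j2 i, neg_eq_zero]
    refine integral_eq_zero_of_ae ?_
    filter_upwards [hw.div_eq_zero] with x hx
    rw [← Finset.mul_sum, Pi.zero_apply]
    simp only [b] at hx ⊢
    rw [hx, mul_zero]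
  -- The derivative is moved from `w` onto the Stokeslet, whose Laplacian is the pressure gradient
  -- minus the mollifier.
  have hstep : ∫ x, frobenius (G x) (fderiv ℝ (fun x => stokeslet ε (x - a) h) x) =
      - ∫ x, ∑ i, inner ℝ (stokesletDeriv₂ ε h (b i) (x - a)) (w x) := by
    simp only [frobenius, fderiv_stokeslet_sub hε]
    rw [integral_finsetSum _ fun i _ => (ibp i).1, integral_finsetSum, ← Finset.sum_neg_distrib]
    · refine Finset.sum_congr rfl fun i _ => ?_
      rw [(ibp i).2.2, neg_neg]
      refine integral_congr_ae (ae_of_all _ fun x => ?_)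
      exact real_inner_comm _ _
    · intro i _
      refine (ibp i).2.1.congr (ae_of_all _ fun x => ?_)
      exact real_inner_comm _ _
  rw [hstep]
  have hpt : ∀ x, ∑ i, inner ℝ (stokesletDeriv₂ ε h (b i) (x - a)) (w x) =
      ∑ i, stokesletPressureDeriv ε h (b i) (x - a) * w x i -
        15 * ε ^ 4 * regInv ε (x - a) ^ 7 * inner ℝ h (w x) := fun x =>
    sum_stokesletDeriv₂ ε hε h (x - a) (w x)
  have hpt' : ∀ x, 15 * ε ^ 4 * regInv ε (x - a) ^ 7 * inner ℝ h (w x) =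
      ∑ i, stokesletPressureDeriv ε h (b i) (x - a) * w x i -
        ∑ i, inner ℝ (stokesletDeriv₂ ε h (b i) (x - a)) (w x) := fun x => by
    rw [hpt]; ring
  simp only [hpt']
  rw [integral_sub (integrable_finsetSum _ fun i _ => j1 i)
    (integrable_finsetSum _ fun i _ => (ibp i).1), hpress, zero_sub]

end Test

/-! ### The representation formula for the fluid velocity -/

/-- The mollifier `15 (1 + |y|²)^{-7/2}` associated with the regularized Stokeslet. -/
def blob (y : Space) : ℝ := 15 * regInv 1 y ^ 7

/-- The mass of `blob`. -/
def blobMass : ℝ := ∫ y, blob y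

lemma blob_pos (y : Space) : 0 < blob y := by
  have := regInv_pos one_pos y
  unfold blob; positivity

lemma continuous_blob : Continuous blob :=
  continuous_const.mul ((contDiff_regInv one_pos).continuous.pow 7)

/-- The extra factor `1 + ‖y‖` is the cost of comparing the kernel at `x + ε • y` with `‖x‖⁻¹`
uniformly in `ε`; see `regInv_add_smul_le`. -/
lemma blob_mul_le (y : Space) : blob y * (1 + ‖y‖) ≤ 15 * 2 ^ 7 * decay y ^ 6 := by
  have h1 := regInv_le one_pos y
  have h2 : regInv 1 y ≤ 2 * decay y := h1.trans_eq (by rw [decay]; norm_num)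
  have h3 := pow_le_pow_left₀ (regInv_nonneg 1 y) h2 7
  have h4 : decay y * (1 + ‖y‖) = 1 := inv_mul_cancel₀ (by positivity : 0 < 1 + ‖y‖).ne'
  calc blob y * (1 + ‖y‖) ≤ 15 * (2 * decay y) ^ 7 * (1 + ‖y‖) := by
        unfold blob; gcongr
    _ = 15 * 2 ^ 7 * decay y ^ 6 * (decay y * (1 + ‖y‖)) := by ring
    _ = _ := by rw [h4, mul_one]

lemma integrable_blob_mul : Integrable fun y => blob y * (1 + ‖y‖) := by
  have h1 : Integrable fun y => decay y ^ (6 : ℝ) := integrable_decay_rpow (by norm_num)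
  refine (h1.const_mul (15 * 2 ^ 7)).mono' (continuous_blob.mul
    (continuous_const.add continuous_norm)).aestronglyMeasurable (ae_of_all _ fun y => ?_)
  have := blob_pos y
  rw [Real.norm_of_nonneg (by positivity)]
  exact_mod_cast blob_mul_le y

lemma integrable_blob : Integrable blob := by
  refine integrable_blob_mul.mono' continuous_blob.aestronglyMeasurable (ae_of_all _ fun y => ?_)
  have := blob_pos y
  rw [Real.norm_of_nonneg this.le]
  nlinarith [norm_nonneg y]

/-- The mass is the normalizing constant of the Stokeslet. Its value (`8π`) plays no role; only its
positivity does. -/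
lemma blobMass_pos : 0 < blobMass := by
  rw [blobMass, integral_pos_iff_support_of_nonneg (fun y => (blob_pos y).le) integrable_blob]
  have : Function.support blob = univ := by
    ext y; simp [(blob_pos y).ne']
  rw [this]
  exact Measure.measure_univ_pos.2 (NeZero.ne _)

lemma regInv_smul {ε : ℝ} (hε : 0 < ε) (y : Space) : regInv ε (ε • y) = ε⁻¹ * regInv 1 y := by
  have : ‖ε • y‖ ^ 2 + ε ^ 2 = ε ^ 2 * (‖y‖ ^ 2 + 1 ^ 2) := by
    rw [norm_smul, Real.norm_of_nonneg hε.le]; ring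
  rw [regInv, this, Real.sqrt_mul (by positivity), Real.sqrt_sq hε.le, mul_inv, regInv]

/-- Substitute `x = a + ε • y`; the powers `ε⁴ · ε⁻⁷ · ε³` cancel, so the right-hand side of the
regularized equation is an average of `F` at scale `ε` around `a`. -/
lemma integral_regInv_pow_mul {ε : ℝ} (hε : 0 < ε) (a : Space) (F : Space → ℝ) :
    ∫ x, 15 * ε ^ 4 * regInv ε (x - a) ^ 7 * F x = ∫ y, blob y * F (a + ε • y) := by
  have h1 := integral_add_right_eq_self (μ := (volume : Measure Space))
    (fun x => 15 * ε ^ 4 * regInv ε (x - a) ^ 7 * F x) a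
  rw [← h1]
  have h2 := Measure.integral_comp_smul (volume : Measure Space)
    (fun x => 15 * ε ^ 4 * regInv ε (x + a - a) ^ 7 * F (x + a)) ε
  have h3 : ∀ y, 15 * ε ^ 4 * regInv ε (ε • y + a - a) ^ 7 * F (ε • y + a) =
      ε⁻¹ ^ 3 * (blob y * F (a + ε • y)) := fun y => by
    rw [add_sub_cancel_right, regInv_smul hε, blob, add_comm a]
    field_simp
  simp only [h3] at h2
  rw [integral_const_mul] at h2
  have h4 : |((ε ^ Module.finrank ℝ Space)⁻¹ : ℝ)| = ε⁻¹ ^ 3 := by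
    rw [finrank_euclideanSpace, Fintype.card_fin, abs_of_pos (by positivity), inv_pow]
  rw [h4, smul_eq_mul] at h2
  exact (mul_left_cancel₀ (by positivity) h2).symm

lemma inner_stokeslet_comm (ε : ℝ) (x h k : Space) :
    inner ℝ (stokeslet ε x h) k = inner ℝ h (stokeslet ε x k) := by
  simp only [stokeslet, inner_add_left, inner_add_right, real_inner_smul_left,
    real_inner_smul_right, real_inner_comm x]
  ring

lemma measurable_stokeslet (ε : ℝ) : Measurable fun p : Space × Space => stokeslet ε p.1 p.2 := by
  have := measurable_regInv ε
  unfold stokeslet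
  fun_prop

/-- The shift `ε • y` is present because the positivity argument evaluates the kernel at mollified
arguments; `y = 0` is the case used in the representation formula. -/
lemma tendsto_stokeslet_add {x : Space} (hx : x ≠ 0) (y h : Space) :
    Tendsto (fun ε : ℝ => stokeslet ε (x + ε • y) h) (𝓝[>] 0) (𝓝 (stokeslet 0 x h)) := by
  have h0 : Continuous fun ε : ℝ => x + ε • y := by fun_prop
  have hl : Tendsto (fun ε : ℝ => x + ε • y) (𝓝[>] 0) (𝓝 x) := by
    simpa using (h0.tendsto 0).mono_left nhdsWithin_le_nhds
  have h1 : Tendsto (fun ε : ℝ => regInv ε (x + ε • y)) (𝓝[>] 0) (𝓝 (regInv 0 x)) := by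
    have hc : ContinuousAt (fun ε : ℝ => regInv ε (x + ε • y)) 0 := by
      unfold regInv
      refine ContinuousAt.inv₀ (by fun_prop) ?_
      simpa using hx
    simpa using hc.tendsto.mono_left nhdsWithin_le_nhds
  have h2 : Tendsto (fun ε : ℝ => ε) (𝓝[>] 0) (𝓝 0) := tendsto_id.mono_left nhdsWithin_le_nhds
  have h3 : Tendsto (fun ε : ℝ => regInv ε (x + ε • y) + ε ^ 2 * regInv ε (x + ε • y) ^ 3) (𝓝[>] 0)
      (𝓝 (regInv 0 x + 0 ^ 2 * regInv 0 x ^ 3)) := h1.add ((h2.pow 2).mul (h1.pow 3))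
  have h4 : Tendsto (fun ε : ℝ => regInv ε (x + ε • y) ^ 3 * inner ℝ h (x + ε • y)) (𝓝[>] 0)
      (𝓝 (regInv 0 x ^ 3 * inner ℝ h x)) := (h1.pow 3).mul (tendsto_const_nhds.inner hl)
  exact (h3.smul_const h).add (h4.smul hl)

lemma tendsto_stokeslet {x : Space} (hx : x ≠ 0) (h : Space) :
    Tendsto (fun ε => stokeslet ε x h) (𝓝[>] 0) (𝓝 (stokeslet 0 x h)) := by
  simpa using tendsto_stokeslet_add hx 0 h

/-- The measure `μ` integrates the singularities `|x - a|^{-9/4}` uniformly in `a`, along `X`. -/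
def SingularBound {Ω : Type*} [MeasurableSpace Ω] (μ : Measure Ω) (X : Ω → Space) (S : ℝ≥0) :
    Prop := ∀ a, ∫⁻ z, ‖X z - a‖ₑ ^ (-(9 / 4) : ℝ) ∂μ ≤ S

/-! ### Consequences of the singular bound -/

namespace SingularBound

variable {Ω : Type*} [MeasurableSpace Ω] {μ : Measure Ω} {X : Ω → Space} {S : ℝ≥0}

/-- A negative power of `0` is `∞` in `ℝ≥0∞`, so finiteness of the integral excludes mass at `a`.
The arbitrary value of the kernel at the origin therefore never matters. -/
lemma ae_ne (h : SingularBound μ X S) (hX : Measurable X) (a : Space) : ∀ᵐ z ∂μ, X z ≠ a := by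
  have := ae_lt_top (by fun_prop) ((h a).trans_lt ENNReal.coe_lt_top).ne
  filter_upwards [this] with z hz heq
  rw [heq, sub_self, enorm_zero, ENNReal.zero_rpow_of_neg (by norm_num)] at hz
  exact lt_irrefl _ hz

lemma rpow_le (h : SingularBound μ X S) [IsProbabilityMeasure μ] {r : ℝ}
    (hr : 0 < r) (hr' : r ≤ 9 / 4) (a : Space) :
    ∫⁻ z, ‖X z - a‖ₑ ^ (-r) ∂μ ≤ (1 + S : ℝ≥0) := by
  have hpt : ∀ y : ℝ≥0∞, y ^ (-r) ≤ 1 + y ^ (-(9 / 4) : ℝ) := by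
    intro y
    rcases le_total y 1 with hy | hy
    · exact (ENNReal.rpow_le_rpow_of_exponent_ge hy (by linarith)).trans le_add_self
    · exact (ENNReal.rpow_le_one_of_one_le_of_neg hy (by linarith)).trans le_self_add
  calc _ ≤ ∫⁻ z, (1 + ‖X z - a‖ₑ ^ (-(9 / 4) : ℝ)) ∂μ := lintegral_mono fun z => hpt _
    _ ≤ _ := by
      rw [lintegral_add_left measurable_const, lintegral_one, measure_univ, ENNReal.coe_add,
        ENNReal.coe_one]
      gcongr
      exact h a

/-- Square integrability of the `|x|⁻¹` singularity, from `2 ≤ 9/4`. Paired with forces in `L²`, it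
makes the Stokeslet potential an absolutely convergent integral at every point. -/
lemma memLp_inv_norm (h : SingularBound μ X S) [IsProbabilityMeasure μ] (hX : Measurable X)
    (a : Space) : MemLp (fun z => ‖X z - a‖⁻¹) 2 μ := by
  refine ⟨(by fun_prop : Measurable fun z => ‖X z - a‖⁻¹).aestronglyMeasurable, ?_⟩
  rw [eLpNorm_lt_top_iff_lintegral_rpow_enorm_lt_top (by norm_num) (by norm_num)]
  refine lt_of_le_of_lt ?_ (ENNReal.coe_lt_top (r := 1 + S))
  refine le_trans (lintegral_mono_ae ?_) (h.rpow_le (r := 2) (by norm_num) (by norm_num) a)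
  filter_upwards [h.ae_ne hX a] with z hz
  rw [enorm_inv (norm_ne_zero_iff.2 (sub_ne_zero.2 hz)), enorm_norm, ENNReal.toReal_ofNat,
    ENNReal.inv_rpow, ENNReal.rpow_neg]

end SingularBound

lemma norm_stokeslet_zero_le (x h : Space) : ‖stokeslet 0 x h‖ ≤ 3 * ‖x‖⁻¹ * ‖h‖ := by
  have := norm_stokeslet_le le_rfl x h
  rwa [regInv_zero] at this

lemma tendsto_integral_blob {u : Space → Space} (hu : Continuous u) {M : ℝ}
    (hM : ∀ x, ‖u x‖ ≤ M) (a h : Space) :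
    Tendsto (fun ε : ℝ => ∫ y, blob y * inner ℝ h (u (a + ε • y))) (𝓝[>] 0)
      (𝓝 (blobMass * inner ℝ h (u a))) := by
  rw [blobMass, ← integral_mul_const]
  refine tendsto_integral_filter_of_dominated_convergence (fun y => blob y * (‖h‖ * M))
    (Eventually.of_forall fun ε => ?_) (Eventually.of_forall fun ε => ae_of_all _ fun y => ?_)
    (integrable_blob.mul_const _) (ae_of_all _ fun y => ?_)
  · exact (continuous_blob.mul (continuous_const.inner (hu.comp (by fun_prop)))).aestronglyMeasurable
  · rw [norm_mul, Real.norm_of_nonneg (blob_pos y).le]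
    refine mul_le_mul_of_nonneg_left ((norm_inner_le_norm _ _).trans ?_) (blob_pos y).le
    exact mul_le_mul_of_nonneg_left (hM _) (norm_nonneg _)
  · have : Continuous fun ε : ℝ => blob y * inner ℝ h (u (a + ε • y)) :=
      continuous_const.mul (continuous_const.inner (hu.comp (by fun_prop)))
    simpa using (this.tendsto 0).mono_left nhdsWithin_le_nhds

/-- Passing to the limit in the regularized representation formula. -/
lemma blobMass_smul_eq_integral {μ : Measure Phase} [IsProbabilityMeasure μ] {u : Space → Space}
    (hu : Continuous u) {M : ℝ} (hM : ∀ x, ‖u x‖ ≤ M) (hv : MemLp (fun z : Phase => z.2) 2 μ)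
    {S : ℝ≥0} (hS : SingularBound μ Prod.fst S)
    (hrep : ∀ ε > 0, ∀ a h : Space, ∫ y, blob y * inner ℝ h (u (a + ε • y)) =
      ∫ z, inner ℝ (z.2 - u z.1) (stokeslet ε (z.1 - a) h) ∂μ) (a : Space) :
    Integrable (fun z => stokeslet 0 (z.1 - a) (z.2 - u z.1)) μ ∧
      blobMass • u a = ∫ z, stokeslet 0 (z.1 - a) (z.2 - u z.1) ∂μ := by
  have hum : Measurable u := hu.measurable
  have hdom : Integrable (fun z : Phase => (‖z.2‖ + M) * (3 * ‖z.1 - a‖⁻¹)) μ := by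
    have h1 : MemLp (fun z : Phase => ‖z.2‖ + M) 2 μ := hv.norm.add (memLp_const M)
    have h2 := (hS.memLp_inv_norm measurable_fst a).const_mul 3
    exact h1.integrable_mul h2
  have hvu : ∀ z : Phase, ‖z.2 - u z.1‖ ≤ ‖z.2‖ + M := fun z =>
    (norm_sub_le _ _).trans (by gcongr; exact hM _)
  have hint : Integrable (fun z => stokeslet 0 (z.1 - a) (z.2 - u z.1)) μ := by
    refine hdom.mono' ?_ (ae_of_all _ fun z => ?_)
    · exact ((measurable_stokeslet 0).comp (g := fun p : Space × Space => stokeslet 0 p.1 p.2)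
        (f := fun z : Phase => (z.1 - a, z.2 - u z.1)) (by fun_prop)).aestronglyMeasurable
    · refine (norm_stokeslet_zero_le _ _).trans ?_
      rw [mul_comm]
      gcongr
      exact hvu z
  refine ⟨hint, ?_⟩
  refine ext_inner_left ℝ fun h => ?_
  rw [← integral_inner hint, real_inner_smul_right]
  have hl := tendsto_integral_blob hu hM a h
  have hr : Tendsto (fun ε : ℝ => ∫ z, inner ℝ (z.2 - u z.1) (stokeslet ε (z.1 - a) h) ∂μ) (𝓝[>] 0)
      (𝓝 (∫ z, inner ℝ h (stokeslet 0 (z.1 - a) (z.2 - u z.1)) ∂μ)) := by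
    refine tendsto_integral_filter_of_dominated_convergence
      (fun z => (‖z.2‖ + M) * (3 * ‖z.1 - a‖⁻¹) * ‖h‖)
      (Eventually.of_forall fun ε => ?_) ?_
      (hdom.mul_const _) ?_
    · have : Measurable fun z : Phase => stokeslet ε (z.1 - a) h :=
        (measurable_stokeslet ε).comp (g := fun p : Space × Space => stokeslet ε p.1 p.2)
          (f := fun z : Phase => (z.1 - a, h)) (by fun_prop)
      exact (Measurable.inner (by fun_prop) this).aestronglyMeasurable
    · filter_upwards [self_mem_nhdsWithin] with ε hε
      filter_upwards [hS.ae_ne measurable_fst a] with z hz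
      refine (norm_inner_le_norm _ _).trans ?_
      rw [mul_assoc]
      refine mul_le_mul (hvu z) ((norm_stokeslet_le (le_of_lt hε) _ _).trans ?_) (norm_nonneg _)
        ((norm_nonneg _).trans (hvu z))
      gcongr
      exact regInv_le_inv_norm ε (sub_ne_zero.2 hz)
    · filter_upwards [hS.ae_ne measurable_fst a] with z hz
      rw [← inner_stokeslet_comm, real_inner_comm]
      exact ((continuous_const.inner continuous_id).tendsto _).comp
        (tendsto_stokeslet (sub_ne_zero.2 hz) h)
  refine tendsto_nhds_unique_of_eventuallyEq hl hr ?_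
  filter_upwards [self_mem_nhdsWithin] with ε hε
  exact hrep ε hε a h

/-! ### The potential formula at every time -/

section Solution

variable {K lam T : ℝ} {g : Space} {f₀ : Measure Phase} {f : ℝ → Measure Phase}
  {u : ℝ → Space → Space}

lemma memLp_snd_of_moment {μ : Measure Phase} [IsFiniteMeasure μ] {k : ℝ} (hk : 0 < k)
    (h : moment k μ < ⊤) {p : ℝ≥0∞} (hp : p ≤ ENNReal.ofReal k) :
    MemLp (fun z : Phase => z.2) p μ := by
  have : MemLp (fun z : Phase => z.2) (ENNReal.ofReal k) μ := by
    refine ⟨measurable_snd.aestronglyMeasurable, ?_⟩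
    rw [eLpNorm_lt_top_iff_lintegral_rpow_enorm_lt_top (by simpa using hk) ENNReal.ofReal_ne_top,
      ENNReal.toReal_ofReal hk.le]
    exact h
  exact this.mono_exponent hp

lemma IsCharacteristics.norm_velocity_le {X V : ℝ → ℝ → Space → Space → Space}
    (hXV : IsCharacteristics lam T g u X V) (hlam : 0 < lam) (hg : ‖g‖ = 1) {M : ℝ≥0}
    (hM : ∀ t ∈ Icc 0 T, ∀ x, ‖u t x‖ ≤ M) {t : ℝ} (ht : t ∈ Icc 0 T) (x v : Space) :
    ‖V t 0 x v‖ ≤ (1 + ‖v‖) * Real.exp (lam * (1 + M) * T) := by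
  have h0 : (0 : ℝ) ∈ Icc 0 T := ⟨le_rfl, ht.1.trans ht.2⟩
  have hpos : 0 < lam * (1 + (M : ℝ)) := by positivity
  have := norm_right_le_of_norm_deriv_le hpos ht.1 (f := fun τ => V τ 0 x v)
    (f' := fun τ => lam • (g + u τ (X τ 0 x v) - V τ 0 x v))
    (fun τ hτ => (hXV.velocity_deriv 0 h0 x v τ ⟨hτ.1, hτ.2.trans ht.2⟩).mono
      (Icc_subset_Icc le_rfl ht.2)) (fun τ hτ => by
      rw [norm_smul, Real.norm_of_nonneg hlam.le, mul_assoc]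
      refine mul_le_mul_of_nonneg_left ?_ hlam.le
      have h1 := norm_sub_le (g + u τ (X τ 0 x v)) (V τ 0 x v)
      have h2 := norm_add_le g (u τ (X τ 0 x v))
      have h3 := hM τ ⟨hτ.1, hτ.2.trans ht.2⟩ (X τ 0 x v)
      have h4 := norm_nonneg (V τ 0 x v)
      have h5 : (0 : ℝ) ≤ M := M.2
      nlinarith [mul_nonneg h5 h4])
  rw [hXV.velocity_initial 0 h0] at this
  refine this.trans ?_
  gcongr
  linarith [ht.2]

lemma IsCharacteristics.continuousOn_position {X V : ℝ → ℝ → Space → Space → Space}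
    (hXV : IsCharacteristics lam T g u X V) (hT : 0 ≤ T) (x v : Space) :
    ContinuousOn (fun t => X t 0 x v) (Icc 0 T) := fun t ht =>
  (hXV.position_deriv 0 ⟨le_rfl, hT⟩ x v t ht).continuousWithinAt

lemma IsCharacteristics.continuousOn_velocity {X V : ℝ → ℝ → Space → Space → Space}
    (hXV : IsCharacteristics lam T g u X V) (hT : 0 ≤ T) (x v : Space) :
    ContinuousOn (fun t => V t 0 x v) (Icc 0 T) := fun t ht =>
  (hXV.velocity_deriv 0 ⟨le_rfl, hT⟩ x v t ht).continuousWithinAt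

/-- The regularized representation formula holds at every time, by continuity. -/
lemma IsVlasovStokesSolution.integral_blob_eq (h : IsVlasovStokesSolution K lam T g f₀ f u)
    {X V : ℝ → ℝ → Space → Space → Space} (hXV : IsCharacteristics lam T g u X V)
    (hK : 1 ≤ K) (hlam : 0 < lam) (hT : 0 < T) (hg : ‖g‖ = 1) (hm : moment K f₀ < ⊤)
    {ε : ℝ} (hε : 0 < ε) (a k : Space) {t : ℝ} (ht : t ∈ Icc 0 T) :
    ∫ y, blob y * inner ℝ k (u t (a + ε • y)) =
      ∫ z, inner ℝ (z.2 - u t z.1) (stokeslet ε (z.1 - a) k) ∂(f t) := by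
  obtain ⟨M, hM⟩ := h.exists_velocity_bounds hT
  have h0 : (0 : ℝ) ∈ Icc 0 T := ⟨le_rfl, hT.le⟩
  have : IsProbabilityMeasure f₀ := h.initial ▸ h.isProbabilityMeasure 0 h0
  have hux : ∀ x, ContinuousOn (fun t => u t x) (Icc 0 T) := fun x =>
    h.velocity_continuous.comp (f := fun t : ℝ => (t, x)) (by fun_prop)
      (fun t ht => ⟨ht, mem_univ _⟩)
  have hsc : ∀ k, Continuous fun x => stokeslet ε x k := fun k => (contDiff_stokeslet hε k).continuous
  have hL : ContinuousOn (fun t => ∫ y, blob y * inner ℝ k (u t (a + ε • y))) (Icc 0 T) := by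
    refine continuousOn_of_dominated (bound := fun y => blob y * (‖k‖ * M)) (fun t ht => ?_)
      (fun t ht => ae_of_all _ fun y => ?_) (integrable_blob.mul_const _)
      (ae_of_all _ fun y => continuousOn_const.mul
        (continuousOn_const.inner (hux _)))
    · exact (continuous_blob.mul (continuous_const.inner
        ((h.continuous_velocity ht).comp (by fun_prop)))).aestronglyMeasurable
    · rw [norm_mul, Real.norm_of_nonneg (blob_pos y).le]
      refine mul_le_mul_of_nonneg_left ((norm_inner_le_norm _ _).trans ?_) (blob_pos y).le
      exact mul_le_mul_of_nonneg_left ((hM t ht).1 _) (norm_nonneg _)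
  have hRm : ∀ t ∈ Icc 0 T,
      Continuous fun z : Phase => (inner ℝ (z.2 - u t z.1) (stokeslet ε (z.1 - a) k) : ℝ) :=
    fun t ht => (continuous_snd.sub ((h.continuous_velocity ht).comp continuous_fst)).inner
      ((hsc k).comp (continuous_fst.sub continuous_const))
  -- Written over the fixed measure `f₀`, the integral depends on time only through the
  -- characteristics and `u`, so dominated convergence gives its continuity.
  have hmap : ∀ t ∈ Icc 0 T, ∫ z, inner ℝ (z.2 - u t z.1) (stokeslet ε (z.1 - a) k) ∂(f t) =
      ∫ z : Phase, inner ℝ (V t 0 z.1 z.2 - u t (X t 0 z.1 z.2))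
        (stokeslet ε (X t 0 z.1 z.2 - a) k) ∂f₀ := by
    intro t ht
    obtain ⟨hc, hf⟩ := h.eq_map hXV hT ht
    rw [hf, integral_map hc.aemeasurable (hRm t ht).aestronglyMeasurable]
    rfl
  have hR : ContinuousOn (fun t => ∫ z : Phase, inner ℝ (V t 0 z.1 z.2 - u t (X t 0 z.1 z.2))
        (stokeslet ε (X t 0 z.1 z.2 - a) k) ∂f₀) (Icc 0 T) := by
    have hint : Integrable (fun z : Phase => z.2) f₀ :=
      memLp_one_iff_integrable.1 (memLp_snd_of_moment (by linarith) hm (by simpa using hK))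
    refine continuousOn_of_dominated (bound := fun z : Phase =>
      ((1 + ‖z.2‖) * Real.exp (lam * (1 + M) * T) + M) * (3 * ε⁻¹ * ‖k‖)) (fun t ht => ?_)
      (fun t ht => ae_of_all _ fun z => ?_) ?_
      (ae_of_all _ fun z => ?_)
    · exact ((hRm t ht).comp (h.eq_map hXV hT ht).1).aestronglyMeasurable
    · refine (norm_inner_le_norm _ _).trans ?_
      refine mul_le_mul ((norm_sub_le _ _).trans (add_le_add
        (hXV.norm_velocity_le hlam hg (fun t ht => (hM t ht).1) ht _ _) ((hM t ht).1 _)))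
        ((norm_stokeslet_le hε.le _ _).trans ?_) (norm_nonneg _) (by positivity)
      gcongr
      rw [← one_div, le_div_iff₀ hε, mul_comm]
      exact mul_regInv_le ε _
    · exact ((((integrable_const 1).add hint.norm).mul_const _).add
        (integrable_const _)).mul_const _
    · have hX := hXV.continuousOn_position hT.le z.1 z.2
      have hV := hXV.continuousOn_velocity hT.le z.1 z.2
      have huX : ContinuousOn (fun t => u t (X t 0 z.1 z.2)) (Icc 0 T) :=
        h.velocity_continuous.comp (f := fun t : ℝ => (t, X t 0 z.1 z.2))
          (continuousOn_id.prodMk hX) (fun t ht => ⟨ht, mem_univ _⟩)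
      exact (hV.sub huX).inner ((hsc k).comp_continuousOn (hX.sub continuousOn_const))
  rw [hmap t ht]
  -- Both sides are continuous on `[0, T]`, and the weak Stokes equation gives their equality at
  -- almost every time.
  refine Measure.eqOn_Icc_of_ae_eq volume hT.ne ?_ hL hR ht
  rw [← restrict_Ioo_eq_restrict_Icc, EventuallyEq, ae_restrict_iff' measurableSet_Ioo]
  filter_upwards [h.fluid] with s hs hsT
  obtain ⟨G, hG, htest⟩ := hs hsT
  rw [← hmap s (Ioo_subset_Icc_self hsT), ← htest _ _ (isDivFreeDotH1_stokeslet hε a k),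
    hG.integral_frobenius_stokeslet hε a k,
    integral_regInv_pow_mul hε a (fun x => inner ℝ k (u s x))]

/-- The velocity is the Stokeslet potential of the force density, at every time at which the
spatial density is regular enough. -/
lemma IsVlasovStokesSolution.velocity_eq_integral (h : IsVlasovStokesSolution K lam T g f₀ f u)
    {X V : ℝ → ℝ → Space → Space → Space} (hXV : IsCharacteristics lam T g u X V)
    (hK : 2 ≤ K) (hlam : 0 < lam) (hT : 0 < T) (hg : ‖g‖ = 1) (hm : moment K f₀ < ⊤)
    {t : ℝ} (ht : t ∈ Icc 0 T) {S : ℝ≥0} (hS : SingularBound (f t) Prod.fst S) (a : Space) :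
    Integrable (fun z => stokeslet 0 (z.1 - a) (z.2 - u t z.1)) (f t) ∧
      blobMass • u t a = ∫ z, stokeslet 0 (z.1 - a) (z.2 - u t z.1) ∂(f t) := by
  obtain ⟨M, hM⟩ := h.exists_velocity_bounds hT
  have h0 : (0 : ℝ) ∈ Icc 0 T := ⟨le_rfl, hT.le⟩
  have := h.isProbabilityMeasure t ht
  have : IsProbabilityMeasure f₀ := h.initial ▸ h.isProbabilityMeasure 0 h0
  have hv : MemLp (fun z : Phase => z.2) 2 (f t) := by
    obtain ⟨hc, hf⟩ := h.eq_map hXV hT ht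
    rw [hf]
    rw [memLp_map_measure_iff measurable_snd.aestronglyMeasurable hc.aemeasurable]
    have hv0 : MemLp (fun z : Phase => z.2) 2 f₀ := memLp_snd_of_moment (by linarith) hm (by
      rw [← ENNReal.ofReal_ofNat 2]; exact ENNReal.ofReal_le_ofReal hK)
    have h2 : MemLp (fun z : Phase => 1 + ‖z.2‖) 2 f₀ := (memLp_const (1 : ℝ)).add hv0.norm
    have h1 := h2.mul_const (Real.exp (lam * (1 + M) * T))
    have hm2 : AEStronglyMeasurable ((fun z : Phase => z.2) ∘ phaseFlow X V t 0) f₀ :=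
      (measurable_snd.comp hc.measurable).aestronglyMeasurable
    refine h1.mono' hm2 (ae_of_all _ fun z => ?_)
    exact hXV.norm_velocity_le hlam hg (fun t ht => (hM t ht).1) ht z.1 z.2
  exact blobMass_smul_eq_integral (h.continuous_velocity ht) (hM t ht).1 hv hS
    (fun ε hε a k => h.integral_blob_eq hXV (by linarith) hlam hT hg hm hε a k ht) a

end Solution

/-! ### Singular integrals against densities in `L^q`, `q > 4` -/

lemma lintegral_ball_rpow_lt_top {α : ℝ} (hα : α < 3) :
    ∫⁻ x in Metric.ball (0 : Space) 1, ‖x‖ₑ ^ (-α) < ⊤ := by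
  have h1 : IntegrableOn (fun x : Space => ‖x‖ ^ (-α)) (Metric.ball 0 1) volume :=
    integrableOn_ball_of_norm_le_rpow (by simp) (C := 1) (α := α) (by simpa using hα)
      (ae_of_all _ fun x => by rw [one_mul, Real.norm_of_nonneg (by positivity)])
      (by fun_prop : Measurable fun x : Space => ‖x‖ ^ (-α)).aestronglyMeasurable
  refine lt_of_le_of_lt (lintegral_mono_ae ?_) h1.hasFiniteIntegral
  have h2 : ∀ᵐ x : Space ∂(volume.restrict (Metric.ball 0 1)), x ≠ 0 :=
    ae_restrict_of_ae (Measure.ae_ne volume 0)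
  filter_upwards [h2] with x hx
  have hx0 : 0 < ‖x‖ := norm_pos_iff.2 hx
  rw [Real.enorm_eq_ofReal (by positivity), ← ENNReal.ofReal_rpow_of_pos hx0, ofReal_norm]

/-- Outside the unit ball around `a` the integrand is at most `1` and the mass is `1`. Inside, apply
Hölder with `q₀ > 4`: the conjugate exponent satisfies `9/4 * p₀ < 3`, so the singularity is locally
integrable, with a bound independent of `a` by translation invariance. -/
lemma exists_singularBound {q : ℝ≥0∞} (hq : 4 < q) (A : ℝ≥0) :
    ∃ S : ℝ≥0, ∀ μ : Measure Phase, IsProbabilityMeasure μ →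
      lqNorm q (spatialDensity μ) ≤ A → SingularBound μ Prod.fst S := by
  obtain ⟨p₀, q₀, hq4, hqq, hconj⟩ : ∃ p₀ q₀ : ℝ, 4 < q₀ ∧ ENNReal.ofReal q₀ ≤ q ∧
      p₀.HolderConjugate q₀ := by
    -- Capping at `5` gives a finite exponent even for `q = ∞`; on the unit ball the passage from
    -- `L^q` to the smaller exponent costs the constant `c₁`.
    have h1 : (4 : ℝ≥0∞) < min q 5 := lt_min hq (by norm_num)
    have h2 : min q 5 ≠ ⊤ := ne_top_of_le_ne_top (by simp) (min_le_right _ _)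
    have h3 : 4 < (min q 5).toReal := by
      have := (ENNReal.toReal_lt_toReal (by simp) h2).2 h1
      simpa using this
    refine ⟨(min q 5).toReal.conjExponent, (min q 5).toReal, h3, ?_,
      (Real.HolderConjugate.conjExponent (by linarith)).symm⟩
    rw [ENNReal.ofReal_toReal h2]
    exact min_le_left _ _
  have hp0 : 0 < p₀ := hconj.pos
  have hq0 : 0 < q₀ := hconj.symm.pos
  have hp43 : 9 / 4 * p₀ < 3 := by
    have := hconj.inv_add_inv_eq_one
    have h5 : q₀⁻¹ < 4⁻¹ := by gcongr
    have h6 : (3 / 4 : ℝ) < p₀⁻¹ := by linarith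
    have h7 : p₀⁻¹ * p₀ = 1 := inv_mul_cancel₀ hp0.ne'
    nlinarith
  set c₁ : ℝ≥0∞ := volume (Metric.ball (0 : Space) 1) ^
    (1 / (ENNReal.ofReal q₀).toReal - 1 / q.toReal) with hc₁
  set c₂ : ℝ≥0∞ := (∫⁻ x in Metric.ball (0 : Space) 1, ‖x‖ₑ ^ (-(9 / 4 * p₀))) ^ (1 / p₀) with hc₂
  have hc₁t : c₁ ≠ ⊤ := by
    refine ENNReal.rpow_ne_top_of_nonneg ?_ measure_ball_lt_top.ne
    rw [ENNReal.toReal_ofReal hq0.le]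
    rcases eq_or_ne q ⊤ with rfl | hqt
    · simp [hq0.le]
    · have h1 := (ENNReal.ofReal_le_iff_le_toReal hqt).1 hqq
      have := one_div_le_one_div_of_le hq0 h1
      linarith
  have hc₂t : c₂ ≠ ⊤ := ENNReal.rpow_ne_top_of_nonneg (by positivity)
    (lintegral_ball_rpow_lt_top hp43).ne
  have hSt : 1 + (A * c₁) * c₂ ≠ ⊤ :=
    ENNReal.add_ne_top.2 ⟨by simp, ENNReal.mul_ne_top (ENNReal.mul_ne_top (by simp) hc₁t) hc₂t⟩
  refine ⟨(1 + (A * c₁) * c₂).toNNReal, fun μ _ hA a => ?_⟩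
  rw [ENNReal.coe_toNNReal hSt]
  have hac : spatialDensity μ ≪ volume := by
    by_contra hnot
    rw [lqNorm, if_neg hnot] at hA
    exact absurd hA (by simp)
  rw [lqNorm, if_pos hac] at hA
  have hρ : IsProbabilityMeasure (spatialDensity μ) :=
    Measure.isProbabilityMeasure_map measurable_fst.aemeasurable
  set d := (spatialDensity μ).rnDeriv volume with hd
  have hdm : Measurable d := Measure.measurable_rnDeriv _ _
  have hdens : volume.withDensity d = spatialDensity μ := Measure.withDensity_rnDeriv_eq _ _ hac
  have h1 : ∫⁻ z, ‖z.1 - a‖ₑ ^ (-(9 / 4) : ℝ) ∂μ =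
      ∫⁻ x, ‖x - a‖ₑ ^ (-(9 / 4) : ℝ) ∂(spatialDensity μ) := by
    rw [spatialDensity, lintegral_map (f := fun x : Space => ‖x - a‖ₑ ^ (-(9 / 4) : ℝ))
      (by fun_prop) measurable_fst]
  rw [h1]
  rw [← lintegral_add_compl _ (measurableSet_ball (x := a) (ε := 1)), add_comm]
  refine add_le_add ?_ ?_
  · calc _ ≤ ∫⁻ x in (Metric.ball a 1)ᶜ, 1 ∂(spatialDensity μ) := by
          refine setLIntegral_mono measurable_const fun x hx => ?_
          have : (1 : ℝ≥0∞) ≤ ‖x - a‖ₑ := by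
            rw [mem_compl_iff, Metric.mem_ball, not_lt, dist_eq_norm] at hx
            rw [← ofReal_norm]
            exact ENNReal.one_le_ofReal.2 hx
          exact ENNReal.rpow_le_one_of_one_le_of_neg this (by norm_num)
      _ ≤ 1 := by
          rw [setLIntegral_one]
          exact prob_le_one
  · rw [← hdens, restrict_withDensity measurableSet_ball,
      lintegral_withDensity_eq_lintegral_mul _ hdm (by fun_prop)]
    refine (ENNReal.lintegral_mul_le_Lp_mul_Lq _ hconj.symm hdm.aemeasurable
      (by fun_prop)).trans ?_
    refine mul_le_mul' ?_ ?_
    · have e1 := eLpNorm_le_eLpNorm_mul_rpow_measure_univ (μ := volume.restrict (Metric.ball a 1)) hqq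
        hdm.aestronglyMeasurable
      rw [eLpNorm_eq_lintegral_rpow_enorm_toReal (by simpa using hq0) ENNReal.ofReal_ne_top,
        ENNReal.toReal_ofReal hq0.le] at e1
      simp only [enorm_eq_self] at e1
      refine e1.trans (mul_le_mul' ((eLpNorm_mono_measure _ Measure.restrict_le_self).trans hA) ?_)
      rw [Measure.restrict_apply_univ, Measure.addHaar_ball_center, hc₁,
        ENNReal.toReal_ofReal hq0.le]
    · rw [hc₂]
      refine ENNReal.rpow_le_rpow (le_of_eq ?_) (by positivity)
      rw [← lintegral_indicator measurableSet_ball, ← lintegral_indicator measurableSet_ball]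
      have e2 := lintegral_sub_right_eq_self (μ := (volume : Measure Space))
        ((Metric.ball (0 : Space) 1).indicator fun x => ‖x‖ₑ ^ (-(9 / 4 * p₀))) a
      rw [← e2]
      refine lintegral_congr fun x => ?_
      by_cases hx : x ∈ Metric.ball a 1
      · have hx' : x - a ∈ Metric.ball (0 : Space) 1 := by
          rw [mem_ball_zero_iff, ← dist_eq_norm]; exact hx
        rw [indicator_of_mem hx, indicator_of_mem hx', ← ENNReal.rpow_mul, neg_mul]
      · have hx' : x - a ∉ Metric.ball (0 : Space) 1 := by
          rw [mem_ball_zero_iff, ← dist_eq_norm]; exact hx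
        rw [indicator_of_notMem hx, indicator_of_notMem hx']

/-! ### Differences of the Stokeslet -/

/-- If `‖a - b‖ ≤ ‖a‖ / 2`, the segment stays at distance at least `‖a‖ / 2` from the origin and the
mean value inequality applies, with constant `9 · 2²`. Otherwise `‖a‖` and `‖b‖` are bounded by
multiples of `‖a - b‖` and the two terms are estimated separately. The constants do not depend on
`ε`, so the limit `ε → 0` is immediate. -/
lemma norm_stokeslet_sub_le_of_pos {ε : ℝ} (hε : 0 < ε) {a b : Space} (ha : a ≠ 0) (hb : b ≠ 0)
    (h : Space) : ‖stokeslet ε a h - stokeslet ε b h‖ ≤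
      36 * ‖h‖ * (‖a - b‖ * (‖a‖⁻¹ ^ 2 + ‖b‖⁻¹ ^ 2)) := by
  have ha0 : 0 < ‖a‖ := norm_pos_iff.2 ha
  have hb0 : 0 < ‖b‖ := norm_pos_iff.2 hb
  by_cases hab : ‖a - b‖ ≤ ‖a‖ / 2
  · have hseg : ∀ x ∈ segment ℝ a b, ‖fderiv ℝ (fun x => stokeslet ε x h) x‖ ≤
        36 * ‖h‖ * ‖a‖⁻¹ ^ 2 := by
      intro x hx
      have hxa : ‖a‖ / 2 ≤ ‖x‖ := by
        have h1 : x ∈ Metric.closedBall a (‖a‖ / 2) :=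
          (convex_closedBall a _).segment_subset (Metric.mem_closedBall_self (by positivity))
            (by rw [Metric.mem_closedBall, dist_eq_norm, norm_sub_rev]; exact hab) hx
        rw [Metric.mem_closedBall, dist_eq_norm] at h1
        have h2 : ‖a‖ ≤ ‖x‖ + ‖x - a‖ := by
          rw [norm_sub_rev]; simpa using norm_add_le x (a - x)
        linarith
      have hx0 : x ≠ 0 := by
        rintro rfl
        rw [norm_zero] at hxa
        linarith
      have h1 := norm_fderiv_stokeslet_sub_le hε 0 h x
      simp only [sub_zero] at h1
      refine h1.trans ?_
      have h2 : regInv ε x ≤ 2 * ‖a‖⁻¹ := (regInv_le_inv_norm ε hx0).trans (by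
        rw [inv_le_comm₀ (by positivity) (by positivity), mul_inv, inv_inv]; linarith)
      calc _ ≤ 9 * ‖h‖ * (2 * ‖a‖⁻¹) ^ 2 := by
            gcongr
            exact regInv_nonneg _ _
        _ = _ := by ring
    have := (convex_segment a b).norm_image_sub_le_of_norm_fderiv_le (𝕜 := ℝ)
      (fun x _ => (contDiff_stokeslet hε h).differentiable (by simp) x) hseg
      (right_mem_segment ℝ a b) (left_mem_segment ℝ a b)
    refine this.trans ?_
    have : 36 * ‖h‖ * ‖a‖⁻¹ ^ 2 * ‖a - b‖ = 36 * ‖h‖ * (‖a - b‖ * (‖a‖⁻¹ ^ 2 + 0)) := by ring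
    rw [this]
    gcongr
    positivity
  · rw [not_le] at hab
    have h1 := norm_stokeslet_le hε.le a h
    have h2 := norm_stokeslet_le hε.le b h
    have e1 : regInv ε a ≤ 2 * (‖a - b‖ * ‖a‖⁻¹ ^ 2) := (regInv_le_inv_norm ε ha).trans (by
      calc ‖a‖⁻¹ = ‖a‖ * ‖a‖⁻¹ ^ 2 := by field_simp
        _ ≤ 2 * ‖a - b‖ * ‖a‖⁻¹ ^ 2 := by gcongr; linarith
        _ = _ := by ring)
    have e2 : regInv ε b ≤ 3 * (‖a - b‖ * ‖b‖⁻¹ ^ 2) := (regInv_le_inv_norm ε hb).trans (by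
      have h4 : ‖b‖ ≤ 3 * ‖a - b‖ := by
        have : ‖b‖ ≤ ‖a‖ + ‖a - b‖ := by
          rw [norm_sub_rev]; simpa using norm_add_le a (b - a)
        linarith
      calc ‖b‖⁻¹ = ‖b‖ * ‖b‖⁻¹ ^ 2 := by field_simp
        _ ≤ 3 * ‖a - b‖ * ‖b‖⁻¹ ^ 2 := by gcongr
        _ = _ := by ring)
    refine (norm_sub_le _ _).trans ?_
    have f1 : 0 ≤ ‖a - b‖ * ‖a‖⁻¹ ^ 2 := by positivity
    have f2 : 0 ≤ ‖a - b‖ * ‖b‖⁻¹ ^ 2 := by positivity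
    calc _ ≤ 3 * (2 * (‖a - b‖ * ‖a‖⁻¹ ^ 2)) * ‖h‖ + 3 * (3 * (‖a - b‖ * ‖b‖⁻¹ ^ 2)) * ‖h‖ := by
          refine add_le_add (h1.trans ?_) (h2.trans ?_) <;> gcongr
      _ ≤ _ := by nlinarith [norm_nonneg h, mul_nonneg (norm_nonneg h) f1,
            mul_nonneg (norm_nonneg h) f2]

lemma norm_stokeslet_sub_le {a b : Space} (ha : a ≠ 0) (hb : b ≠ 0) (h : Space) :
    ‖stokeslet 0 a h - stokeslet 0 b h‖ ≤
      36 * ‖h‖ * (‖a - b‖ * (‖a‖⁻¹ ^ 2 + ‖b‖⁻¹ ^ 2)) := by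
  refine le_of_tendsto ((tendsto_stokeslet ha h).sub (tendsto_stokeslet hb h)).norm ?_
  filter_upwards [self_mem_nhdsWithin] with ε hε
  exact norm_stokeslet_sub_le_of_pos hε ha hb h

/-! ### The Stokes energy of a force distribution -/

section Energy

variable {Ω : Type*} [MeasurableSpace Ω] {γ : Measure Ω} {X : Ω → Space} {S : ℝ≥0} {h k : Ω → Space}

lemma stokeslet_neg (ε : ℝ) (x h : Space) : stokeslet ε (-x) h = stokeslet ε x h := by
  simp [stokeslet, regInv_neg]

lemma stokeslet_add_right (ε : ℝ) (x h k : Space) :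
    stokeslet ε x (h + k) = stokeslet ε x h + stokeslet ε x k := by
  simp only [stokeslet, inner_add_left, mul_add, smul_add, add_smul]
  abel

lemma stokeslet_smul_right (ε : ℝ) (x : Space) (c : ℝ) (h : Space) :
    stokeslet ε x (c • h) = c • stokeslet ε x h := by
  simp only [stokeslet, real_inner_smul_left, smul_add, smul_smul]
  congr 2 <;> ring

lemma stokeslet_sub_right (ε : ℝ) (x h k : Space) :
    stokeslet ε x (h - k) = stokeslet ε x h - stokeslet ε x k := by
  rw [sub_eq_add_neg, ← neg_one_smul ℝ k, stokeslet_add_right, stokeslet_smul_right,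
    neg_one_smul, ← sub_eq_add_neg]

lemma measurable_stokeslet_comp {β : Type*} [MeasurableSpace β] (ε : ℝ) {f g : β → Space}
    (hf : Measurable f) (hg : Measurable g) : Measurable fun b => stokeslet ε (f b) (g b) :=
  (measurable_stokeslet ε).comp (g := fun p : Space × Space => stokeslet ε p.1 p.2)
    (f := fun b => (f b, g b)) (hf.prodMk hg)

namespace SingularBound

variable [IsProbabilityMeasure γ]

lemma integrable_inv_norm (hS : SingularBound γ X S) (hX : Measurable X) (a : Space) :
    Integrable (fun ω' => ‖X ω' - a‖⁻¹) γ :=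
  (hS.memLp_inv_norm hX a).integrable one_le_two

lemma integral_inv_norm_le (hS : SingularBound γ X S) (hX : Measurable X) (a : Space) :
    ∫ ω', ‖X ω' - a‖⁻¹ ∂γ ≤ 1 + S := by
  rw [integral_eq_lintegral_of_nonneg_ae (ae_of_all _ fun _ => by positivity) (by fun_prop)]
  refine ENNReal.toReal_le_of_le_ofReal (by positivity) ?_
  have := hS.rpow_le (r := 1) one_pos (by norm_num) a
  have e : ((1 + S : ℝ≥0) : ℝ≥0∞) = ENNReal.ofReal (1 + S) := by
    rw [← ENNReal.ofReal_coe_nnreal]; simp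
  rw [← e]
  refine le_trans (lintegral_mono_ae ?_) this
  filter_upwards [hS.ae_ne hX a] with z hz
  have hz' : 0 < ‖X z - a‖ := norm_pos_iff.2 (sub_ne_zero.2 hz)
  rw [ENNReal.ofReal_inv_of_pos hz', ofReal_norm, ENNReal.rpow_neg_one]

lemma ae_prod_ne (hS : SingularBound γ X S) (hX : Measurable X) :
    ∀ᵐ p : Ω × Ω ∂(γ.prod γ), X p.2 ≠ X p.1 := by
  refine (Measure.ae_prod_iff_ae_ae (p := fun p : Ω × Ω => X p.2 ≠ X p.1) ?_).2
    (ae_of_all _ fun a => hS.ae_ne hX (X a))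
  exact (measurableSet_eq_fun (hX.comp measurable_snd) (hX.comp measurable_fst)).compl

lemma integrable_prod_sq (hS : SingularBound γ X S) (hX : Measurable X) (hh : Measurable h)
    (hh2 : MemLp h 2 γ) :
    Integrable (fun p : Ω × Ω => ‖X p.2 - X p.1‖⁻¹ * ‖h p.1‖ ^ 2) (γ.prod γ) ∧
      ∫ p : Ω × Ω, ‖X p.2 - X p.1‖⁻¹ * ‖h p.1‖ ^ 2 ∂(γ.prod γ) ≤ (1 + S) * ∫ z, ‖h z‖ ^ 2 ∂γ := by
  have hsq : Integrable (fun z => ‖h z‖ ^ 2) γ := hh2.integrable_norm_pow (by norm_num)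
  have hle : ∀ z, ∫ ω', ‖X ω' - X z‖⁻¹ * ‖h z‖ ^ 2 ∂γ ≤ (1 + S) * ‖h z‖ ^ 2 := fun z => by
    rw [integral_mul_const]
    gcongr
    exact hS.integral_inv_norm_le hX _
  have hm : Measurable fun p : Ω × Ω => ‖X p.2 - X p.1‖⁻¹ * ‖h p.1‖ ^ 2 := by fun_prop
  have hint : Integrable (fun p : Ω × Ω => ‖X p.2 - X p.1‖⁻¹ * ‖h p.1‖ ^ 2) (γ.prod γ) := by
    have hiz : ∀ z, Integrable (fun ω' => ‖X ω' - X z‖⁻¹ * ‖h z‖ ^ 2) γ := fun z =>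
      (hS.integrable_inv_norm hX _).mul_const _
    rw [integrable_prod_iff hm.aestronglyMeasurable]
    refine ⟨Eventually.of_forall hiz, ?_⟩
    have hms : StronglyMeasurable fun z => ∫ ω', ‖‖X ω' - X z‖⁻¹ * ‖h z‖ ^ 2‖ ∂γ :=
      StronglyMeasurable.integral_prod_right'
        (f := fun p : Ω × Ω => ‖‖X p.2 - X p.1‖⁻¹ * ‖h p.1‖ ^ 2‖) hm.norm.stronglyMeasurable
    refine (hsq.const_mul (1 + S : ℝ)).mono' hms.aestronglyMeasurable (ae_of_all _ fun z => ?_)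
    have hn : ∀ ω', ‖‖X ω' - X z‖⁻¹ * ‖h z‖ ^ 2‖ = ‖X ω' - X z‖⁻¹ * ‖h z‖ ^ 2 := fun ω' =>
      Real.norm_of_nonneg (by positivity)
    simp only [hn]
    rw [Real.norm_of_nonneg (integral_nonneg fun _ => by positivity)]
    exact hle z
  refine ⟨hint, ?_⟩
  rw [integral_prod _ hint, ← integral_const_mul]
  exact integral_mono hint.integral_prod_left (hsq.const_mul _) hle

/-- Schur's test. -/
lemma integrable_prod_mul (hS : SingularBound γ X S) (hX : Measurable X)
    (hh : Measurable h) (hk : Measurable k) (hh2 : MemLp h 2 γ) (hk2 : MemLp k 2 γ) :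
    Integrable (fun p : Ω × Ω => ‖X p.2 - X p.1‖⁻¹ * (‖h p.1‖ * ‖k p.2‖)) (γ.prod γ) ∧
      ∫ p : Ω × Ω, ‖X p.2 - X p.1‖⁻¹ * (‖h p.1‖ * ‖k p.2‖) ∂(γ.prod γ) ≤
        (1 + S) * ((∫ z, ‖h z‖ ^ 2 ∂γ) + ∫ z, ‖k z‖ ^ 2 ∂γ) / 2 := by
  obtain ⟨i1, b1⟩ := hS.integrable_prod_sq hX hh hh2
  obtain ⟨i2, b2⟩ := hS.integrable_prod_sq hX hk hk2
  have i3 : Integrable (fun p : Ω × Ω => ‖X p.2 - X p.1‖⁻¹ * ‖k p.2‖ ^ 2) (γ.prod γ) := by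
    refine i2.swap.congr (ae_of_all _ fun p => ?_)
    simp [norm_sub_rev]
  have b3 : ∫ p : Ω × Ω, ‖X p.2 - X p.1‖⁻¹ * ‖k p.2‖ ^ 2 ∂(γ.prod γ) ≤
      (1 + S) * ∫ z, ‖k z‖ ^ 2 ∂γ := by
    rw [← integral_prod_swap] at b2
    simpa [norm_sub_rev] using b2
  have hpt : ∀ p : Ω × Ω, ‖X p.2 - X p.1‖⁻¹ * (‖h p.1‖ * ‖k p.2‖) ≤
      (‖X p.2 - X p.1‖⁻¹ * ‖h p.1‖ ^ 2 + ‖X p.2 - X p.1‖⁻¹ * ‖k p.2‖ ^ 2) / 2 := fun p => by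
    have h1 : 0 ≤ ‖X p.2 - X p.1‖⁻¹ := by positivity
    nlinarith [mul_nonneg h1 (sq_nonneg (‖h p.1‖ - ‖k p.2‖))]
  have hint : Integrable (fun p : Ω × Ω => ‖X p.2 - X p.1‖⁻¹ * (‖h p.1‖ * ‖k p.2‖)) (γ.prod γ) := by
    refine ((i1.add i3).div_const 2).mono' (by fun_prop) (ae_of_all _ fun p => ?_)
    rw [Real.norm_of_nonneg (by positivity)]
    exact hpt p
  refine ⟨hint, (integral_mono hint ((i1.add i3).div_const 2) hpt).trans ?_⟩
  have e : ∫ p : Ω × Ω, (‖X p.2 - X p.1‖⁻¹ * ‖h p.1‖ ^ 2 + ‖X p.2 - X p.1‖⁻¹ * ‖k p.2‖ ^ 2) / 2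
      ∂(γ.prod γ) = (∫ p : Ω × Ω, ‖X p.2 - X p.1‖⁻¹ * ‖h p.1‖ ^ 2 ∂(γ.prod γ) +
        ∫ p : Ω × Ω, ‖X p.2 - X p.1‖⁻¹ * ‖k p.2‖ ^ 2 ∂(γ.prod γ)) / 2 := by
    rw [integral_div, integral_add i1 i3]
  refine e.trans_le ?_
  linarith

end SingularBound

variable (γ X) in
/-- The velocity at `X ω` generated by the forces `k` located at `X`. -/
def stokesPotential (k : Ω → Space) (z : Ω) : Space := ∫ z', stokeslet 0 (X z' - X z) (k z') ∂γ

variable (γ X) in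
/-- The Stokes interaction energy of the forces `h` and `k` located at `X`. -/
def stokesEnergy (h k : Ω → Space) : ℝ :=
  ∫ p : Ω × Ω, inner ℝ (h p.1) (stokeslet 0 (X p.2 - X p.1) (k p.2)) ∂(γ.prod γ)

lemma stokesEnergy_comm [SFinite γ] (h k : Ω → Space) :
    stokesEnergy γ X h k = stokesEnergy γ X k h := by
  rw [stokesEnergy, ← integral_prod_swap]
  refine integral_congr_ae (ae_of_all _ fun p => ?_)
  simp only [Prod.fst_swap, Prod.snd_swap]
  rw [← neg_sub, stokeslet_neg, ← inner_stokeslet_comm, real_inner_comm]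

namespace SingularBound

variable [IsProbabilityMeasure γ]

lemma abs_inner_stokeslet_le (x a b : Space) :
    |inner ℝ a (stokeslet 0 x b)| ≤ 3 * (‖x‖⁻¹ * (‖a‖ * ‖b‖)) := by
  refine (abs_real_inner_le_norm _ _).trans ?_
  calc _ ≤ ‖a‖ * (3 * ‖x‖⁻¹ * ‖b‖) := by gcongr; exact norm_stokeslet_zero_le _ _
    _ = _ := by ring

lemma integrable_energy (hS : SingularBound γ X S) (hX : Measurable X)
    (hh : Measurable h) (hk : Measurable k) (hh2 : MemLp h 2 γ) (hk2 : MemLp k 2 γ) :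
    Integrable (fun p : Ω × Ω => (inner ℝ (h p.1) (stokeslet 0 (X p.2 - X p.1) (k p.2)) : ℝ))
      (γ.prod γ) := by
  refine ((hS.integrable_prod_mul hX hh hk hh2 hk2).1.const_mul 3).mono' ?_
    (ae_of_all _ fun p => abs_inner_stokeslet_le _ _ _)
  exact ((hh.comp measurable_fst).inner
    (measurable_stokeslet_comp 0 (by fun_prop) (by fun_prop))).aestronglyMeasurable

lemma integrable_stokeslet (hS : SingularBound γ X S) (hX : Measurable X)
    (hk : Measurable k) (hk2 : MemLp k 2 γ) (a : Space) :
    Integrable (fun z => stokeslet 0 (X z - a) (k z)) γ := by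
  have h1 : Integrable (fun z => ‖X z - a‖⁻¹ * ‖k z‖) γ :=
    (hS.memLp_inv_norm hX a).integrable_mul hk2.norm
  refine (h1.const_mul 3).mono' (measurable_stokeslet_comp 0 (by fun_prop) hk).aestronglyMeasurable
    (ae_of_all _ fun z => ?_)
  rw [← mul_assoc]
  exact norm_stokeslet_zero_le _ _

lemma stokesEnergy_eq (hS : SingularBound γ X S) (hX : Measurable X)
    (hh : Measurable h) (hk : Measurable k) (hh2 : MemLp h 2 γ) (hk2 : MemLp k 2 γ) :
    stokesEnergy γ X h k = ∫ z, inner ℝ (h z) (stokesPotential γ X k z) ∂γ := by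
  rw [stokesEnergy, integral_prod _ (hS.integrable_energy hX hh hk hh2 hk2)]
  congr 1 with z
  have := integral_inner (𝕜 := ℝ) (hS.integrable_stokeslet hX hk hk2 (X z)) (h z)
  rw [stokesPotential, ← this]

/-- Schur's test for the kernel `3 * ‖x‖⁻¹`: this is the operator bound that sets the co-coercivity
constant. -/
lemma stokesEnergy_self_le (hS : SingularBound γ X S) (hX : Measurable X)
    (hk : Measurable k) (hk2 : MemLp k 2 γ) :
    stokesEnergy γ X k k ≤ 3 * (1 + S) * ∫ z, ‖k z‖ ^ 2 ∂γ := by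
  obtain ⟨i1, b1⟩ := hS.integrable_prod_mul hX hk hk hk2 hk2
  have := integral_mono (hS.integrable_energy hX hk hk hk2 hk2) (i1.const_mul 3)
    (fun p => (le_abs_self _).trans (abs_inner_stokeslet_le _ _ _))
  rw [integral_const_mul] at this
  refine this.trans ?_
  linarith

lemma stokesEnergy_sub_smul (hS : SingularBound γ X S) (hX : Measurable X)
    (hh : Measurable h) (hk : Measurable k) (hh2 : MemLp h 2 γ) (hk2 : MemLp k 2 γ) (s : ℝ) :
    stokesEnergy γ X (fun z => h z - s • k z) (fun z => h z - s • k z) =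
      stokesEnergy γ X h h - 2 * s * stokesEnergy γ X k h + s ^ 2 * stokesEnergy γ X k k := by
  have i1 := hS.integrable_energy hX hh hh hh2 hh2
  have i2 := hS.integrable_energy hX hh hk hh2 hk2
  have i3 := hS.integrable_energy hX hk hh hk2 hh2
  have i4 := hS.integrable_energy hX hk hk hk2 hk2
  have e1 : stokesEnergy γ X (fun z => h z - s • k z) (fun z => h z - s • k z) =
      stokesEnergy γ X h h - s * stokesEnergy γ X h k - s * stokesEnergy γ X k h +
        s ^ 2 * stokesEnergy γ X k k := by
    simp only [stokesEnergy]
    have j2 := i2.const_mul s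
    have j3 := i3.const_mul s
    have j12 := i1.sub j2
    have j123 := j12.sub j3
    rw [← integral_const_mul, ← integral_const_mul, ← integral_const_mul]
    refine Eq.trans ?_ (integral_add' j123 (i4.const_mul (s ^ 2))) |>.trans ?_
    rotate_left
    · rw [integral_sub' j12 j3, integral_sub' i1 j2]
    refine integral_congr_ae (ae_of_all _ fun p => ?_)
    simp only [stokeslet_sub_right, stokeslet_smul_right, inner_sub_left, inner_sub_right,
      real_inner_smul_left, real_inner_smul_right, Pi.sub_apply, Pi.add_apply]
    ring
  rw [e1, stokesEnergy_comm h k]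
  ring

end SingularBound

end Energy

/-! ### Positivity of the Stokes energy -/

section Positivity

variable {Ω : Type*} [MeasurableSpace Ω] {γ : Measure Ω} {X : Ω → Space} {S : ℝ≥0} {h : Ω → Space}

lemma integrable_regInv_pow_four {ε : ℝ} (hε : 0 < ε) : Integrable fun x => regInv ε x ^ 4 := by
  have h1 : Integrable fun x => decay x ^ (4 : ℝ) := integrable_decay_rpow (by norm_num)
  refine (h1.const_mul ((1 + 1 / ε) ^ 4)).mono' ((measurable_regInv ε).pow_const 4).aestronglyMeasurable
    (ae_of_all _ fun x => ?_)
  have := pow_le_pow_left₀ (regInv_nonneg ε x) (regInv_le hε x) 4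
  rw [Real.norm_of_nonneg (pow_nonneg (regInv_nonneg ε x) 4)]
  refine this.trans_eq ?_
  rw [mul_pow, decay]
  norm_cast

lemma measurable_stokesletDeriv_comp {β : Type*} [MeasurableSpace β] (ε : ℝ) (e : Space)
    {f g : β → Space} (hf : Measurable f) (hg : Measurable g) :
    Measurable fun b => stokesletDeriv ε (f b) e (g b) := by
  have := (measurable_regInv ε).comp hg
  simp only [Function.comp_def] at this
  unfold stokesletDeriv
  fun_prop

/-- The Stokeslet centred at `b` is itself a divergence-free field of finite Dirichlet energy.
Testing it with the Stokeslet centred at `a` writes the mollified interaction of two point forces as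
a pairing of gradients. -/
lemma integral_blob_inner_stokeslet {ε : ℝ} (hε : 0 < ε) (a b h k : Space) :
    ∫ y, blob y * inner ℝ h (stokeslet ε (a + ε • y - b) k) =
      ∫ x, ∑ i : Fin 3, (inner ℝ (stokesletDeriv ε k (EuclideanSpace.single i 1) (x - b))
        (stokesletDeriv ε h (EuclideanSpace.single i 1) (x - a)) : ℝ) := by
  rw [← integral_regInv_pow_mul hε a fun x => inner ℝ h (stokeslet ε (x - b) k),
    ← (isDivFreeDotH1_stokeslet hε b k).integral_frobenius_stokeslet hε a h]
  simp only [frobenius, fderiv_stokeslet_sub hε]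

variable [IsProbabilityMeasure γ]

lemma integrable_regInv_pow_four_prod {ε : ℝ} (hε : 0 < ε) (hX : Measurable X) (hh : Measurable h)
    (hh2 : MemLp h 2 γ) : Integrable (fun q : (Ω × Ω) × Space =>
      ‖h q.1.1‖ * ‖h q.1.2‖ * regInv ε (q.2 - X q.1.1) ^ 4) ((γ.prod γ).prod volume) := by
  have hr := measurable_regInv ε
  have hm : Measurable fun q : (Ω × Ω) × Space =>
      ‖h q.1.1‖ * ‖h q.1.2‖ * regInv ε (q.2 - X q.1.1) ^ 4 := by fun_prop
  have hh1 : Integrable (fun z => ‖h z‖) γ := (hh2.integrable one_le_two).norm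
  rw [integrable_prod_iff hm.aestronglyMeasurable]
  refine ⟨Eventually.of_forall fun p => ?_, ?_⟩
  · exact ((integrable_regInv_pow_four hε).comp_sub_right (X p.1)).const_mul (‖h p.1‖ * ‖h p.2‖)
  · refine ((hh1.mul_prod hh1).mul_const (∫ x, regInv ε x ^ 4)).congr (ae_of_all _ fun p => ?_)
    have hn : ∀ x, ‖‖h p.1‖ * ‖h p.2‖ * regInv ε (x - X p.1) ^ 4‖ =
        ‖h p.1‖ * ‖h p.2‖ * regInv ε (x - X p.1) ^ 4 := fun x => by
      have := regInv_nonneg ε (x - X p.1)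
      exact Real.norm_of_nonneg (by positivity)
    simp only [hn]
    rw [integral_const_mul, integral_sub_right_eq_self (fun x => regInv ε x ^ 4) (X p.1)]

/-- Absolute integrability for Fubini. The product of two squares of `regInv` is at most half the
sum of their fourth powers, and each fourth power has an integral over space independent of its
centre. -/
lemma integrable_inner_stokesletDeriv {ε : ℝ} (hε : 0 < ε) (hX : Measurable X) (hh : Measurable h)
    (hh2 : MemLp h 2 γ) {e : Space} (he : ‖e‖ = 1) : Integrable (fun q : (Ω × Ω) × Space =>
      (inner ℝ (stokesletDeriv ε (h q.1.2) e (q.2 - X q.1.2))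
        (stokesletDeriv ε (h q.1.1) e (q.2 - X q.1.1)) : ℝ)) ((γ.prod γ).prod volume) := by
  have i1 := integrable_regInv_pow_four_prod hε hX hh hh2
  have hsw : MeasurePreserving (Prod.map Prod.swap id : (Ω × Ω) × Space → (Ω × Ω) × Space)
      ((γ.prod γ).prod volume) ((γ.prod γ).prod volume) :=
    Measure.measurePreserving_swap.prod (MeasurePreserving.id _)
  have i2 := hsw.integrable_comp_of_integrable i1
  refine ((i1.add i2).const_mul (81 / 2)).mono' ?_ (ae_of_all _ fun q => ?_)
  · exact Measurable.aestronglyMeasurable <| Measurable.inner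
      (measurable_stokesletDeriv_comp ε e (by fun_prop) (by fun_prop))
      (measurable_stokesletDeriv_comp ε e (by fun_prop) (by fun_prop))
  · refine (norm_inner_le_norm _ _).trans ?_
    have b1 := norm_stokesletDeriv_le hε.le (h q.1.2) e (q.2 - X q.1.2)
    have b2 := norm_stokesletDeriv_le hε.le (h q.1.1) e (q.2 - X q.1.1)
    rw [he, mul_one] at b1 b2
    refine (mul_le_mul b1 b2 (norm_nonneg _) ((norm_nonneg _).trans b1)).trans ?_
    simp only [Pi.add_apply, Function.comp_apply, Prod.map_fst, Prod.map_snd, Prod.fst_swap,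
      Prod.snd_swap, id]
    have : 0 ≤ ‖h q.1.1‖ * ‖h q.1.2‖ := by positivity
    nlinarith [mul_nonneg this
      (sq_nonneg (regInv ε (q.2 - X q.1.2) ^ 2 - regInv ε (q.2 - X q.1.1) ^ 2))]

/-- After exchanging the integrals, the inner integral at fixed `x` is the squared norm of `∫
stokesletDeriv ε (h z) e (x - X z) ∂γ`. -/
lemma integral_inner_stokesletDeriv_nonneg {ε : ℝ} (hε : 0 < ε) (hX : Measurable X)
    (hh : Measurable h) (hh2 : MemLp h 2 γ) {e : Space} (he : ‖e‖ = 1) :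
    0 ≤ ∫ p : Ω × Ω, (∫ x, (inner ℝ (stokesletDeriv ε (h p.2) e (x - X p.2))
        (stokesletDeriv ε (h p.1) e (x - X p.1)) : ℝ)) ∂(γ.prod γ) := by
  have hint := integrable_inner_stokesletDeriv hε hX hh hh2 he
  rw [integral_integral_swap (f := fun (p : Ω × Ω) (x : Space) =>
    (inner ℝ (stokesletDeriv ε (h p.2) e (x - X p.2))
        (stokesletDeriv ε (h p.1) e (x - X p.1)) : ℝ)) hint]
  refine integral_nonneg_of_ae ?_
  filter_upwards [hint.prod_left_ae] with x hx
  have hA : Integrable (fun z => stokesletDeriv ε (h z) e (x - X z)) γ := by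
    refine ((hh2.integrable one_le_two).norm.const_mul (9 * (1 / ε) ^ 2)).mono'
      (measurable_stokesletDeriv_comp ε e hh (by fun_prop)).aestronglyMeasurable
      (ae_of_all _ fun z => ?_)
    refine (norm_stokesletDeriv_le hε.le _ _ _).trans ?_
    rw [he]
    have h1 : regInv ε (x - X z) ≤ 1 / ε := by
      rw [le_div_iff₀ hε, mul_comm]; exact mul_regInv_le ε _
    have h2 := pow_le_pow_left₀ (regInv_nonneg ε (x - X z)) h1 2
    calc _ ≤ 9 * ‖h z‖ * 1 * (1 / ε) ^ 2 := by gcongr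
      _ = _ := by ring
  have e1 : ∫ p : Ω × Ω, (inner ℝ (stokesletDeriv ε (h p.2) e (x - X p.2))
        (stokesletDeriv ε (h p.1) e (x - X p.1)) : ℝ) ∂(γ.prod γ) =
      inner ℝ (∫ z, stokesletDeriv ε (h z) e (x - X z) ∂γ)
        (∫ z, stokesletDeriv ε (h z) e (x - X z) ∂γ) := by
    rw [integral_prod _ hx, ← integral_inner hA]
    congr 1 with z
    rw [real_inner_comm, ← integral_inner hA]
    simp only [real_inner_comm]
  simp only [Pi.zero_apply]
  rw [e1]
  exact real_inner_self_nonneg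

lemma integral_blob_inner_nonneg {ε : ℝ} (hε : 0 < ε) (hX : Measurable X)
    (hh : Measurable h) (hh2 : MemLp h 2 γ) :
    0 ≤ ∫ p : Ω × Ω, (∫ y, blob y * inner ℝ (h p.1) (stokeslet ε (X p.1 + ε • y - X p.2) (h p.2)))
      ∂(γ.prod γ) := by
  have he : ∀ i : Fin 3, ‖(EuclideanSpace.single i 1 : Space)‖ = 1 := fun i => by simp
  simp only [integral_blob_inner_stokeslet hε]
  have e1 : ∫ p : Ω × Ω, (∫ x, ∑ i : Fin 3,
      (inner ℝ (stokesletDeriv ε (h p.2) (EuclideanSpace.single i 1) (x - X p.2))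
        (stokesletDeriv ε (h p.1) (EuclideanSpace.single i 1) (x - X p.1)) : ℝ)) ∂(γ.prod γ) =
      ∫ p : Ω × Ω, (∑ i : Fin 3, ∫ x,
      (inner ℝ (stokesletDeriv ε (h p.2) (EuclideanSpace.single i 1) (x - X p.2))
        (stokesletDeriv ε (h p.1) (EuclideanSpace.single i 1) (x - X p.1)) : ℝ)) ∂(γ.prod γ) := by
    refine integral_congr_ae ?_
    have hae : ∀ i : Fin 3, _ := fun i =>
      (integrable_inner_stokesletDeriv hε hX hh hh2 (he i)).prod_right_ae
    filter_upwards [ae_all_iff.2 hae] with p hp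
    exact integral_finsetSum _ fun i _ => hp i
  rw [e1, integral_finsetSum _ fun i _ =>
    (integrable_inner_stokesletDeriv hε hX hh hh2 (he i)).integral_prod_left]
  exact Finset.sum_nonneg fun i _ => integral_inner_stokesletDeriv_nonneg hε hX hh hh2 (he i)

/-- Multiply `‖x‖ ≤ ‖x + ε • y‖ + ε * ‖y‖` by `regInv` at `x + ε • y` and use that `regInv` times
the norm of its argument, or times `ε`, is at most `1`. The bound is uniform in `ε`. -/
lemma regInv_add_smul_le {ε : ℝ} (hε : 0 ≤ ε) {x : Space} (hx : x ≠ 0) (y : Space) :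
    regInv ε (x + ε • y) ≤ (1 + ‖y‖) * ‖x‖⁻¹ := by
  have hx0 : 0 < ‖x‖ := norm_pos_iff.2 hx
  have h1 := norm_mul_regInv_le ε (x + ε • y)
  have h2 := mul_regInv_le ε (x + ε • y)
  have h3 : ‖x‖ ≤ ‖x + ε • y‖ + ε * ‖y‖ := by
    have := norm_sub_le (x + ε • y) (ε • y)
    rwa [add_sub_cancel_right, norm_smul, Real.norm_of_nonneg hε] at this
  have h4 := regInv_nonneg ε (x + ε • y)
  rw [← div_eq_mul_inv, le_div_iff₀ hx0]
  nlinarith [mul_le_mul_of_nonneg_right h3 h4, mul_le_mul_of_nonneg_right h2 (norm_nonneg y)]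

lemma abs_blob_mul_inner_le {ε : ℝ} (hε : 0 ≤ ε) {x : Space} (hx : x ≠ 0) (y h k : Space) :
    |blob y * inner ℝ h (stokeslet ε (x + ε • y) k)| ≤
      blob y * (1 + ‖y‖) * (3 * (‖x‖⁻¹ * (‖h‖ * ‖k‖))) := by
  have hb := blob_pos y
  rw [abs_mul, abs_of_pos hb]
  have h1 := norm_stokeslet_le hε (x + ε • y) k
  have h2 := regInv_add_smul_le hε hx y
  calc _ ≤ blob y * (‖h‖ * (3 * ((1 + ‖y‖) * ‖x‖⁻¹) * ‖k‖)) := by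
        gcongr
        refine (abs_real_inner_le_norm _ _).trans ?_
        gcongr
        exact h1.trans (by gcongr)
    _ = _ := by ring

/-- The energy times `blobMass` is the limit of mollified energies, which are Dirichlet integrals
and so nonnegative. Dominated convergence is used twice: in `y` for a fixed pair of distinct
centres, then over pairs with the majorant from Schur's test. -/
lemma SingularBound.stokesEnergy_self_nonneg (hS : SingularBound γ X S) (hX : Measurable X)
    (hh : Measurable h) (hh2 : MemLp h 2 γ) : 0 ≤ stokesEnergy γ X h h := by
  have key : Tendsto (fun ε : ℝ => ∫ p : Ω × Ω, (∫ y,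
      blob y * inner ℝ (h p.1) (stokeslet ε (X p.1 + ε • y - X p.2) (h p.2))) ∂(γ.prod γ)) (𝓝[>] 0)
      (𝓝 (∫ p : Ω × Ω, blobMass * inner ℝ (h p.1) (stokeslet 0 (X p.2 - X p.1) (h p.2))
        ∂(γ.prod γ))) := by
    have hrw : ∀ (ε : ℝ) (p : Ω × Ω) (y : Space), X p.1 + ε • y - X p.2 = X p.1 - X p.2 + ε • y :=
      fun ε p y => by abel
    simp only [hrw]
    have hbd : ∀ ε : ℝ, 0 < ε → ∀ p : Ω × Ω, X p.2 ≠ X p.1 → ∀ y,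
        ‖blob y * inner ℝ (h p.1) (stokeslet ε (X p.1 - X p.2 + ε • y) (h p.2))‖ ≤
        blob y * (1 + ‖y‖) * (3 * (‖X p.2 - X p.1‖⁻¹ * (‖h p.1‖ * ‖h p.2‖))) := fun ε hε p hp y => by
      rw [norm_sub_rev]
      exact abs_blob_mul_inner_le hε.le (sub_ne_zero.2 hp.symm) y _ _
    have hmeas : ∀ ε : ℝ, Measurable fun q : (Ω × Ω) × Space =>
        blob q.2 * inner ℝ (h q.1.1) (stokeslet ε (X q.1.1 - X q.1.2 + ε • q.2) (h q.1.2)) := by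
      intro ε
      have hb := continuous_blob.measurable
      have := measurable_stokeslet_comp ε (β := (Ω × Ω) × Space)
        (f := fun q => X q.1.1 - X q.1.2 + ε • q.2) (g := fun q => h q.1.2)
        (by fun_prop) (by fun_prop)
      fun_prop
    refine tendsto_integral_filter_of_dominated_convergence (fun p : Ω × Ω =>
      (∫ y, blob y * (1 + ‖y‖)) * (3 * (‖X p.2 - X p.1‖⁻¹ * (‖h p.1‖ * ‖h p.2‖))))
      (Eventually.of_forall fun ε =>
        (hmeas ε).stronglyMeasurable.integral_prod_right'.aestronglyMeasurable) ?_
      (((hS.integrable_prod_mul hX hh hh hh2 hh2).1.const_mul 3).const_mul _) ?_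
    · filter_upwards [self_mem_nhdsWithin] with ε hε
      filter_upwards [hS.ae_prod_ne hX] with p hp
      rw [← integral_mul_const]
      exact norm_integral_le_of_norm_le (integrable_blob_mul.mul_const _)
        (ae_of_all _ (hbd ε hε p hp))
    · filter_upwards [hS.ae_prod_ne hX] with p hp
      rw [blobMass, ← integral_mul_const]
      refine tendsto_integral_filter_of_dominated_convergence _
        (Eventually.of_forall fun ε =>
          ((hmeas ε).comp measurable_prodMk_left).aestronglyMeasurable) ?_
        (integrable_blob_mul.mul_const
          (3 * (‖X p.2 - X p.1‖⁻¹ * (‖h p.1‖ * ‖h p.2‖)))) (ae_of_all _ fun y => ?_)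
      · filter_upwards [self_mem_nhdsWithin] with ε hε
        exact ae_of_all _ (hbd ε hε p hp)
      · rw [← stokeslet_neg 0 (X p.2 - X p.1), neg_sub]
        exact tendsto_const_nhds.mul (tendsto_const_nhds.inner
          (tendsto_stokeslet_add (sub_ne_zero.2 hp.symm) y _))
  rw [integral_const_mul] at key
  have h0 : 0 ≤ blobMass * stokesEnergy γ X h h := by
    refine ge_of_tendsto key ?_
    filter_upwards [self_mem_nhdsWithin] with ε hε
    exact integral_blob_inner_nonneg hε hX hh hh2
  exact (mul_nonneg_iff_of_pos_left blobMass_pos).1 h0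

/-- The Stokes potential is a bounded nonnegative self-adjoint operator, hence co-coercive. -/
lemma SingularBound.integral_sq_stokesPotential_le (hS : SingularBound γ X S) (hX : Measurable X)
    {y : Ω → Space} (hh : Measurable h) (hy : Measurable y) (hh2 : MemLp h 2 γ) (hy2 : MemLp y 2 γ)
    (hyh : ∀ z, y z = stokesPotential γ X h z) :
    ∫ z, ‖y z‖ ^ 2 ∂γ ≤ 3 * (1 + S) * ∫ z, inner ℝ (h z) (y z) ∂γ := by
  set τ : ℝ := 3 * (1 + S) with hτ
  have hτ0 : 0 < τ := by positivity
  have e1 : stokesEnergy γ X h h = ∫ z, inner ℝ (h z) (y z) ∂γ := by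
    rw [hS.stokesEnergy_eq hX hh hh hh2 hh2]; simp only [hyh]
  have e2 : stokesEnergy γ X y h = ∫ z, ‖y z‖ ^ 2 ∂γ := by
    rw [hS.stokesEnergy_eq hX hy hh hy2 hh2]
    simp only [← hyh, real_inner_self_eq_norm_sq]
  have e3 := hS.stokesEnergy_sub_smul hX hh hy hh2 hy2 τ⁻¹
  have e4 := hS.stokesEnergy_self_le hX hy hy2
  -- Positivity is applied to `h - τ⁻¹ • y` with `τ` the operator bound. In the expansion the cross
  -- term is `-2 * τ⁻¹ * ∫ ‖y‖²` and the quadratic one at most `τ⁻¹ * ∫ ‖y‖²`, leaving `τ⁻¹ * ∫ ‖y‖²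
  -- ≤ ∫ ⟪h, y⟫`.
  have e5 := hS.stokesEnergy_self_nonneg hX (h := fun z => h z - τ⁻¹ • y z) (by fun_prop)
    (hh2.sub (hy2.const_smul τ⁻¹))
  rw [e3, e1, e2] at e5
  have e6 : τ⁻¹ ^ 2 * stokesEnergy γ X y y ≤ τ⁻¹ * ∫ z, ‖y z‖ ^ 2 ∂γ := by
    calc _ ≤ τ⁻¹ ^ 2 * (τ * ∫ z, ‖y z‖ ^ 2 ∂γ) := by gcongr
      _ = _ := by field_simp
  have e7 : τ⁻¹ * ∫ z, ‖y z‖ ^ 2 ∂γ ≤ ∫ z, inner ℝ (h z) (y z) ∂γ := by linarith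
  rwa [inv_mul_le_iff₀ hτ0] at e7

end Positivity

/-! ### Displacement of the force centres -/

section Displacement

variable {Ω : Type*} [MeasurableSpace Ω] {γ : Measure Ω}

/-- With `t = b ^ (-1/4)` this is `a² t⁷ ≤ a⁹ + t⁹`, obvious by comparing `a` and `t`. It is where
the ninth moment and the exponent `9/4` meet. -/
lemma sq_mul_rpow_le_add (a b : ℝ≥0∞) :
    a ^ (2 : ℝ) * b ^ (-(7 / 4) : ℝ) ≤ a ^ (9 : ℝ) + b ^ (-(9 / 4) : ℝ) := by
  have h7 : b ^ (-(7 / 4) : ℝ) = (b ^ (-(1 / 4) : ℝ)) ^ (7 : ℝ) := by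
    rw [← ENNReal.rpow_mul]; norm_num
  have h9 : b ^ (-(9 / 4) : ℝ) = (b ^ (-(1 / 4) : ℝ)) ^ (9 : ℝ) := by
    rw [← ENNReal.rpow_mul]; norm_num
  rw [h7, h9]
  set t := b ^ (-(1 / 4) : ℝ)
  have e : ∀ s : ℝ≥0∞, s ^ (2 : ℝ) * s ^ (7 : ℝ) = s ^ (9 : ℝ) := fun s => by
    rw [← ENNReal.rpow_add_of_nonneg _ _ (by norm_num) (by norm_num)]; norm_num
  rcases le_total a t with h | h
  · calc _ ≤ t ^ (2 : ℝ) * t ^ (7 : ℝ) := by gcongr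
      _ = t ^ (9 : ℝ) := e t
      _ ≤ _ := le_add_self
  · calc _ ≤ a ^ (2 : ℝ) * a ^ (7 : ℝ) := by gcongr
      _ = a ^ (9 : ℝ) := e a
      _ ≤ _ := le_self_add

variable {x y F δ : Ω → Space} {S S' N : ℝ≥0}

/-- Cauchy–Schwarz with the split `2 = 9/8 + 7/8`. The factor carrying `F` is at most `N + S'` by
`sq_mul_rpow_le_add`. The factor carrying `δ` has singularity `9/4`; exchanging the integrals, the
integral over `z` is at most `S` uniformly in `z'`. -/
lemma SingularBound.lintegral_sq_le [SFinite γ] (hS : SingularBound γ x S)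
    (hS' : SingularBound γ y S') (hx : Measurable x) (hy : Measurable y) (hF : Measurable F)
    (hδ : Measurable δ) (hN : ∫⁻ z, ‖F z‖ₑ ^ (9 : ℝ) ∂γ ≤ N) :
    ∫⁻ z, (∫⁻ z', ‖F z'‖ₑ * ‖δ z'‖ₑ * ‖y z' - x z‖ₑ ^ (-2 : ℝ) ∂γ) ^ (2 : ℝ) ∂γ ≤
      (N + S') * S * ∫⁻ z, ‖δ z‖ₑ ^ (2 : ℝ) ∂γ := by
  have hcs : ∀ z, (∫⁻ z', ‖F z'‖ₑ * ‖δ z'‖ₑ * ‖y z' - x z‖ₑ ^ (-2 : ℝ) ∂γ) ^ (2 : ℝ) ≤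
      (∫⁻ z', ‖δ z'‖ₑ ^ (2 : ℝ) * ‖y z' - x z‖ₑ ^ (-(9 / 4) : ℝ) ∂γ) * (N + S') := by
    intro z
    have h1 : ∫⁻ z', ‖F z'‖ₑ * ‖δ z'‖ₑ * ‖y z' - x z‖ₑ ^ (-2 : ℝ) ∂γ ≤
        (∫⁻ z', (‖δ z'‖ₑ * ‖y z' - x z‖ₑ ^ (-(9 / 8) : ℝ)) ^ (2 : ℝ) ∂γ) ^ (1 / 2 : ℝ) *
        (∫⁻ z', (‖F z'‖ₑ * ‖y z' - x z‖ₑ ^ (-(7 / 8) : ℝ)) ^ (2 : ℝ) ∂γ) ^ (1 / 2 : ℝ) := by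
      refine le_trans (le_of_eq (lintegral_congr_ae ?_)) (ENNReal.lintegral_mul_le_Lp_mul_Lq γ
        Real.HolderConjugate.two_two (f := fun z' => ‖δ z'‖ₑ * ‖y z' - x z‖ₑ ^ (-(9 / 8) : ℝ))
        (g := fun z' => ‖F z'‖ₑ * ‖y z' - x z‖ₑ ^ (-(7 / 8) : ℝ)) (by fun_prop) (by fun_prop))
      filter_upwards [hS'.ae_ne hy (x z)] with z' hz'
      have h0 : ‖y z' - x z‖ₑ ≠ 0 := by simpa [sub_eq_zero] using hz'
      have : ‖y z' - x z‖ₑ ^ (-2 : ℝ) =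
          ‖y z' - x z‖ₑ ^ (-(9 / 8) : ℝ) * ‖y z' - x z‖ₑ ^ (-(7 / 8) : ℝ) := by
        rw [← ENNReal.rpow_add _ _ h0 enorm_ne_top]; norm_num
      simp only [Pi.mul_apply]
      rw [this]
      ring
    have h2 := ENNReal.rpow_le_rpow h1 (z := 2) (by norm_num)
    rw [ENNReal.mul_rpow_of_nonneg _ _ (by norm_num), ← ENNReal.rpow_mul, ← ENNReal.rpow_mul] at h2
    norm_num only [ENNReal.rpow_one] at h2
    refine h2.trans (mul_le_mul' (le_of_eq ?_) ?_)
    · refine lintegral_congr fun z' => ?_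
      rw [ENNReal.mul_rpow_of_nonneg _ _ (by norm_num), ← ENNReal.rpow_mul]
      norm_num
    · calc _ ≤ ∫⁻ z', (‖F z'‖ₑ ^ (9 : ℝ) + ‖y z' - x z‖ₑ ^ (-(9 / 4) : ℝ)) ∂γ := by
            refine lintegral_mono fun z' => ?_
            refine le_trans (le_of_eq ?_) (sq_mul_rpow_le_add _ _)
            rw [ENNReal.mul_rpow_of_nonneg _ _ (by norm_num), ← ENNReal.rpow_mul]
            norm_num
        _ ≤ _ := by
            rw [lintegral_add_left (by fun_prop)]
            exact add_le_add hN (hS' _)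
  calc _ ≤ ∫⁻ z, (∫⁻ z', ‖δ z'‖ₑ ^ (2 : ℝ) * ‖y z' - x z‖ₑ ^ (-(9 / 4) : ℝ) ∂γ) * (N + S') ∂γ :=
        lintegral_mono hcs
    _ = (N + S') * ∫⁻ z', ∫⁻ z, ‖δ z'‖ₑ ^ (2 : ℝ) * ‖y z' - x z‖ₑ ^ (-(9 / 4) : ℝ) ∂γ ∂γ := by
        have hm : Measurable fun p : Ω × Ω =>
            ‖δ p.2‖ₑ ^ (2 : ℝ) * ‖y p.2 - x p.1‖ₑ ^ (-(9 / 4) : ℝ) := by fun_prop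
        rw [lintegral_mul_const' _ _ (by simp), mul_comm, lintegral_lintegral_swap hm.aemeasurable]
    _ ≤ (N + S') * ∫⁻ z', ‖δ z'‖ₑ ^ (2 : ℝ) * S ∂γ := by
        gcongr with z'
        rw [lintegral_const_mul _ (by fun_prop)]
        gcongr
        refine le_trans (le_of_eq (lintegral_congr fun z => ?_)) (hS (y z'))
        rw [← enorm_neg, neg_sub]
    _ = _ := by rw [lintegral_mul_const' _ _ (by simp)]; ring

/-- The effect on the potential, along `x`, of moving the centres of the forces `F` from `x`
to `y`. -/
lemma SingularBound.lintegral_sq_displacement_le [SFinite γ] (hS : SingularBound γ x S)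
    (hS' : SingularBound γ y S') (hx : Measurable x) (hy : Measurable y) (hF : Measurable F)
    (hN : ∫⁻ z, ‖F z‖ₑ ^ (9 : ℝ) ∂γ ≤ N) :
    ∫⁻ z, ‖∫ z', (stokeslet 0 (x z' - x z) (F z') - stokeslet 0 (y z' - x z) (F z')) ∂γ‖ₑ ^ (2 : ℝ)
      ∂γ ≤ (36 ^ 2 * 2 * (2 * N + S + S') * S : ℝ≥0) * ∫⁻ z, ‖x z - y z‖ₑ ^ (2 : ℝ) ∂γ := by
  set I : (Ω → Space) → Ω → ℝ≥0∞ := fun w z =>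
    ∫⁻ z', ‖F z'‖ₑ * ‖x z' - y z'‖ₑ * ‖w z' - x z‖ₑ ^ (-2 : ℝ) ∂γ with hI
  have hpt : ∀ z, ‖∫ z', (stokeslet 0 (x z' - x z) (F z') - stokeslet 0 (y z' - x z) (F z')) ∂γ‖ₑ ≤
      36 * (I x z + I y z) := by
    intro z
    refine (enorm_integral_le_lintegral_enorm _).trans ?_
    rw [hI]
    simp only
    rw [← lintegral_add_left (by fun_prop), ← lintegral_const_mul _ (by fun_prop)]
    refine lintegral_mono_ae ?_
    filter_upwards [hS.ae_ne hx (x z), hS'.ae_ne hy (x z)] with z' h1 h2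
    have h1' := sub_ne_zero.2 h1
    have h2' := sub_ne_zero.2 h2
    have key := norm_stokeslet_sub_le h1' h2' (F z')
    rw [sub_sub_sub_cancel_right] at key
    have e : ∀ w : Space, w ≠ 0 → ‖w‖ₑ ^ (-2 : ℝ) = ENNReal.ofReal (‖w‖⁻¹ ^ 2) := fun w hw => by
      have hw0 : 0 < ‖w‖ := norm_pos_iff.2 hw
      rw [← ofReal_norm, ENNReal.ofReal_rpow_of_pos hw0, inv_pow, Real.rpow_neg hw0.le]
      norm_cast
    rw [e _ h1', e _ h2', ← ofReal_norm, ← ofReal_norm, ← ofReal_norm, ← mul_add,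
      ← ENNReal.ofReal_add (by positivity) (by positivity), ← ENNReal.ofReal_mul (by positivity),
      ← ENNReal.ofReal_mul (by positivity), ← ENNReal.ofReal_ofNat 36,
      ← ENNReal.ofReal_mul (by positivity)]
    refine ENNReal.ofReal_le_ofReal (key.trans_eq ?_)
    ring
  have hb1 := hS.lintegral_sq_le hS hx hx hF (δ := fun z => x z - y z) (by fun_prop) hN
  have hb2 := hS.lintegral_sq_le hS' hx hy hF (δ := fun z => x z - y z) (by fun_prop) hN
  set L := ∫⁻ z, ‖x z - y z‖ₑ ^ (2 : ℝ) ∂γ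
  have hmI : Measurable fun z => I x z ^ (2 : ℝ) := by
    have hm : Measurable fun p : Ω × Ω =>
        ‖F p.2‖ₑ * ‖x p.2 - y p.2‖ₑ * ‖x p.2 - x p.1‖ₑ ^ (-2 : ℝ) := by fun_prop
    exact hm.lintegral_prod_right'.pow_const _
  calc _ ≤ ∫⁻ z, 36 ^ 2 * 2 * (I x z ^ (2 : ℝ) + I y z ^ (2 : ℝ)) ∂γ := by
        refine lintegral_mono fun z => ?_
        refine (ENNReal.rpow_le_rpow (hpt z) (by norm_num)).trans ?_
        rw [ENNReal.mul_rpow_of_nonneg _ _ (by norm_num), mul_assoc]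
        have := ENNReal.rpow_add_le_mul_rpow_add_rpow (I x z) (I y z) (p := 2) (by norm_num)
        norm_num at this ⊢
        gcongr
    _ = 36 ^ 2 * 2 * (∫⁻ z, I x z ^ (2 : ℝ) ∂γ + ∫⁻ z, I y z ^ (2 : ℝ) ∂γ) := by
        rw [lintegral_const_mul' _ _ (by finiteness), lintegral_add_left hmI]
    _ ≤ 36 ^ 2 * 2 * ((N + S) * S * L + (N + S') * S * L) := by gcongr
    _ = _ := by push_cast; ring

end Displacement

/-! ### The energy estimate -/

/-- With `a = m⁻¹ • y` and `ρ = r + m⁻¹ • e` one has `W + r = a + ρ`, and co-coercivity reads `κ * m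
* ‖a‖² ≤ ⟪D - ρ, a⟫ - ‖a‖²`. Hence `(1 + κ * m) * ‖a‖ ≤ ‖D‖ + ‖ρ‖`: the main part of `W + r` is
shorter than `D` by the factor `1 / (1 + κ * m)`, and everything else is charged to `ρ`. -/
lemma inner_add_le_of_coercive {E : Type*} [NormedAddCommGroup E] [InnerProductSpace ℝ E]
    {D W r y e : E} {m κ : ℝ} (hm : 0 < m) (hκ : 0 ≤ κ) (hW : m • W = y + e)
    (hy : κ * ‖y‖ ^ 2 ≤ inner ℝ (D - (W + r)) y) :
    inner ℝ D (W + r) ≤ 1 / (1 + κ * m) * ‖D‖ ^ 2 + 2 * ‖D‖ * (‖r‖ + m⁻¹ * ‖e‖) := by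
  set a := m⁻¹ • y with ha
  set ρ := r + m⁻¹ • e with hρ
  have hya : y = m • a := by rw [ha, smul_inv_smul₀ hm.ne']
  have hs : W + r = a + ρ := by
    rw [ha, hρ, ← inv_smul_smul₀ hm.ne' W, hW, smul_add]; abel
  have hq : 0 < 1 + κ * m := by positivity
  rw [hs, hya, inner_smul_right, norm_smul, Real.norm_of_nonneg hm.le] at hy
  have h1 : κ * m * ‖a‖ ^ 2 ≤ inner ℝ (D - (a + ρ)) a := by
    refine le_of_mul_le_mul_left ?_ hm
    calc _ = κ * (m * ‖a‖) ^ 2 := by ring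
      _ ≤ _ := hy
  have h2 : (inner ℝ (D - (a + ρ)) a : ℝ) = inner ℝ (D - ρ) a - ‖a‖ ^ 2 := by
    rw [← real_inner_self_eq_norm_sq, ← inner_sub_left]; congr 1; abel
  have h3 := real_inner_le_norm (D - ρ) a
  have h4 : ‖D - ρ‖ ≤ ‖D‖ + ‖ρ‖ := norm_sub_le _ _
  have h5 : (1 + κ * m) * ‖a‖ ≤ ‖D‖ + ‖ρ‖ := by
    rcases (norm_nonneg a).eq_or_lt with h0 | h0
    · rw [← h0, mul_zero]; positivity
    · refine le_of_mul_le_mul_right ?_ h0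
      nlinarith
  have h6 : ‖a‖ ≤ 1 / (1 + κ * m) * ‖D‖ + ‖ρ‖ := by
    have : ‖a‖ ≤ 1 / (1 + κ * m) * (‖D‖ + ‖ρ‖) := by
      rw [one_div, ← div_eq_inv_mul, le_div_iff₀ hq]; linarith
    have hle : 1 / (1 + κ * m) ≤ 1 := by
      rw [div_le_one hq]; nlinarith [mul_nonneg hκ hm.le]
    nlinarith [mul_le_mul_of_nonneg_right hle (norm_nonneg ρ)]
  have h7 : ‖ρ‖ ≤ ‖r‖ + m⁻¹ * ‖e‖ := by
    refine (norm_add_le _ _).trans ?_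
    rw [norm_smul, Real.norm_of_nonneg (by positivity)]
  rw [hs, inner_add_right]
  have h8 := real_inner_le_norm D a
  have h9 := real_inner_le_norm D ρ
  have h10 := mul_le_mul_of_nonneg_left h6 (norm_nonneg D)
  have h11 := mul_le_mul_of_nonneg_left h7 (norm_nonneg D)
  nlinarith

section EnergyEstimate

variable {Ω : Type*} [MeasurableSpace Ω] {γ : Measure Ω}

lemma inner_toLp {f g : Ω → Space} (hf : MemLp f 2 γ) (hg : MemLp g 2 γ) :
    (inner ℝ (hf.toLp f) (hg.toLp g) : ℝ) = ∫ z, inner ℝ (f z) (g z) ∂γ := by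
  rw [L2.inner_def]
  refine integral_congr_ae ?_
  filter_upwards [hf.coeFn_toLp, hg.coeFn_toLp] with z h1 h2
  rw [h1, h2]

lemma norm_toLp_sq {f : Ω → Space} (hf : MemLp f 2 γ) :
    ‖hf.toLp f‖ ^ 2 = ∫ z, ‖f z‖ ^ 2 ∂γ := by
  rw [← real_inner_self_eq_norm_sq, inner_toLp]
  simp only [real_inner_self_eq_norm_sq]

lemma norm_toLp_eq_sqrt {f : Ω → Space} (hf : MemLp f 2 γ) :
    ‖hf.toLp f‖ = √(∫ z, ‖f z‖ ^ 2 ∂γ) := by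
  rw [← norm_toLp_sq hf, Real.sqrt_sq (norm_nonneg _)]

end EnergyEstimate

section EnergyEstimate

variable {Ω : Type*} [MeasurableSpace Ω] {γ : Measure Ω}

lemma eLpNorm_two_le_of_lintegral_sq_le {f g : Ω → Space} {Q : ℝ≥0}
    (h : ∫⁻ z, ‖f z‖ₑ ^ (2 : ℝ) ∂γ ≤ Q * ∫⁻ z, ‖g z‖ₑ ^ (2 : ℝ) ∂γ) :
    eLpNorm f 2 γ ≤ NNReal.sqrt Q * eLpNorm g 2 γ := by
  rw [eLpNorm_eq_lintegral_rpow_enorm_toReal two_ne_zero (by simp),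
    eLpNorm_eq_lintegral_rpow_enorm_toReal two_ne_zero (by simp), ENNReal.toReal_ofNat,
    NNReal.sqrt_eq_rpow, ENNReal.coe_rpow_of_nonneg _ (by norm_num),
    ← ENNReal.mul_rpow_of_nonneg _ _ (by norm_num)]
  exact ENNReal.rpow_le_rpow h (by norm_num)

variable [IsProbabilityMeasure γ] {x₁ x₂ v₁ v₂ : Ω → Space} {u₁ u₂ : Space → Space}
  {S₁ S₂ N B : ℝ≥0} {R : ℝ}

/-- The heart of the estimate: the velocity difference is split at `X₁` into a co-coercive part and
two errors controlled by `x₁ - x₂`. The roles are asymmetric. The Stokes operator lives on the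
centres `x₁`, while the quantitative bounds `B` and `N` are asked of the second solution, whose
field and forces are the ones displaced. The bound `R` on `u₁` serves only for integrability and
does not enter the constants. -/
lemma integral_inner_velocity_le (hx₁ : Measurable x₁) (hx₂ : Measurable x₂) (hv₁ : Measurable v₁)
    (hv₂ : Measurable v₂) (hv₁2 : MemLp v₁ 2 γ) (hv₂2 : MemLp v₂ 2 γ)
    (hδ : MemLp (fun z => x₁ z - x₂ z) 2 γ) (hu₁ : Continuous u₁) (hR : ∀ a, ‖u₁ a‖ ≤ R)
    (hB : ∀ a, ‖u₂ a‖ ≤ B) (hL : LipschitzWith (B + 1) u₂)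
    (hN : ∫⁻ z, ‖v₂ z - u₂ (x₂ z)‖ₑ ^ (9 : ℝ) ∂γ ≤ N)
    (hS₁ : SingularBound γ x₁ S₁) (hS₂ : SingularBound γ x₂ S₂)
    (hrep₁ : ∀ a, blobMass • u₁ a = ∫ z, stokeslet 0 (x₁ z - a) (v₁ z - u₁ (x₁ z)) ∂γ)
    (hrep₂ : ∀ a, blobMass • u₂ a = ∫ z, stokeslet 0 (x₂ z - a) (v₂ z - u₂ (x₂ z)) ∂γ) :
    ∫ z, inner ℝ (v₁ z - v₂ z) (u₁ (x₁ z) - u₂ (x₂ z)) ∂γ ≤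
      1 / (1 + (3 * (1 + S₁ : ℝ))⁻¹ * blobMass) * ∫ z, ‖v₁ z - v₂ z‖ ^ 2 ∂γ +
      2 * (B + 1 + blobMass⁻¹ * √(36 ^ 2 * 2 * (2 * N + S₁ + S₂) * S₁)) *
        (√(∫ z, ‖v₁ z - v₂ z‖ ^ 2 ∂γ) * √(∫ z, ‖x₁ z - x₂ z‖ ^ 2 ∂γ)) := by
  have hu₂ : Continuous u₂ := hL.continuous
  have hu₁m := hu₁.measurable
  have hu₂m := hu₂.measurable
  set Q : ℝ≥0 := 36 ^ 2 * 2 * (2 * N + S₁ + S₂) * S₁ with hQ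
  set F₁ : Ω → Space := fun z => v₁ z - u₁ (x₁ z) with hF₁
  set F₂ : Ω → Space := fun z => v₂ z - u₂ (x₂ z) with hF₂
  have hF₁m : Measurable F₁ := by fun_prop
  have hF₂m : Measurable F₂ := by fun_prop
  have hbd : ∀ {u : Space → Space} {x : Ω → Space} {R : ℝ}, Measurable u → Measurable x →
      (∀ a, ‖u a‖ ≤ R) → MemLp (fun z => u (x z)) 2 γ := fun hu hx h =>
    MemLp.of_bound (hu.comp hx).aestronglyMeasurable _ (ae_of_all _ fun z => h _)
  have hF₁2 : MemLp F₁ 2 γ := hv₁2.sub (hbd hu₁m hx₁ hR)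
  have hF₂2 : MemLp F₂ 2 γ := hv₂2.sub (hbd hu₂m hx₂ hB)
  set k : Ω → Space := fun z => F₁ z - F₂ z with hk
  have hkm : Measurable k := by fun_prop
  have hk2 : MemLp k 2 γ := hF₁2.sub hF₂2
  set y := stokesPotential γ x₁ k with hy
  set e : Ω → Space := fun z =>
    ∫ z', (stokeslet 0 (x₁ z' - x₁ z) (F₂ z') - stokeslet 0 (x₂ z' - x₁ z) (F₂ z')) ∂γ with he
  have hpm : ∀ {w G : Ω → Space}, Measurable w → Measurable G →
      Measurable fun p : Ω × Ω => stokeslet 0 (w p.2 - x₁ p.1) (G p.2) := fun hw hG =>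
    measurable_stokeslet_comp 0 (by fun_prop) (by fun_prop)
  have hym : Measurable y :=
    (hpm hx₁ hkm).stronglyMeasurable.integral_prod_right'.measurable
  have hem : Measurable e :=
    ((hpm hx₁ hF₂m).sub (hpm hx₂ hF₂m)).stronglyMeasurable.integral_prod_right'.measurable
  have hle := hS₁.lintegral_sq_displacement_le hS₂ hx₁ hx₂ hF₂m hN
  have heN : eLpNorm e 2 γ ≤ NNReal.sqrt Q * eLpNorm (fun z => x₁ z - x₂ z) 2 γ :=
    eLpNorm_two_le_of_lintegral_sq_le hle
  have hfin : NNReal.sqrt Q * eLpNorm (fun z => x₁ z - x₂ z) 2 γ < ⊤ :=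
    ENNReal.mul_lt_top (by simp) hδ.eLpNorm_lt_top
  have he2 : MemLp e 2 γ := ⟨hem.aestronglyMeasurable, heN.trans_lt hfin⟩
  set W : Ω → Space := fun z => u₁ (x₁ z) - u₂ (x₁ z) with hW
  have hW2 : MemLp W 2 γ := (hbd hu₁m hx₁ hR).sub (hbd hu₂m hx₁ hB)
  -- Both fields are evaluated at `x₁`; adding and subtracting the potential of `F₂` with centres at
  -- `x₁` separates the difference of forces from the displacement of centres.
  have hWy : ∀ z, blobMass • W z = y z + e z := by
    intro z
    have i1 := hS₁.integrable_stokeslet hx₁ hF₁m hF₁2 (x₁ z)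
    have i2 := hS₁.integrable_stokeslet hx₁ hF₂m hF₂2 (x₁ z)
    have i3 := hS₂.integrable_stokeslet hx₂ hF₂m hF₂2 (x₁ z)
    have h1 : y z = (∫ z', stokeslet 0 (x₁ z' - x₁ z) (F₁ z') ∂γ) -
        ∫ z', stokeslet 0 (x₁ z' - x₁ z) (F₂ z') ∂γ := by
      rw [← integral_sub i1 i2]
      simp only [hy, stokesPotential, hk, stokeslet_sub_right]
    have h2 : e z = (∫ z', stokeslet 0 (x₁ z' - x₁ z) (F₂ z') ∂γ) -
        ∫ z', stokeslet 0 (x₂ z' - x₁ z) (F₂ z') ∂γ := integral_sub i2 i3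
    rw [h1, h2, hW, smul_sub, hrep₁, hrep₂]
    abel
  have hy2 : MemLp y 2 γ := by
    have : y = fun z => blobMass • W z - e z := funext fun z => by rw [hWy]; abel
    rw [this]
    exact (hW2.const_smul blobMass).sub he2
  set r : Ω → Space := fun z => u₂ (x₁ z) - u₂ (x₂ z) with hr
  have hr2 : MemLp r 2 γ := (hbd hu₂m hx₁ hB).sub (hbd hu₂m hx₂ hB)
  set D : Ω → Space := fun z => v₁ z - v₂ z with hD
  have hD2 : MemLp D 2 γ := hv₁2.sub hv₂2
  have hr_le : ‖hr2.toLp r‖ ≤ (B + 1) * ‖hδ.toLp _‖ := by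
    refine Lp.norm_le_mul_norm_of_ae_le_mul ?_
    filter_upwards [hr2.coeFn_toLp, hδ.coeFn_toLp] with z h1 h2
    rw [h1, h2]
    exact_mod_cast hL.norm_sub_le (x₁ z) (x₂ z)
  have he_le : ‖he2.toLp e‖ ≤ √Q * ‖hδ.toLp _‖ := by
    rw [Lp.norm_toLp, Lp.norm_toLp]
    have := ENNReal.toReal_mono hfin.ne heN
    rwa [ENNReal.toReal_mul, ENNReal.coe_toReal, Real.coe_sqrt] at this
  -- The force difference is `D` minus the total velocity difference. This feedback turns
  -- co-coercivity into a gain on `D`.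
  have hDWr : hD2.toLp D - (hW2.toLp W + hr2.toLp r) = hk2.toLp k := by
    rw [← MemLp.toLp_add, ← MemLp.toLp_sub]
    refine MemLp.toLp_congr _ _ (ae_of_all _ fun z => ?_)
    simp only [hD, hW, hr, hk, hF₁, hF₂, Pi.sub_apply, Pi.add_apply]
    abel
  have hWL : blobMass • hW2.toLp W = hy2.toLp y + he2.toLp e := by
    rw [← MemLp.toLp_const_smul, ← MemLp.toLp_add]
    exact MemLp.toLp_congr _ _ (ae_of_all _ hWy)
  have hκ : (0 : ℝ) < 3 * (1 + S₁) := by positivity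
  have hyc : (3 * (1 + S₁ : ℝ))⁻¹ * ‖hy2.toLp y‖ ^ 2 ≤
      inner ℝ (hD2.toLp D - (hW2.toLp W + hr2.toLp r)) (hy2.toLp y) := by
    rw [hDWr, inner_toLp, norm_toLp_sq, inv_mul_le_iff₀ hκ]
    exact hS₁.integral_sq_stokesPotential_le hx₁ hkm hym hk2 hy2 fun z => rfl
  have key := inner_add_le_of_coercive blobMass_pos (inv_nonneg.2 hκ.le) hWL hyc
  rw [← MemLp.toLp_add, inner_toLp] at key
  have hlhs : ∫ z, inner ℝ (D z) ((W + r) z) ∂γ =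
      ∫ z, inner ℝ (v₁ z - v₂ z) (u₁ (x₁ z) - u₂ (x₂ z)) ∂γ := by
    congr 1 with z
    simp only [hW, hr, Pi.add_apply, sub_add_sub_cancel, hD]
  rw [hlhs] at key
  rw [← norm_toLp_eq_sqrt hD2, ← norm_toLp_eq_sqrt hδ, ← norm_toLp_sq hD2]
  refine key.trans (add_le_add le_rfl ?_)
  have hm := blobMass_pos
  have hQc : (36 ^ 2 * 2 * (2 * N + S₁ + S₂) * S₁ : ℝ) = (Q : ℝ) := by rw [hQ]; push_cast; ring
  rw [hQc]
  calc _ ≤ 2 * ‖hD2.toLp D‖ * ((B + 1) * ‖hδ.toLp _‖ + blobMass⁻¹ * (√Q * ‖hδ.toLp _‖)) := by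
        gcongr
    _ = _ := by ring

end EnergyEstimate

/-! ### Differentiation of mean squares along trajectories -/

section MeanSquare

variable {Ω : Type*} [MeasurableSpace Ω] {γ : Measure Ω} {T : ℝ}

/-- The mean value inequality on `[0, T]` bounds the difference quotients at `t` by `b`, so they
converge in integral by domination; working within the interval covers the one-sided derivatives at
its ends. -/
lemma hasDerivWithinAt_integral_of_norm_deriv_le {F F' : ℝ → Ω → ℝ} {b : Ω → ℝ}
    (hint : ∀ s ∈ Icc 0 T, Integrable (F s) γ) (hb : Integrable b γ)
    (hderiv : ∀ s ∈ Icc 0 T, ∀ z, HasDerivWithinAt (fun τ => F τ z) (F' s z) (Icc 0 T) s)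
    (hle : ∀ s ∈ Icc 0 T, ∀ z, ‖F' s z‖ ≤ b z) {t : ℝ} (ht : t ∈ Icc 0 T) :
    HasDerivWithinAt (fun s => ∫ z, F s z ∂γ) (∫ z, F' t z ∂γ) (Icc 0 T) t := by
  rw [hasDerivWithinAt_iff_tendsto_slope]
  have hslope : ∀ s ∈ Icc 0 T, slope (fun s => ∫ z, F s z ∂γ) t s =
      ∫ z, slope (fun τ => F τ z) t s ∂γ := fun s hs => by
    simp only [slope_def_field]
    rw [integral_div, integral_sub (hint s hs) (hint t ht)]
  have hmem : ∀ᶠ s in 𝓝[Icc 0 T \ {t}] t, s ∈ Icc 0 T \ {t} := self_mem_nhdsWithin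
  have key : Tendsto (fun s => ∫ z, slope (fun τ => F τ z) t s ∂γ) (𝓝[Icc 0 T \ {t}] t)
      (𝓝 (∫ z, F' t z ∂γ)) := by
    refine tendsto_integral_filter_of_dominated_convergence b ?_ ?_ hb (ae_of_all _ fun z => ?_)
    · filter_upwards [hmem] with s hs
      simp only [slope_def_field]
      exact (((hint s hs.1).sub (hint t ht)).div_const _).aestronglyMeasurable
    · filter_upwards [hmem] with s hs
      refine ae_of_all _ fun z => ?_
      have h1 := (convex_Icc (0 : ℝ) T).norm_image_sub_le_of_norm_hasDerivWithin_le
        (fun τ hτ => hderiv τ hτ z) (fun τ hτ => hle τ hτ z) ht hs.1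
      have h2 : 0 < ‖s - t‖ := norm_pos_iff.2 (sub_ne_zero.2 hs.2)
      rwa [slope_def_field, norm_div, div_le_iff₀ h2]
    · exact hasDerivWithinAt_iff_tendsto_slope.1 (hderiv t ht z)
  refine key.congr' ?_
  filter_upwards [hmem] with s hs using (hslope s hs.1).symm

lemma hasDerivWithinAt_half_integral_norm_sq {A A' : ℝ → Ω → Space} {b b' : Ω → ℝ}
    (hm : ∀ s ∈ Icc 0 T, Measurable (A s))
    (hderiv : ∀ s ∈ Icc 0 T, ∀ z, HasDerivWithinAt (fun τ => A τ z) (A' s z) (Icc 0 T) s)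
    (hA : ∀ s ∈ Icc 0 T, ∀ z, ‖A s z‖ ≤ b z) (hA' : ∀ s ∈ Icc 0 T, ∀ z, ‖A' s z‖ ≤ b' z)
    (hb : MemLp b 2 γ) (hb' : MemLp b' 2 γ) {t : ℝ} (ht : t ∈ Icc 0 T) :
    MemLp (A t) 2 γ ∧ HasDerivWithinAt (fun s => 1 / 2 * ∫ z, ‖A s z‖ ^ 2 ∂γ)
      (∫ z, inner ℝ (A t z) (A' t z) ∂γ) (Icc 0 T) t := by
  have hL : ∀ s ∈ Icc 0 T, MemLp (A s) 2 γ := fun s hs =>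
    hb.mono' (hm s hs).aestronglyMeasurable (ae_of_all _ (hA s hs))
  refine ⟨hL t ht, ?_⟩
  have hI : Integrable (fun z => 2 * (b z * b' z)) γ := (hb.integrable_mul hb').const_mul 2
  have := (hasDerivWithinAt_integral_of_norm_deriv_le (γ := γ) (F := fun s z => ‖A s z‖ ^ 2)
    (F' := fun s z => 2 * inner ℝ (A s z) (A' s z))
    (fun s hs => (hL s hs).integrable_norm_pow (by norm_num)) hI
    (fun s hs z => (hderiv s hs z).norm_sq) (fun s hs z => ?_) ht).const_mul (1 / 2)
  · rwa [integral_const_mul, ← mul_assoc, one_div, inv_mul_cancel₀ two_ne_zero, one_mul,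
      ← one_div] at this
  · rw [norm_mul, Real.norm_ofNat]
    refine mul_le_mul_of_nonneg_left ((norm_inner_le_norm _ _).trans ?_) zero_le_two
    exact mul_le_mul (hA s hs z) (hA' s hs z) (norm_nonneg _) ((norm_nonneg _).trans (hA s hs z))

lemma integral_inner_le_sqrt_mul_sqrt {f g : Ω → Space} (hf : MemLp f 2 γ) (hg : MemLp g 2 γ) :
    ∫ z, inner ℝ (f z) (g z) ∂γ ≤ √(∫ z, ‖f z‖ ^ 2 ∂γ) * √(∫ z, ‖g z‖ ^ 2 ∂γ) := by
  rw [← inner_toLp hf hg, ← norm_toLp_eq_sqrt hf, ← norm_toLp_eq_sqrt hg]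
  exact real_inner_le_norm _ _

end MeanSquare

section Characteristics

variable {lam T : ℝ} {g : Space} {u₁ u₂ : ℝ → Space → Space}
  {X₁ V₁ X₂ V₂ : ℝ → ℝ → Space → Space → Space} {γ : Measure (Phase × Phase)}
  [IsProbabilityMeasure γ] {R : ℝ≥0}

/-- Along trajectories velocities are bounded by multiples of `1 + ‖v‖`, and position differences by
the initial difference plus `T` times the velocity bound. These majorants are square integrable
although the positions themselves need not be. The gravity term cancels in the difference. -/
lemma IsCharacteristics.hasDerivWithinAt_halfMeanSq (h₁ : IsCharacteristics lam T g u₁ X₁ V₁)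
    (h₂ : IsCharacteristics lam T g u₂ X₂ V₂) (hlam : 0 < lam) (hT : 0 < T) (hg : ‖g‖ = 1)
    (hR₁ : ∀ t ∈ Icc 0 T, ∀ x, ‖u₁ t x‖ ≤ R) (hR₂ : ∀ t ∈ Icc 0 T, ∀ x, ‖u₂ t x‖ ≤ R)
    {t : ℝ} (ht : t ∈ Icc 0 T) (hu₁ : Continuous (u₁ t)) (hu₂ : Continuous (u₂ t))
    (hc₁ : ∀ t ∈ Icc 0 T, Continuous (phaseFlow X₁ V₁ t 0))
    (hc₂ : ∀ t ∈ Icc 0 T, Continuous (phaseFlow X₂ V₂ t 0))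
    (hv₁ : MemLp (fun z : Phase × Phase => z.1.2) 2 γ)
    (hv₂ : MemLp (fun z : Phase × Phase => z.2.2) 2 γ)
    (hδ : MemLp (fun z : Phase × Phase => z.1.1 - z.2.1) 2 γ) :
    (MemLp (fun z : Phase × Phase => V₁ t 0 z.1.1 z.1.2) 2 γ ∧
      MemLp (fun z : Phase × Phase => V₂ t 0 z.2.1 z.2.2) 2 γ ∧
      MemLp (fun z : Phase × Phase => X₁ t 0 z.1.1 z.1.2 - X₂ t 0 z.2.1 z.2.2) 2 γ) ∧
    HasDerivWithinAt (halfMeanSq γ X₁ X₂)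
      (∫ z, inner ℝ (X₁ t 0 z.1.1 z.1.2 - X₂ t 0 z.2.1 z.2.2)
        (V₁ t 0 z.1.1 z.1.2 - V₂ t 0 z.2.1 z.2.2) ∂γ) (Icc 0 T) t ∧
    HasDerivWithinAt (halfMeanSq γ V₁ V₂)
      (lam * ((∫ z, inner ℝ (V₁ t 0 z.1.1 z.1.2 - V₂ t 0 z.2.1 z.2.2)
        (u₁ t (X₁ t 0 z.1.1 z.1.2) - u₂ t (X₂ t 0 z.2.1 z.2.2)) ∂γ) -
        ∫ z, ‖V₁ t 0 z.1.1 z.1.2 - V₂ t 0 z.2.1 z.2.2‖ ^ 2 ∂γ)) (Icc 0 T) t := by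
  have h0 : (0 : ℝ) ∈ Icc 0 T := ⟨le_rfl, hT.le⟩
  set E := Real.exp (lam * (1 + R) * T) with hE
  set b : Phase × Phase → ℝ := fun z => (1 + ‖z.1.2‖) * E + (1 + ‖z.2.2‖) * E with hb
  have hb₁ : MemLp (fun z : Phase × Phase => (1 + ‖z.1.2‖) * E) 2 γ :=
    ((memLp_const (1 : ℝ)).add hv₁.norm).mul_const E
  have hb₂ : MemLp (fun z : Phase × Phase => (1 + ‖z.2.2‖) * E) 2 γ :=
    ((memLp_const (1 : ℝ)).add hv₂.norm).mul_const E
  have hbL : MemLp b 2 γ := hb₁.add hb₂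
  have hV₁b : ∀ s ∈ Icc 0 T, ∀ z : Phase × Phase, ‖V₁ s 0 z.1.1 z.1.2‖ ≤ (1 + ‖z.1.2‖) * E :=
    fun s hs z => h₁.norm_velocity_le hlam hg hR₁ hs _ _
  have hV₂b : ∀ s ∈ Icc 0 T, ∀ z : Phase × Phase, ‖V₂ s 0 z.2.1 z.2.2‖ ≤ (1 + ‖z.2.2‖) * E :=
    fun s hs z => h₂.norm_velocity_le hlam hg hR₂ hs _ _
  have hVb : ∀ s ∈ Icc 0 T, ∀ z : Phase × Phase,
      ‖V₁ s 0 z.1.1 z.1.2 - V₂ s 0 z.2.1 z.2.2‖ ≤ b z := fun s hs z =>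
    (norm_sub_le _ _).trans (add_le_add (hV₁b s hs z) (hV₂b s hs z))
  have hXm₁ : ∀ s ∈ Icc 0 T, Measurable fun z : Phase × Phase => X₁ s 0 z.1.1 z.1.2 := fun s hs =>
    (continuous_fst.comp ((hc₁ s hs).comp continuous_fst)).measurable
  have hXm₂ : ∀ s ∈ Icc 0 T, Measurable fun z : Phase × Phase => X₂ s 0 z.2.1 z.2.2 := fun s hs =>
    (continuous_fst.comp ((hc₂ s hs).comp continuous_snd)).measurable
  have hVm₁ : ∀ s ∈ Icc 0 T, Measurable fun z : Phase × Phase => V₁ s 0 z.1.1 z.1.2 := fun s hs =>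
    (continuous_snd.comp ((hc₁ s hs).comp continuous_fst)).measurable
  have hVm₂ : ∀ s ∈ Icc 0 T, Measurable fun z : Phase × Phase => V₂ s 0 z.2.1 z.2.2 := fun s hs =>
    (continuous_snd.comp ((hc₂ s hs).comp continuous_snd)).measurable
  have hXd : ∀ s ∈ Icc 0 T, ∀ z : Phase × Phase,
      HasDerivWithinAt (fun τ => X₁ τ 0 z.1.1 z.1.2 - X₂ τ 0 z.2.1 z.2.2)
        (V₁ s 0 z.1.1 z.1.2 - V₂ s 0 z.2.1 z.2.2) (Icc 0 T) s := fun s hs z =>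
    (h₁.position_deriv 0 h0 _ _ s hs).sub (h₂.position_deriv 0 h0 _ _ s hs)
  have hXb : ∀ s ∈ Icc 0 T, ∀ z : Phase × Phase,
      ‖X₁ s 0 z.1.1 z.1.2 - X₂ s 0 z.2.1 z.2.2‖ ≤ ‖z.1.1 - z.2.1‖ + b z * T := by
    intro s hs z
    have h1 := (convex_Icc (0 : ℝ) T).norm_image_sub_le_of_norm_hasDerivWithin_le
      (fun τ hτ => hXd τ hτ z) (fun τ hτ => hVb τ hτ z) h0 hs
    simp only [h₁.position_initial 0 h0, h₂.position_initial 0 h0, sub_zero] at h1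
    rw [Real.norm_of_nonneg hs.1] at h1
    have h2 := norm_le_insert' (X₁ s 0 z.1.1 z.1.2 - X₂ s 0 z.2.1 z.2.2) (z.1.1 - z.2.1)
    have h3 : b z * s ≤ b z * T :=
      mul_le_mul_of_nonneg_left hs.2 ((norm_nonneg _).trans (hVb s hs z))
    linarith
  have hVd : ∀ s ∈ Icc 0 T, ∀ z : Phase × Phase,
      HasDerivWithinAt (fun τ => V₁ τ 0 z.1.1 z.1.2 - V₂ τ 0 z.2.1 z.2.2)
        (lam • (g + u₁ s (X₁ s 0 z.1.1 z.1.2) - V₁ s 0 z.1.1 z.1.2) -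
          lam • (g + u₂ s (X₂ s 0 z.2.1 z.2.2) - V₂ s 0 z.2.1 z.2.2)) (Icc 0 T) s := fun s hs z =>
    (h₁.velocity_deriv 0 h0 _ _ s hs).sub (h₂.velocity_deriv 0 h0 _ _ s hs)
  have hVd' : ∀ s (z : Phase × Phase),
      lam • (g + u₁ s (X₁ s 0 z.1.1 z.1.2) - V₁ s 0 z.1.1 z.1.2) -
          lam • (g + u₂ s (X₂ s 0 z.2.1 z.2.2) - V₂ s 0 z.2.1 z.2.2) =
      lam • ((u₁ s (X₁ s 0 z.1.1 z.1.2) - u₂ s (X₂ s 0 z.2.1 z.2.2)) -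
        (V₁ s 0 z.1.1 z.1.2 - V₂ s 0 z.2.1 z.2.2)) := fun s z => by
    rw [← smul_sub]; congr 1; abel
  simp only [hVd'] at hVd
  have hub : ∀ s ∈ Icc 0 T, ∀ z : Phase × Phase,
      ‖u₁ s (X₁ s 0 z.1.1 z.1.2) - u₂ s (X₂ s 0 z.2.1 z.2.2)‖ ≤ R + R := fun s hs z =>
    (norm_sub_le _ _).trans (add_le_add (hR₁ s hs _) (hR₂ s hs _))
  obtain ⟨hXL, hXH⟩ := hasDerivWithinAt_half_integral_norm_sq (γ := γ)
    (fun s hs => (hXm₁ s hs).sub (hXm₂ s hs)) hXd hXb hVb (hδ.norm.add (hbL.mul_const T)) hbL ht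
  obtain ⟨hVL, hVE⟩ := hasDerivWithinAt_half_integral_norm_sq (γ := γ)
    (b' := fun z => lam * (R + R + b z))
    (fun s hs => (hVm₁ s hs).sub (hVm₂ s hs)) hVd hVb (fun s hs z => by
      rw [norm_smul, Real.norm_of_nonneg hlam.le]
      exact mul_le_mul_of_nonneg_left ((norm_sub_le _ _).trans
        (add_le_add (hub s hs z) (hVb s hs z))) hlam.le) hbL
    (((memLp_const (R + R : ℝ)).add hbL).const_mul lam) ht
  refine ⟨⟨hb₁.mono' (hVm₁ t ht).aestronglyMeasurable (ae_of_all _ (hV₁b t ht)),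
    hb₂.mono' (hVm₂ t ht).aestronglyMeasurable (ae_of_all _ (hV₂b t ht)), hXL⟩, hXH, ?_⟩
  refine HasDerivWithinAt.congr_deriv hVE ?_
  have hi₁ : Integrable (fun z : Phase × Phase =>
      (inner ℝ (V₁ t 0 z.1.1 z.1.2 - V₂ t 0 z.2.1 z.2.2)
        (u₁ t (X₁ t 0 z.1.1 z.1.2) - u₂ t (X₂ t 0 z.2.1 z.2.2)) : ℝ)) γ := by
    refine ((hbL.integrable one_le_two).mul_const (R + R : ℝ)).mono'
      (((hVm₁ t ht).sub (hVm₂ t ht)).inner ((hu₁.measurable.comp (hXm₁ t ht)).sub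
        (hu₂.measurable.comp (hXm₂ t ht)))).aestronglyMeasurable (ae_of_all _ fun z => ?_)
    refine (norm_inner_le_norm _ _).trans ?_
    exact mul_le_mul (hVb t ht z) (hub t ht z) (norm_nonneg _) ((norm_nonneg _).trans (hVb t ht z))
  have hi₂ : Integrable (fun z : Phase × Phase =>
      ‖V₁ t 0 z.1.1 z.1.2 - V₂ t 0 z.2.1 z.2.2‖ ^ 2) γ := hVL.integrable_norm_pow (by norm_num)
  rw [← integral_sub hi₁ hi₂, ← integral_const_mul]
  congr 1 with z
  rw [real_inner_smul_right, inner_sub_right, ← real_inner_self_eq_norm_sq]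
  rfl

end Characteristics

/-! ### Transport of a solution to a transport plan -/

section Pullback

variable {Ω : Type*} [MeasurableSpace Ω] {γ : Measure Ω} {π : Ω → Phase} {K lam T : ℝ}
  {g : Space} {f : ℝ → Measure Phase} {u : ℝ → Space → Space}
  {X V : ℝ → ℝ → Space → Space → Space} {S : ℝ≥0}

/-- Taking the initial datum of the form `γ.map π`, with `π` a projection of the transport plan,
places both solutions on one probability space, where their forces can be subtracted. -/
lemma IsVlasovStokesSolution.eq_map_comp
    (h : IsVlasovStokesSolution K lam T g (γ.map π) f u) (hXV : IsCharacteristics lam T g u X V)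
    (hπ : Measurable π) (hT : 0 < T) {t : ℝ} (ht : t ∈ Icc 0 T) :
    Measurable (fun z => phaseFlow X V t 0 (π z)) ∧
      f t = γ.map (fun z => phaseFlow X V t 0 (π z)) := by
  obtain ⟨hc, hf⟩ := h.eq_map hXV hT ht
  rw [hf, Measure.map_map hc.measurable hπ]
  exact ⟨hc.measurable.comp hπ, rfl⟩

lemma IsVlasovStokesSolution.velocity_eq_integral_comp
    (h : IsVlasovStokesSolution K lam T g (γ.map π) f u) (hXV : IsCharacteristics lam T g u X V)
    (hπ : Measurable π) (hK : 2 ≤ K) (hlam : 0 < lam) (hT : 0 < T) (hg : ‖g‖ = 1)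
    (hm : moment K (γ.map π) < ⊤) {t : ℝ} (ht : t ∈ Icc 0 T)
    (hS : SingularBound (f t) Prod.fst S) :
    SingularBound γ (fun z => X t 0 (π z).1 (π z).2) S ∧
      ∀ a, blobMass • u t a = ∫ z, stokeslet 0 (X t 0 (π z).1 (π z).2 - a)
        (V t 0 (π z).1 (π z).2 - u t (X t 0 (π z).1 (π z).2)) ∂γ := by
  obtain ⟨hc, hf⟩ := h.eq_map_comp hXV hπ hT ht
  have hu := (h.continuous_velocity ht).measurable
  refine ⟨fun a => ?_, fun a => ?_⟩
  · have := hS a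
    rwa [hf, lintegral_map (by fun_prop) hc] at this
  · rw [(h.velocity_eq_integral hXV hK hlam hT hg hm ht hS a).2, hf, integral_map hc.aemeasurable]
    · rfl
    · exact (measurable_stokeslet_comp 0 (f := fun z : Phase => z.1 - a)
        (g := fun z : Phase => z.2 - u t z.1) (by fun_prop) (by fun_prop)).aestronglyMeasurable

end Pullback

/-- Convexity of the ninth power, with factor `2 ^ 8`, turns the ninth velocity moment and a sup
bound on the fluid velocity into the ninth moment of the drag force. -/
lemma lintegral_sub_rpow_nine_le {Ω : Type*} [MeasurableSpace Ω] {γ : Measure Ω}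
    [IsProbabilityMeasure γ] {v w : Ω → Space} {M B : ℝ≥0}
    (hM : ∫⁻ z, ‖v z‖ₑ ^ (9 : ℝ) ∂γ ≤ M) (hB : ∀ z, ‖w z‖ ≤ B) :
    ∫⁻ z, ‖v z - w z‖ₑ ^ (9 : ℝ) ∂γ ≤ (2 ^ 8 * (M + B ^ 9) : ℝ≥0) := by
  have hpt : ∀ z, ‖v z - w z‖ₑ ^ (9 : ℝ) ≤ 2 ^ 8 * (‖v z‖ₑ ^ (9 : ℝ) + (B : ℝ≥0∞) ^ 9) := fun z => by
    have h1 : ‖w z‖ₑ ≤ B := by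
      rw [← ofReal_norm, ← ENNReal.ofReal_coe_nnreal]
      exact ENNReal.ofReal_le_ofReal (hB z)
    calc _ ≤ (‖v z‖ₑ + B) ^ (9 : ℝ) :=
          ENNReal.rpow_le_rpow (enorm_sub_le.trans (by gcongr)) (by norm_num)
      _ ≤ _ := by
          have := ENNReal.rpow_add_le_mul_rpow_add_rpow ‖v z‖ₑ B (p := 9) (by norm_num)
          norm_num at this ⊢
          exact this
  refine (lintegral_mono hpt).trans ?_
  rw [lintegral_const_mul' _ _ (by finiteness), lintegral_add_right _ measurable_const,
    lintegral_const, measure_univ, mul_one]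
  push_cast
  gcongr

lemma memLp_two_of_lintegral_sq_lt_top {Ω : Type*} [MeasurableSpace Ω] {γ : Measure Ω}
    {w : Ω → Space} (hw : Measurable w) (h : ∫⁻ z, ‖w z‖ₑ ^ 2 ∂γ < ⊤) : MemLp w 2 γ := by
  refine ⟨hw.aestronglyMeasurable, ?_⟩
  rw [eLpNorm_lt_top_iff_lintegral_rpow_enorm_lt_top (by norm_num) (by norm_num)]
  simpa using h

end VlasovStokes

end

/-! ### Proof of the proposition -/

theorem proposition5p1 (q : ℝ≥0∞) (hq : 4 < q) (A₁ A₂ B M : ℝ≥0) :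
    ∃ c C : ℝ, 0 < c ∧
      ∀ (K lam T : ℝ), 9 < K → 0 < lam → 0 < T →
      ∀ g : Space, ‖g‖ = 1 →
      ∀ f₁₀ f₂₀ : Measure Phase, IsProbabilityMeasure f₁₀ → IsProbabilityMeasure f₂₀ →
      (∃ R : ℝ≥0, DensityBoundedBy f₁₀ R) → (∃ R : ℝ≥0, DensityBoundedBy f₂₀ R) →
      moment K f₁₀ < ⊤ → moment K f₂₀ < ⊤ →
      ∀ (f₁ f₂ : ℝ → Measure Phase) (u₁ u₂ : ℝ → Space → Space),
      IsVlasovStokesSolution K lam T g f₁₀ f₁ u₁ →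
      IsVlasovStokesSolution K lam T g f₂₀ f₂ u₂ →
      ∀ X₁ V₁ X₂ V₂ : ℝ → ℝ → Space → Space → Space,
      IsCharacteristics lam T g u₁ X₁ V₁ → IsCharacteristics lam T g u₂ X₂ V₂ →
      ∀ γ₀ : Measure (Phase × Phase), IsTransportPlan γ₀ f₁₀ f₂₀ →
      ∫⁻ z, ‖z.1.1 - z.2.1‖ₑ ^ 2 ∂γ₀ < ⊤ →
      ∀ t ∈ Icc 0 T,
        Integrable (sqDiff X₁ X₂ t) γ₀ ∧ Integrable (sqDiff V₁ V₂ t) γ₀ ∧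
        ∃ H' E' : ℝ,
          HasDerivWithinAt (halfMeanSq γ₀ X₁ X₂) H' (Icc 0 T) t ∧
          HasDerivWithinAt (halfMeanSq γ₀ V₁ V₂) E' (Icc 0 T) t ∧
          H' ≤ 2 * √(halfMeanSq γ₀ V₁ V₂ t) * √(halfMeanSq γ₀ X₁ X₂ t) ∧
          (lqNorm q (spatialDensity (f₁ t)) ≤ A₁ → lqNorm q (spatialDensity (f₂ t)) ≤ A₂ →
            w1InfNorm (u₂ t) ≤ B → moment 9 (f₂ t) ≤ M →
            E' ≤ lam * (-c * halfMeanSq γ₀ V₁ V₂ t +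
              C * √(halfMeanSq γ₀ V₁ V₂ t) * √(halfMeanSq γ₀ X₁ X₂ t))) := by
  obtain ⟨S₁, hS₁⟩ := exists_singularBound hq A₁
  obtain ⟨S₂, hS₂⟩ := exists_singularBound hq A₂
  have hmass := blobMass_pos
  set N : ℝ≥0 := 2 ^ 8 * (M + B ^ 9) with hN
  set c₀ : ℝ := 1 / (1 + (3 * (1 + S₁ : ℝ))⁻¹ * blobMass) with hc₀
  set C₀ : ℝ := 2 * (B + 1 + blobMass⁻¹ * √(36 ^ 2 * 2 * (2 * N + S₁ + S₂) * S₁)) with hC₀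
  -- The strict gain over the friction term `-∫ ‖D‖²` comes from the positive co-coercivity
  -- constant; it depends only on `q` and `A₁`, through `S₁`.
  have hc₀1 : c₀ < 1 := by
    rw [hc₀, div_lt_one (by positivity)]
    have : 0 < (3 * (1 + S₁ : ℝ))⁻¹ * blobMass := by positivity
    linarith
  -- The factors `2` undo the `1/2` in `halfMeanSq`: the mean square velocity difference is `2ℰ`,
  -- and the product of the two root mean squares is `2 √ℰ √ℋ`.
  refine ⟨2 * (1 - c₀), 2 * C₀, by linarith, ?_⟩
  rintro K lam T hK hlam hT g hg _ _ hp₁ hp₂ - - hm₁ hm₂ f₁ f₂ u₁ u₂ h₁ h₂ X₁ V₁ X₂ V₂ hXV₁ hXV₂ γ₀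
    ⟨rfl, rfl⟩ hδ t ht
  have : IsProbabilityMeasure γ₀ := ⟨by
    rw [← hp₁.measure_univ, Measure.map_apply measurable_fst MeasurableSet.univ, preimage_univ]⟩
  obtain ⟨R₁, hR₁⟩ := h₁.exists_velocity_bounds hT
  obtain ⟨R₂, hR₂⟩ := h₂.exists_velocity_bounds hT
  have hv : ∀ {π : Phase × Phase → Phase}, Measurable π → moment K (γ₀.map π) < ⊤ →
      MemLp (fun z => (π z).2) 2 γ₀ := fun {π} hπ hm => by
    have := Measure.isProbabilityMeasure_map (μ := γ₀) hπ.aemeasurable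
    have h2 := memLp_snd_of_moment (by linarith) hm (p := 2) (by
      rw [← ENNReal.ofReal_ofNat 2]; exact ENNReal.ofReal_le_ofReal (by linarith))
    exact h2.comp_measurePreserving ⟨hπ, rfl⟩
  have hu₁ := h₁.continuous_velocity ht
  have hu₂ := h₂.continuous_velocity ht
  obtain ⟨⟨hV₁, hV₂, hX⟩, hH, hE⟩ := hXV₁.hasDerivWithinAt_halfMeanSq hXV₂ hlam hT hg
    (R := max R₁ R₂)
    (fun s hs x => ((hR₁ s hs).1 x).trans (by exact_mod_cast le_max_left _ _))
    (fun s hs x => ((hR₂ s hs).1 x).trans (by exact_mod_cast le_max_right _ _)) ht hu₁ hu₂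
    (fun s hs => (h₁.eq_map hXV₁ hT hs).1) (fun s hs => (h₂.eq_map hXV₂ hT hs).1)
    (hv measurable_fst hm₁) (hv measurable_snd hm₂)
    (memLp_two_of_lintegral_sq_lt_top (by fun_prop) hδ)
  have hD := hV₁.sub hV₂
  refine ⟨hX.integrable_norm_pow (by norm_num), hD.integrable_norm_pow (by norm_num), _, _, hH, hE,
    ?_, fun hA₁ hA₂ hB hM => ?_⟩
  all_goals
    have hsqrt : ∀ Y₁ Y₂ : ℝ → ℝ → Space → Space → Space,
        √(∫ z, ‖Y₁ t 0 z.1.1 z.1.2 - Y₂ t 0 z.2.1 z.2.2‖ ^ 2 ∂γ₀) =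
          √2 * √(halfMeanSq γ₀ Y₁ Y₂ t) := fun Y₁ Y₂ => by
      rw [← Real.sqrt_mul zero_le_two, halfMeanSq, ← mul_assoc, mul_one_div_cancel two_ne_zero,
        one_mul]
      rfl
    have h22 : √2 * √2 = (2 : ℝ) := Real.mul_self_sqrt zero_le_two
  · refine (integral_inner_le_sqrt_mul_sqrt hX hD).trans_eq ?_
    have := hsqrt V₁ V₂
    rw [hsqrt X₁ X₂]
    simp only [Pi.sub_apply]
    rw [this]
    linear_combination √(halfMeanSq γ₀ X₁ X₂ t) * √(halfMeanSq γ₀ V₁ V₂ t) * h22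
  · obtain ⟨hm₁', hf₁⟩ := h₁.eq_map_comp hXV₁ measurable_fst hT ht
    obtain ⟨hm₂', hf₂⟩ := h₂.eq_map_comp hXV₂ measurable_snd hT ht
    have hxm₁ := hm₁'.fst
    have hvm₁ := hm₁'.snd
    have hxm₂ := hm₂'.fst
    have hvm₂ := hm₂'.snd
    obtain ⟨hs₁, hrep₁⟩ := h₁.velocity_eq_integral_comp hXV₁ measurable_fst (by linarith) hlam hT hg
      hm₁ ht (hS₁ _ (h₁.isProbabilityMeasure t ht) hA₁)
    obtain ⟨hs₂, hrep₂⟩ := h₂.velocity_eq_integral_comp hXV₂ measurable_snd (by linarith) hlam hT hg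
      hm₂ ht (hS₂ _ (h₂.isProbabilityMeasure t ht) hA₂)
    obtain ⟨hb, hL⟩ := w1InfNorm_bounds hu₂ hB
    have hM9 : ∫⁻ z, ‖V₂ t 0 z.2.1 z.2.2‖ₑ ^ (9 : ℝ) ∂γ₀ ≤ M := by
      rw [moment, hf₂, lintegral_map (by fun_prop) hm₂'] at hM
      exact hM
    have key := integral_inner_velocity_le hxm₁ hxm₂ hvm₁ hvm₂ hV₁ hV₂ hX hu₁ (hR₁ t ht).1 hb hL
      (lintegral_sub_rpow_nine_le hM9 fun z => hb _) hs₁ hs₂ hrep₁ hrep₂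
    simp only [phaseFlow] at key
    rw [← hc₀, ← hN, ← hC₀, hsqrt V₁ V₂, hsqrt X₁ X₂] at key
    have hP : ∫ z, ‖V₁ t 0 z.1.1 z.1.2 - V₂ t 0 z.2.1 z.2.2‖ ^ 2 ∂γ₀ =
        2 * halfMeanSq γ₀ V₁ V₂ t := by
      rw [halfMeanSq, ← mul_assoc, mul_one_div_cancel two_ne_zero, one_mul]
      rfl
    rw [hP] at key ⊢
    refine mul_le_mul_of_nonneg_left ?_ hlam.le
    have e : √2 * √(halfMeanSq γ₀ V₁ V₂ t) * (√2 * √(halfMeanSq γ₀ X₁ X₂ t)) =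
        2 * (√(halfMeanSq γ₀ V₁ V₂ t) * √(halfMeanSq γ₀ X₁ X₂ t)) := by
      linear_combination √(halfMeanSq γ₀ X₁ X₂ t) * √(halfMeanSq γ₀ V₁ V₂ t) * h22
    rw [e] at key
    linarith
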